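/- **Proposition (odd anchor).** All supermanifolds are smooth (a second countable Hausdorff space $|M|$ with a sheaf $\mathcal O_M$ of real supercommutative superalgebras, locally isomorphic to $\mathbb R^{n|m}=(\mathbb R^n, C^\infty(\mathbb R^n)\otimes\Lambda(\xi^1,\dots,\xi^m))$). A vector field on $M$ is a ($\mathbb Z_2$-graded) derivation of $\mathcal O_M$; a Q-manifold $(M,Q)$ is a supermanifold $M$ with an odd vector field $Q$ such that $Q^2=0$; a morphism of Q-manifolds $(M_1,Q_1)\to(M_2,Q_2)$ is a morphism of supermanifolds $\psi$ with $Q_1\circ\psi^*=\psi^*\circ Q_2$. An antitangent bundle of a supermanifold $M$, with its de Rham differential $\mathrm d$, is a supermanifold $\Pi\mathsf TM$ with a morphism $\pi:\Pi\mathsf TM\to M$ and an odd vector field $\mathrm d$ on $\Pi\mathsf TM$ such that, for every coordinate chart of $M$ with domain $U$ and coordinates $x^a$ of parity $\widetilde a$, the functions $x^a$ (short for $\pi^*x^a$) and $\mathrm dx^b:=\mathrm d(\pi^*x^b)$, the latter of parity $\widetilde b+1$, are the coordinates of a chart of $\Pi\mathsf TM$ with domain $\pi^{-1}(U)$, whose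 even fibre coordinates (the $\mathrm dx^b$ with $\widetilde b=1$) together take all real values over each point of $U$; and $\mathrm d=\mathrm dx^a\,\partial/\partial x^a$, i.e. $\mathrm d(\mathrm dx^a)=0$. Let $(M,Q)$ be a Q-manifold of dimension $n|m$. Then an antitangent bundle of $M$ exists, and for every antitangent bundle $(\Pi\mathsf TM,\pi,\mathrm d)$ of $M$: 1. $(\Pi\mathsf TM,\mathrm d)$ is a Q-manifold, i.e. $\mathrm d^2=0$; 2. there is exactly one morphism of supermanifolds $a_Q:M\to\Pi\mathsf TM$ (the odd anchor: $Q$ regarded as a section of the antitangent bundle) that lies over the identity of $|M|$ and is given in all local coordinates by $a_Q^*(x^a,\mathrm dx^b)=(x^a,Q^b)$, where $Q=Q^a\,\partial/\partial x^a$, that is $Q^b=Q(x^b)$; 3. $a_Q$ is a morphism of Q-manifolds $(M,Q)\to(\Pi\mathsf TM,\mathrm d)$, that is $$Q\circ a_Q^*=a_Q^*\circ \mathrm d .$$ -/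

import Mathlib

universe u

open TopologicalSpace Set
open scoped Manifold ContDiff TensorProduct

noncomputable section

namespace Super

/-! ### The local model `C^∞(V) ⊗ Λ(ξ)` -/

/-- Smooth real functions on an open subset `V` of `ℝ^ι`. -/
abbrev Smooth (ι : Type) [Fintype ι] (V : Opens (ι → ℝ)) : Type :=
  ContMDiffMap 𝓘(ℝ, ι → ℝ) 𝓘(ℝ, ℝ) V ℝ ∞

/-- Functions on the superdomain with body `V ⊆ ℝ^ι` and anticommuting coordinates
`ξ^j`, `j ∈ κ`: the algebra `C^∞(V) ⊗ Λ(ξ)`. -/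
abbrev Model (ι κ : Type) [Fintype ι] [Fintype κ] (V : Opens (ι → ℝ)) : Type :=
  Smooth ι V ⊗[ℝ] ExteriorAlgebra ℝ (κ → ℝ)

/-- Restriction of smooth functions to a smaller open set. -/
def Smooth.res {ι : Type} [Fintype ι] {U V : Opens (ι → ℝ)} (h : U ≤ V) :
    Smooth ι V →ₐ[ℝ] Smooth ι U where
  toFun f := ⟨fun x => f (inclusion h x), f.contMDiff.comp (contMDiff_inclusion h)⟩
  map_one' := rfl
  map_mul' _ _ := rfl
  map_zero' := rfl
  map_add' _ _ := rfl
  commutes' _ := rfl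

/-- The `μ`-th coordinate of `ℝ^ι` as a smooth function on `V`. -/
def Smooth.coord {ι : Type} [Fintype ι] (V : Opens (ι → ℝ)) (μ : ι) : Smooth ι V :=
  ⟨fun x => x.1 μ, ((contDiff_apply ℝ ℝ μ).contMDiff).comp contMDiff_subtype_val⟩

namespace Model

variable {ι κ : Type} [Fintype ι] [Fintype κ]

/-- Restriction of functions on a superdomain. -/
def res {U V : Opens (ι → ℝ)} (h : U ≤ V) : Model ι κ V →ₐ[ℝ] Model ι κ U :=
  Algebra.TensorProduct.map (Smooth.res h) (AlgHom.id ℝ _)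

/-- The even (`i = 0`) and odd (`i = 1`) functions on a superdomain. -/
def par (V : Opens (ι → ℝ)) (i : ZMod 2) : Submodule ℝ (Model ι κ V) :=
  LinearMap.range (LinearMap.lTensor (Smooth ι V)
    (CliffordAlgebra.evenOdd (0 : QuadraticForm ℝ (κ → ℝ)) i).subtype)

/-- The standard even coordinates `x^μ`. -/
def even (V : Opens (ι → ℝ)) (μ : ι) : Model ι κ V :=
  Smooth.coord V μ ⊗ₜ[ℝ] 1

open Classical in
/-- The standard odd coordinates `ξ^j`. -/
def odd (V : Opens (ι → ℝ)) (j : κ) : Model ι κ V :=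
  (1 : Smooth ι V) ⊗ₜ[ℝ] ExteriorAlgebra.ι ℝ (Pi.single j (1 : ℝ))

end Model

/-! ### Sheaves of superalgebras and supermanifolds -/

/-- A sheaf of real supercommutative superalgebras on a topological space. -/
structure SuperSheaf (X : Type u) [TopologicalSpace X] where
  /-- sections over an open set -/
  Sec : Opens X → Type u
  [ring : ∀ U, Ring (Sec U)]
  [algebra : ∀ U, Algebra ℝ (Sec U)]
  /-- the even and the odd sections -/
  par : ∀ U, ZMod 2 → Submodule ℝ (Sec U)
  [graded : ∀ U, GradedAlgebra (par U)]
  supercomm : ∀ (U : Opens X) (i j : ZMod 2) (f g : Sec U), f ∈ par U i → g ∈ par U j →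
    f * g = (-1 : ℝ) ^ (i * j).val • (g * f)
  /-- restriction maps -/
  res : ∀ {U V : Opens X}, U ≤ V → Sec V →ₐ[ℝ] Sec U
  res_par : ∀ {U V : Opens X} (h : U ≤ V) (i : ZMod 2) (f : Sec V),
    f ∈ par V i → res h f ∈ par U i
  res_self : ∀ (U : Opens X) (f : Sec U), res le_rfl f = f
  res_res : ∀ {U V W : Opens X} (h : U ≤ V) (k : V ≤ W) (f : Sec W),
    res h (res k f) = res (h.trans k) f
  /-- compatible sections over the members of an open cover glue in exactly one way -/
  glue : ∀ {I : Type u} (U : I → Opens X) (s : ∀ i, Sec (U i)),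
    (∀ i j, res (inf_le_left : U i ⊓ U j ≤ U i) (s i)
      = res (inf_le_right : U i ⊓ U j ≤ U j) (s j)) →
    ∃! f : Sec (⨆ i, U i), ∀ i, res (le_iSup U i) f = s i

attribute [instance] SuperSheaf.ring SuperSheaf.algebra SuperSheaf.graded

/-- A coordinate chart with even coordinates indexed by `ι` and odd ones by `κ`: an
isomorphism of an open part of `(X, O)` with a superdomain, that is a homeomorphism `e` of open
sets together with an isomorphism of the sheaves of superalgebras over `e`. -/
structure Chart {X : Type u} [TopologicalSpace X] (O : SuperSheaf X) (ι κ : Type)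
    [Fintype ι] [Fintype κ] where
  /-- the homeomorphism of the underlying open sets -/
  e : OpenPartialHomeomorph X (ι → ℝ)
  /-- the isomorphism on sections over `U ⊆ e.source` and over its image `V` -/
  iso : ∀ (U : Opens X) (V : Opens (ι → ℝ)), (U : Set X) ⊆ e.source → e '' U = V →
    Model ι κ V ≃ₐ[ℝ] O.Sec U
  iso_res : ∀ (U U₁ : Opens X) (V V₁ : Opens (ι → ℝ)) (hU : (U : Set X) ⊆ e.source)
    (hV : e '' U = V) (hU₁ : (U₁ : Set X) ⊆ e.source) (hV₁ : e '' U₁ = V₁)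
    (h : U₁ ≤ U) (k : V₁ ≤ V) (f : Model ι κ V),
    O.res h (iso U V hU hV f) = iso U₁ V₁ hU₁ hV₁ (Model.res k f)
  iso_par : ∀ (U : Opens X) (V : Opens (ι → ℝ)) (hU : (U : Set X) ⊆ e.source)
    (hV : e '' U = V) (i : ZMod 2) (f : Model ι κ V),
    iso U V hU hV f ∈ O.par U i ↔ f ∈ Model.par V i

namespace Chart

variable {X : Type u} [TopologicalSpace X] {O : SuperSheaf X} {ι κ : Type}
  [Fintype ι] [Fintype κ]

/-- The domain of a chart. -/
def dom (c : Chart O ι κ) : Opens X := ⟨c.e.source, c.e.open_source⟩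

/-- The image of a chart in `ℝ^ι`. -/
def img (c : Chart O ι κ) : Opens (ι → ℝ) := ⟨c.e.target, c.e.open_target⟩

/-- The even coordinate functions of a chart. -/
def even (c : Chart O ι κ) (μ : ι) : O.Sec c.dom :=
  c.iso c.dom c.img subset_rfl c.e.image_source_eq_target (Model.even c.img μ)

/-- The odd coordinate functions of a chart. -/
def odd (c : Chart O ι κ) (j : κ) : O.Sec c.dom :=
  c.iso c.dom c.img subset_rfl c.e.image_source_eq_target (Model.odd c.img j)

/-- All coordinate functions `x^a = (x^μ, θ^j)` of a chart. -/
def coord (c : Chart O ι κ) : ι ⊕ κ → O.Sec c.dom := Sum.elim c.even c.odd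

end Chart

/-- A smooth supermanifold whose local even and odd coordinates are indexed by `ι` and `κ`
(of dimension `n|m` for `ι = Fin n`, `κ = Fin m`): a second countable Hausdorff space with a
sheaf of superalgebras that is locally isomorphic to `ℝ^{ι|κ}`. -/
structure Supermanifold (ι κ : Type) [Fintype ι] [Fintype κ] where
  /-- the underlying space `|M|` -/
  X : Type u
  [top : TopologicalSpace X]
  [t2 : T2Space X]
  [sc : SecondCountableTopology X]
  /-- the structure sheaf -/
  O : SuperSheaf X
  exists_chart : ∀ x : X, ∃ c : Chart O ι κ, x ∈ c.dom

attribute [instance] Supermanifold.top Supermanifold.t2 Supermanifold.sc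

/-- A morphism of supermanifolds: a continuous map `|M| → |N|` with a morphism `O_N → O_M` of
sheaves of superalgebras over it. (The induced maps of stalks are automatically local, since all
the residue fields are `ℝ`.) -/
@[ext]
structure Hom {ι κ ι₁ κ₁ : Type} [Fintype ι] [Fintype κ] [Fintype ι₁] [Fintype κ₁]
    (M : Supermanifold.{u} ι κ) (N : Supermanifold.{u} ι₁ κ₁) where
  /-- the map of underlying spaces -/
  base : C(M.X, N.X)
  /-- the pull-back of functions -/
  pull : ∀ V : Opens N.X, N.O.Sec V →ₐ[ℝ] M.O.Sec (Opens.comap base V)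
  pull_par : ∀ (V : Opens N.X) (i : ZMod 2) (f : N.O.Sec V),
    f ∈ N.O.par V i → pull V f ∈ M.O.par (Opens.comap base V) i
  pull_res : ∀ {V W : Opens N.X} (h : V ≤ W) (f : N.O.Sec W),
    pull V (N.O.res h f) = M.O.res (fun _ hx => h hx) (pull W f)

/-- An odd vector field: an odd derivation of the structure sheaf. -/
@[ext]
structure OddVectorField {ι κ : Type} [Fintype ι] [Fintype κ] (M : Supermanifold.{u} ι κ) where
  /-- the action on functions over an open set -/
  map : ∀ U : Opens M.X, M.O.Sec U →ₗ[ℝ] M.O.Sec U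
  map_res : ∀ {U V : Opens M.X} (h : U ≤ V) (f : M.O.Sec V),
    map U (M.O.res h f) = M.O.res h (map V f)
  map_par : ∀ (U : Opens M.X) (i : ZMod 2) (f : M.O.Sec U),
    f ∈ M.O.par U i → map U f ∈ M.O.par U (i + 1)
  leibniz : ∀ (U : Opens M.X) (i : ZMod 2) (f g : M.O.Sec U), f ∈ M.O.par U i →
    map U (f * g) = map U f * g + (-1 : ℝ) ^ i.val • (f * map U g)

/-- An odd vector field is homological if it squares to zero. -/
def OddVectorField.IsHomological {ι κ : Type} [Fintype ι] [Fintype κ]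
    {M : Supermanifold.{u} ι κ} (Q : OddVectorField M) : Prop :=
  ∀ (U : Opens M.X) (f : M.O.Sec U), Q.map U (Q.map U f) = 0

/-- A Q-manifold. -/
structure QManifold (ι κ : Type) [Fintype ι] [Fintype κ] where
  /-- the supermanifold -/
  M : Supermanifold.{u} ι κ
  /-- the homological vector field -/
  Q : OddVectorField M
  homological : Q.IsHomological

/-- A morphism of supermanifolds is a morphism of Q-manifolds `(M₁, Q₁) → (M₂, Q₂)` if
`Q₁ ∘ ψ^* = ψ^* ∘ Q₂`. -/
def IsQMorphism {ι κ ι₁ κ₁ : Type} [Fintype ι] [Fintype κ] [Fintype ι₁] [Fintype κ₁]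
    (M₁ : QManifold.{u} ι κ) (M₂ : QManifold.{u} ι₁ κ₁) (ψ : Hom M₁.M M₂.M) : Prop :=
  ∀ (V : Opens M₂.M.X) (f : M₂.M.O.Sec V),
    M₁.Q.map (Opens.comap ψ.base V) (ψ.pull V f) = ψ.pull V (M₂.Q.map V f)

/-! ### The antitangent bundle with the de Rham differential -/

/-- The antitangent bundle `π : ΠTM → M` with its de Rham differential `d`.
Over the domain `U` of every chart of `M` with coordinates `x^a`, the functions
`(x^a, dx^b)` (that is `π^* x^a` and `dx^b = d (π^* x^b)`, the latter of opposite parity) are the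
coordinates of a chart of `ΠTM` which identifies `π⁻¹ U` with the whole product of `U` and the
fibre; the even fibre coordinates are the `dx^b` with `x^b` odd.
A vector field is determined by its components, the values on coordinates; `d` has the
components `dx^a` at `x^a` and `0` at `dx^a`, that is `d = dx^a ∂/∂x^a`. -/
structure AntitangentBundle {ι κ : Type} [Fintype ι] [Fintype κ] (M : Supermanifold.{u} ι κ) where
  /-- the total space `ΠTM` -/
  total : Supermanifold.{u} (ι ⊕ κ) (κ ⊕ ι)
  /-- the projection -/
  proj : Hom total M
  /-- the de Rham differential -/
  d : OddVectorField total
  exists_chart : ∀ c : Chart M.O ι κ, ∃ C : Chart total.O (ι ⊕ κ) (κ ⊕ ι),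
    ∃ hdom : C.dom = Opens.comap proj.base c.dom,
      C.e.target = {z | (fun μ => z (Sum.inl μ)) ∈ c.e.target} ∧
      (∀ μ, C.even (Sum.inl μ) = total.O.res hdom.le (proj.pull c.dom (c.even μ))) ∧
      (∀ j, C.odd (Sum.inl j) = total.O.res hdom.le (proj.pull c.dom (c.odd j))) ∧
      (∀ j, C.even (Sum.inr j) = total.O.res hdom.le (d.map _ (proj.pull c.dom (c.odd j)))) ∧
      (∀ μ, C.odd (Sum.inr μ) = total.O.res hdom.le (d.map _ (proj.pull c.dom (c.even μ))))
  d_d : ∀ (c : Chart M.O ι κ) (a : ι ⊕ κ),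
    d.map _ (d.map _ (proj.pull c.dom (c.coord a))) = 0

/-- The odd anchor: `a : M → ΠTM` is the vector field `Q` regarded as a section of `ΠTM`, that is
`a` lies over the identity of `|M|` and `a^*(x^a, dx^b) = (x^a, Q^b)` in all local coordinates,
where `Q^b = Q(x^b)`. -/
structure IsOddAnchor {ι κ : Type} [Fintype ι] [Fintype κ] {M : Supermanifold.{u} ι κ}
    (Q : OddVectorField M) (T : AntitangentBundle M) (a : Hom M T.total) : Prop where
  base : ∀ x, T.proj.base (a.base x) = x
  pull_coord : ∀ (c : Chart M.O ι κ) (b : ι ⊕ κ)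
    (h : c.dom ≤ Opens.comap a.base (Opens.comap T.proj.base c.dom)),
    M.O.res h (a.pull _ (T.proj.pull c.dom (c.coord b))) = c.coord b
  pull_d_coord : ∀ (c : Chart M.O ι κ) (b : ι ⊕ κ)
    (h : c.dom ≤ Opens.comap a.base (Opens.comap T.proj.base c.dom)),
    M.O.res h (a.pull _ (T.d.map _ (T.proj.pull c.dom (c.coord b)))) = Q.map c.dom (c.coord b)

end Super

end

/-! Everything rests on one rigidity principle, `Model.eq_zero_of_coord`: a linear map Δ between
function algebras of superdomains is zero if it kills 1 and turns multiplication by each coordinate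
into multiplication by a fixed element, provided that the bodies of the elements assigned to the
even coordinates form a point of the domain. Hadamard's lemma writes f − f(q) as a combination of
the x^μ − q^μ; with q the body of those elements at a given point, each use of the lemma multiplies
the value of Δ f at that point by an element without scalar part, and sufficiently many such factors
multiply to zero. The principle is applied to differences of homomorphisms, to d², to the defect
Q∘a^* − a^*∘d, and to the defect of naturality of d under coordinate changes. In each case only the
coordinates have to be checked. Conversely, coordinates may be replaced by arbitrary elements of the
right parity with admissible bodies (`Model.exists_subst`): the Taylor series of a smooth function
in the nilpotent parts is finite.

Given an antitangent bundle, d² kills x^a and dx^a, hence everything. Over a chart the odd anchor is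
the substitution x^a ↦ x^a, dx^b ↦ Q^b. It does not depend on the chart: on pulled-back functions
both h ↦ a^*(dh) and h ↦ Q h are odd derivations along restriction with the same values on
coordinates, so a^*(dh) = Q h for every h (`HasCoords.map_d_pull`). The local anchors therefore
agree on overlaps and glue. The underlying map sends x to the point over x at which the value of
each dh is the value of Q h at x; such a point exists because the fibre coordinates take all real
values. Finally, Q∘a^* and a^*∘d agree on x^a, where both give Q^a, and on dx^a, where they give
Q(Q^a) = 0 and a^*(0) = 0. This is where Q² = 0 is used.

For existence, the superdomains with coordinates (x, dξ | ξ, dx) over the charts of M are glued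
along x' = x'(x, ξ), dx' = d(x'(x, ξ)) and likewise for ξ'. These changes commute with pull-back
from M and with d (`Chart.trans_lift`, `Chart.trans_deRham`), from which the cocycle identity
follows formally. The underlying space is a fibre bundle over |M| with fibre coordinates dξ^j. -/

noncomputable section

namespace Super

/-! ### Integrals depending on a parameter and Hadamard's lemma -/

section ParametricIntegral

variable {E : Type} [NormedAddCommGroup E] [NormedSpace ℝ E] [FiniteDimensional ℝ E]

/-- Differentiation under the integral sign: the dominating constant is a bound of the continuous
derivative on the compact set [0,1] × closed unit ball around x₀. -/
theorem hasFDerivAt_integral_unitInterval {F : Type} [NormedAddCommGroup F] [NormedSpace ℝ F]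
    [CompleteSpace F] {Φ : ℝ × E → F} (hΦ : ContDiff ℝ ∞ Φ) (x₀ : E) :
    HasFDerivAt (fun x => ∫ t in (0:ℝ)..1, Φ (t, x))
      (∫ t in (0:ℝ)..1, (fderiv ℝ Φ (t, x₀)).comp (ContinuousLinearMap.inr ℝ ℝ E)) x₀ := by
  have hc : Continuous Φ := hΦ.continuous
  have hc' : Continuous fun p => (fderiv ℝ Φ p).comp (ContinuousLinearMap.inr ℝ ℝ E) :=
    (hΦ.continuous_fderiv (by simp)).clm_comp continuous_const
  have hK : IsCompact (Icc (0:ℝ) 1 ×ˢ Metric.closedBall x₀ 1) :=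
    isCompact_Icc.prod (isCompact_closedBall x₀ 1)
  obtain ⟨C, hC⟩ := hK.exists_bound_of_continuousOn hc'.continuousOn
  refine (intervalIntegral.hasFDerivAt_integral_of_dominated_of_fderiv_le
    (F := fun x t => Φ (t, x))
    (F' := fun x t => (fderiv ℝ Φ (t, x)).comp (ContinuousLinearMap.inr ℝ ℝ E))
    (bound := fun _ => C) (Metric.ball_mem_nhds x₀ one_pos) ?_ ?_ ?_ ?_ ?_ ?_)
  · exact Filter.Eventually.of_forall fun x =>
      (by fun_prop : Continuous fun t => Φ (t, x)).aestronglyMeasurable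
  · exact (by fun_prop : Continuous fun t => Φ (t, x₀)).intervalIntegrable _ _
  · exact (hc'.comp (by fun_prop : Continuous fun t : ℝ => (t, x₀))).aestronglyMeasurable
  · refine Filter.Eventually.of_forall fun t ht x hx => hC (t, x) ⟨?_, Metric.ball_subset_closedBall hx⟩
    rw [uIoc_of_le zero_le_one] at ht
    exact ⟨ht.1.le, ht.2⟩
  · exact intervalIntegrable_const
  · refine Filter.Eventually.of_forall fun t _ x _ => ?_
    have h1 : HasFDerivAt Φ (fderiv ℝ Φ (t, x)) (t, x) :=
      ((hΦ.differentiable (by simp)) (t, x)).hasFDerivAt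
    exact h1.comp x (hasFDerivAt_prodMk_right t x)

/-- The derivative of such an integral is an integral of the same kind with values in `E →L[ℝ] F`,
so the induction has to run over all target spaces `F` at once. -/
theorem contDiff_nat_integral_unitInterval (n : ℕ) : ∀ {F : Type} [NormedAddCommGroup F]
    [NormedSpace ℝ F] [CompleteSpace F] {Φ : ℝ × E → F}, ContDiff ℝ ∞ Φ →
    ContDiff ℝ n (fun x => ∫ t in (0:ℝ)..1, Φ (t, x)) := by
  induction n with
  | zero =>
    intro F _ _ _ Φ hΦ
    refine contDiff_zero.2 ?_
    exact continuous_iff_continuousAt.2 fun x =>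
      (hasFDerivAt_integral_unitInterval hΦ x).continuousAt
  | succ n ih =>
    intro F _ _ _ Φ hΦ
    have : ((n + 1 : ℕ) : WithTop ℕ∞) = (n : WithTop ℕ∞) + 1 := by norm_cast
    rw [this, contDiff_succ_iff_fderiv]
    refine ⟨fun x => (hasFDerivAt_integral_unitInterval hΦ x).differentiableAt, by simp, ?_⟩
    have h2 : fderiv ℝ (fun x => ∫ t in (0:ℝ)..1, Φ (t, x)) = fun x =>
        ∫ t in (0:ℝ)..1, (fderiv ℝ Φ (t, x)).comp (ContinuousLinearMap.inr ℝ ℝ E) :=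
      funext fun x => (hasFDerivAt_integral_unitInterval hΦ x).fderiv
    rw [h2]
    exact ih (Φ := fun p => (fderiv ℝ Φ p).comp (ContinuousLinearMap.inr ℝ ℝ E))
      ((hΦ.fderiv_right (by simp)).clm_comp contDiff_const)

/-- Hadamard's lemma for globally defined smooth functions. -/
theorem exists_hadamard {F : E → ℝ} (hF : ContDiff ℝ ∞ F) (q : E) :
    ∃ G : E → E →L[ℝ] ℝ, ContDiff ℝ ∞ G ∧ ∀ x, F x = F q + G x (x - q) := by
  -- The fundamental theorem of calculus along the segment from q to x.
  refine ⟨fun x => ∫ t in (0:ℝ)..1, fderiv ℝ F (q + t • (x - q)), ?_, fun x => ?_⟩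
  · have hΦ : ContDiff ℝ ∞ fun p : ℝ × E => fderiv ℝ F (q + p.1 • (p.2 - q)) :=
      (hF.fderiv_right (m := ∞) (by simp)).comp (by fun_prop)
    exact contDiff_infty.2 fun n => contDiff_nat_integral_unitInterval n hΦ
  · have hcont : Continuous fun t : ℝ => fderiv ℝ F (q + t • (x - q)) :=
      (hF.continuous_fderiv (by simp)).comp (by fun_prop)
    beta_reduce
    rw [ContinuousLinearMap.intervalIntegral_apply (hcont.intervalIntegrable _ _)]
    have hd : ∀ t ∈ uIcc (0:ℝ) 1, HasDerivAt (fun t : ℝ => F (q + t • (x - q)))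
        (fderiv ℝ F (q + t • (x - q)) (x - q)) t := fun t _ => by
      have h1 : HasDerivAt (fun t : ℝ => q + t • (x - q)) (x - q) t := by
        simpa using ((hasDerivAt_id t).smul_const (x - q)).const_add q
      exact ((hF.differentiable (by simp)) _).hasFDerivAt.comp_hasDerivAt t h1
    rw [intervalIntegral.integral_eq_sub_of_hasDerivAt hd
      ((hcont.clm_apply continuous_const).intervalIntegrable _ _)]
    simp

end ParametricIntegral

/-! ### Calculus of smooth functions on open subsets of ℝ^ι -/

namespace Smooth

variable {ι ι' : Type} [Fintype ι] [Fintype ι']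

/-- Extension of a function on an open set by zero. -/
def extend {V : Opens (ι → ℝ)} (f : V → ℝ) : (ι → ℝ) → ℝ := Function.extend Subtype.val f 0

@[simp]
theorem extend_coe {V : Opens (ι → ℝ)} (f : V → ℝ) (x : V) : extend f x.1 = f x :=
  Subtype.val_injective.extend_apply _ _ _

/-- Smoothness on the manifold V is traded for `ContDiffAt` of a function on all of ℝ^ι, so that
ordinary derivatives can be used; only germs at points of V matter. -/
theorem contMDiff_coe_iff {V : Opens (ι → ℝ)} {F : (ι → ℝ) → ℝ} :
    ContMDiff 𝓘(ℝ, ι → ℝ) 𝓘(ℝ, ℝ) ∞ (fun x : V => F x) ↔ ∀ x ∈ V, ContDiffAt ℝ ∞ F x := by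
  refine ⟨fun h x hx => ?_, fun h x => ?_⟩
  · exact (contMDiffAt_subtype_iff (x := (⟨x, hx⟩ : V)).1 (h ⟨x, hx⟩)).contDiffAt
  · exact contMDiffAt_subtype_iff.2 (h x x.2).contMDiffAt

theorem contMDiff_iff {V : Opens (ι → ℝ)} {f : V → ℝ} :
    ContMDiff 𝓘(ℝ, ι → ℝ) 𝓘(ℝ, ℝ) ∞ f ↔ ∀ x ∈ V, ContDiffAt ℝ ∞ (extend f) x := by
  rw [← contMDiff_coe_iff]
  simp

theorem contDiffAt_extend {V : Opens (ι → ℝ)} (f : Smooth ι V) {x : ι → ℝ} (hx : x ∈ V) :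
    ContDiffAt ℝ ∞ (extend f) x := contMDiff_iff.1 f.contMDiff x hx

/-- A function that is smooth at all points of `V`, restricted to `V`. -/
def ofContDiffAt {V : Opens (ι → ℝ)} (F : (ι → ℝ) → ℝ) (h : ∀ x ∈ V, ContDiffAt ℝ ∞ F x) :
    Smooth ι V := ⟨fun x => F x, contMDiff_coe_iff.2 h⟩

@[simp]
theorem ofContDiffAt_apply {V : Opens (ι → ℝ)} (F : (ι → ℝ) → ℝ)
    (h : ∀ x ∈ V, ContDiffAt ℝ ∞ F x) (x : V) : ofContDiffAt F h x = F x := rfl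

@[simp]
theorem coord_apply (V : Opens (ι → ℝ)) (μ : ι) (x : V) : coord V μ x = x.1 μ := rfl

@[simp]
theorem res_apply {U V : Opens (ι → ℝ)} (h : U ≤ V) (f : Smooth ι V) (x : U) :
    res h f x = f (inclusion h x) := rfl

theorem extend_eventuallyEq {V : Opens (ι → ℝ)} {f : V → ℝ} {F : (ι → ℝ) → ℝ}
    (h : ∀ x : V, f x = F x) {x : ι → ℝ} (hx : x ∈ V) : extend f =ᶠ[nhds x] F := by
  filter_upwards [V.2.mem_nhds hx] with y hy
  rw [← h ⟨y, hy⟩]; exact extend_coe f ⟨y, hy⟩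

/-- Hadamard's lemma on an arbitrary open set. -/
theorem exists_hadamard {V : Opens (ι → ℝ)} (f : Smooth ι V) (q : V) :
    ∃ g : ι → Smooth ι V, ∀ x : V, f x = f q + ∑ μ, (x.1 μ - q.1 μ) * g μ x := by
  classical
  -- V need not be star-shaped about q, so the segment formula is not available. The bump function χ
  -- splits f − f(q) into χ·(f − f(q)), which is smooth on the whole space, and (1 − χ)·(f − f(q)),
  -- which vanishes near q. The second part is divided by N = |x − q|² and multiplied back by Σ (x^μ
  -- − q^μ)².
  obtain ⟨r, hr, hrV⟩ := Metric.isOpen_iff.1 V.2 q.1 q.2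
  let χ : ContDiffBump q.1 := ⟨r / 4, r / 2, by positivity, by linarith⟩
  set F : (ι → ℝ) → ℝ := fun x => χ x * (extend f x - f q) with hFdef
  have hF : ContDiff ℝ ∞ F := by
    refine contDiff_iff_contDiffAt.2 fun x => ?_
    by_cases hx : x ∈ V
    · exact χ.contDiff.contDiffAt.mul ((contDiffAt_extend f hx).sub contDiffAt_const)
    · have hx' : x ∉ tsupport χ := fun h => hx <| hrV <| by
        rw [χ.tsupport_eq] at h
        exact Metric.closedBall_subset_ball (by simp [χ]; linarith) h
      have : F =ᶠ[nhds x] fun _ => 0 := by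
        filter_upwards [(isClosed_tsupport χ).isOpen_compl.mem_nhds hx'] with y hy
        simp [hFdef, image_eq_zero_of_notMem_tsupport hy]
      exact contDiffAt_const.congr_of_eventuallyEq this
  obtain ⟨G, hG, hFG⟩ := Super.exists_hadamard hF q.1
  have hFq : F q.1 = 0 := by simp [hFdef]
  have hone : ∀ᶠ y in nhds q.1, χ y = 1 := χ.eventuallyEq_one
  set N : (ι → ℝ) → ℝ := fun x => ∑ μ, (x μ - q.1 μ) ^ 2 with hN
  have hNs : ContDiff ℝ ∞ N := by fun_prop
  have hN0 : ∀ x, x ≠ q.1 → N x ≠ 0 := fun x hx h => hx <| by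
    rw [hN, Finset.sum_eq_zero_iff_of_nonneg (fun _ _ => sq_nonneg _)] at h
    ext μ
    have := h μ (Finset.mem_univ _)
    rw [sq_eq_zero_iff] at this
    linarith
  -- At q itself the denominator is zero, but the numerator vanishes on a neighbourhood and 0/0 = 0,
  -- so the quotient is locally constant there.
  have hH : ∀ x ∈ V, ContDiffAt ℝ ∞ (fun x => (1 - χ x) * (extend f x - f q) / N x) x := by
    intro x hx
    by_cases hxq : x = q.1
    · subst hxq
      refine (contDiffAt_const (c := (0:ℝ))).congr_of_eventuallyEq ?_
      filter_upwards [hone] with y hy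
      simp [hy]
    · exact ((contDiffAt_const.sub χ.contDiff.contDiffAt).mul
        ((contDiffAt_extend f hx).sub contDiffAt_const)).div hNs.contDiffAt (hN0 x hxq)
  refine ⟨fun μ => ofContDiffAt (fun x => G x (Pi.single μ 1) +
    (x μ - q.1 μ) * ((1 - χ x) * (extend f x - f q) / N x)) fun x hx => ?_, fun x => ?_⟩
  · exact ((hG.clm_apply contDiff_const).contDiffAt).add
      (((contDiff_apply ℝ ℝ μ).contDiffAt.sub contDiffAt_const).mul (hH x hx))
  · have h1 : G x.1 (x.1 - q.1) = ∑ μ, (x.1 μ - q.1 μ) * G x.1 (Pi.single μ 1) := by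
      conv_lhs => rw [pi_eq_sum_univ' (x.1 - q.1)]
      simp
    have h2 : ∑ μ, (x.1 μ - q.1 μ) * ((x.1 μ - q.1 μ) * ((1 - χ x) * (extend f x - f q) / N x))
        = (1 - χ x) * (f x - f q) := by
      have : ∀ μ, (x.1 μ - q.1 μ) * ((x.1 μ - q.1 μ) * ((1 - χ x) * (extend f x - f q) / N x))
          = (x.1 μ - q.1 μ) ^ 2 * ((1 - χ x) * (extend f x - f q) / N x) := fun μ => by ring
      simp only [this, ← Finset.sum_mul]
      by_cases hxq : x.1 = q.1
      · have : x = q := Subtype.ext hxq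
        subst this; simp
      · rw [mul_div_cancel₀ _ (hN0 x.1 hxq)]; simp
    simp only [ofContDiffAt_apply, mul_add, Finset.sum_add_distrib, h2, ← h1]
    have h3 := hFG x.1
    rw [hFq, zero_add] at h3
    rw [← h3]
    simp only [hFdef, extend_coe]
    ring

/-- Partial derivatives. -/
def pderiv (V : Opens (ι → ℝ)) (μ : ι) : Smooth ι V →ₗ[ℝ] Smooth ι V := by
  classical exact
  { toFun f := ofContDiffAt (fun x => fderiv ℝ (extend f) x (Pi.single μ 1)) fun x hx =>
      ((contDiffAt_extend f hx).fderiv_right (m := ∞) (by simp)).clm_apply contDiffAt_const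
    map_add' f g := by
      ext x
      have h : extend (f + g) =ᶠ[nhds x.1] extend f + extend g :=
        extend_eventuallyEq (fun x => by simp) x.2
      have := ((contDiffAt_extend f x.2).differentiableAt (by simp)).hasFDerivAt.add
        ((contDiffAt_extend g x.2).differentiableAt (by simp)).hasFDerivAt
      exact congrArg (fun L => L (Pi.single μ 1)) (this.congr_of_eventuallyEq h).fderiv
    map_smul' c f := by
      ext x
      have h : extend (c • f) =ᶠ[nhds x.1] c • extend f :=
        extend_eventuallyEq (fun x => by simp) x.2
      have := ((contDiffAt_extend f x.2).differentiableAt (by simp)).hasFDerivAt.const_smul c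
      exact congrArg (fun L => L (Pi.single μ 1)) (this.congr_of_eventuallyEq h).fderiv }

theorem pderiv_apply {V : Opens (ι → ℝ)} [DecidableEq ι] (μ : ι) (f : Smooth ι V) (x : V) :
    pderiv V μ f x = fderiv ℝ (extend f) x (Pi.single μ 1) := by
  unfold pderiv; simp; congr!

theorem pderiv_mul {V : Opens (ι → ℝ)} (μ : ι) (f g : Smooth ι V) :
    pderiv V μ (f * g) = pderiv V μ f * g + f * pderiv V μ g := by
  classical
  ext x
  have h : extend (f * g) =ᶠ[nhds x.1] extend f * extend g :=
    extend_eventuallyEq (fun x => by simp) x.2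
  have := ((contDiffAt_extend f x.2).differentiableAt (by simp)).hasFDerivAt.mul
    ((contDiffAt_extend g x.2).differentiableAt (by simp)).hasFDerivAt
  have e := congrArg (fun L => L (Pi.single μ 1)) (this.congr_of_eventuallyEq h).fderiv
  rw [pderiv_apply, e]
  simp only [extend_coe, add_apply, smul_apply,
    smul_eq_mul, ContMDiffMap.coe_add, ContMDiffMap.coe_mul, Pi.add_apply, Pi.mul_apply,
    pderiv_apply]
  ring

theorem pderiv_coord {V : Opens (ι → ℝ)} [DecidableEq ι] (μ ν : ι) :
    pderiv V μ (coord V ν) = if μ = ν then 1 else 0 := by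
  ext x
  have h : extend (coord V ν) =ᶠ[nhds x.1] fun x => x ν := extend_eventuallyEq (F := fun x => x ν) (fun _ => rfl) x.2
  rw [pderiv_apply, h.fderiv_eq, (hasFDerivAt_apply (𝕜 := ℝ) ν x.1).fderiv]
  rcases eq_or_ne μ ν with rfl | hne
  · simp
  · simp [hne, hne.symm]

theorem pderiv_res {U V : Opens (ι → ℝ)} (h : U ≤ V) (μ : ι) (f : Smooth ι V) :
    pderiv U μ (res h f) = res h (pderiv V μ f) := by
  classical
  ext x
  rw [pderiv_apply, res_apply, pderiv_apply]
  have : extend (res h f) =ᶠ[nhds x.1] extend f :=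
    extend_eventuallyEq (fun x => by rw [res_apply]; exact (extend_coe f (inclusion h x)).symm) x.2
  rw [this.fderiv_eq]

/-- Composition with a smooth map given by its components. -/
def comp {V : Opens (ι → ℝ)} {W : Opens (ι' → ℝ)} (y : ι → Smooth ι' W)
    (hy : ∀ z, (fun μ => y μ z) ∈ V) : Smooth ι V →ₐ[ℝ] Smooth ι' W where
  toFun f := ⟨fun z => f ⟨fun μ => y μ z, hy z⟩, by
    have h : ContMDiff 𝓘(ℝ, ι' → ℝ) 𝓘(ℝ, ι → ℝ) ∞ fun z : W => fun μ => y μ z :=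
      contMDiff_pi_space.2 fun μ => (y μ).contMDiff
    intro z
    have := ((contDiffAt_extend f (hy z)).contMDiffAt).comp z (h z)
    refine this.congr_of_eventuallyEq (Filter.Eventually.of_forall fun w => ?_)
    exact (extend_coe f ⟨fun μ => y μ w, hy w⟩).symm⟩
  map_one' := rfl
  map_mul' _ _ := rfl
  map_zero' := rfl
  map_add' _ _ := rfl
  commutes' _ := rfl

@[simp]
theorem comp_apply {V : Opens (ι → ℝ)} {W : Opens (ι' → ℝ)} (y : ι → Smooth ι' W)
    (hy : ∀ z, (fun μ => y μ z) ∈ V) (f : Smooth ι V) (z : W) :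
    comp y hy f z = f ⟨fun μ => y μ z, hy z⟩ := rfl

/-- Smooth functions that locally come from given ones glue. -/
theorem exists_glue {I : Type*} (U : I → Opens (ι → ℝ)) (V : Opens (ι → ℝ)) (hU : ∀ i, U i ≤ V)
    (hV : ∀ x ∈ V, ∃ i, x ∈ U i) (s : ∀ i, Smooth ι (U i))
    (hs : ∀ i j x (hi : x ∈ U i) (hj : x ∈ U j), s i ⟨x, hi⟩ = s j ⟨x, hj⟩) :
    ∃ f : Smooth ι V, ∀ i, res (hU i) f = s i := by
  choose i hi using hV
  have key : ∀ j x (hx : x ∈ U j), s (i x (hU j hx)) ⟨x, hi x (hU j hx)⟩ = s j ⟨x, hx⟩ :=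
    fun j x hx => hs _ _ _ _ _
  refine ⟨⟨fun x => s (i x.1 x.2) ⟨x.1, hi x.1 x.2⟩, contMDiff_iff.2 fun x hx => ?_⟩, fun j => ?_⟩
  · refine (contDiffAt_extend (s (i x hx)) (hi x hx)).congr_of_eventuallyEq ?_
    filter_upwards [(U (i x hx)).2.mem_nhds (hi x hx)] with y hy
    have h1 := extend_coe (s (i x hx)) ⟨y, hy⟩
    have h2 := extend_coe (fun x : V => s (i x.1 x.2) ⟨x.1, hi x.1 x.2⟩) ⟨y, hU _ hy⟩
    rw [h1, h2]
    exact hs _ _ _ _ _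
  · ext x
    exact key j x.1 x.2

end Smooth


theorem zmod_two_cases (i : ZMod 2) : i = 0 ∨ i = 1 := by decide +revert

/-! ### The exterior algebra -/

/-- The exterior algebra on generators indexed by `κ`. -/
abbrev Ext (κ : Type) [Fintype κ] : Type := ExteriorAlgebra ℝ (κ → ℝ)

namespace Ext

variable {κ : Type} [Fintype κ]

open CliffordAlgebra (involute)

/-- The parity involution. -/
abbrev inv : Ext κ →ₐ[ℝ] Ext κ := involute

instance : Module.Finite ℝ (Ext κ) :=
  Module.Finite.of_basis
    ((Pi.basisFun ℝ κ).reindex (Fintype.equivFin κ)).ExteriorAlgebra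

/-- The ideal of elements of degree at least `k`. -/
def filt (k : ℕ) : Submodule ℝ (Ext κ) :=
  LinearMap.range (ExteriorAlgebra.ι ℝ : (κ → ℝ) →ₗ[ℝ] _) ^ k * ⊤

/-- Each generator in x contributes one sign when v moves past it, and the parity involution
collects these signs. -/
theorem mul_ι_eq (x : Ext κ) (v : κ → ℝ) :
    x * ExteriorAlgebra.ι ℝ v = ExteriorAlgebra.ι ℝ v * inv x := by
  induction x using CliffordAlgebra.left_induction with
  | algebraMap r => simp [Algebra.commutes]
  | add x y hx hy => simp [add_mul, mul_add, hx, hy]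
  | ι_mul x m h =>
    have h1 := ExteriorAlgebra.ι_add_mul_swap (R := ℝ) v m
    rw [mul_assoc, h, map_mul, CliffordAlgebra.involute_ι, ← mul_assoc, ← mul_assoc, mul_neg,
      eq_neg_of_add_eq_zero_left h1]
    simp

/-- This makes the right ideal generated by the generators two-sided, which is what multiplicativity
of `filt` needs. -/
theorem top_mul_range_le :
    (⊤ : Submodule ℝ (Ext κ)) * LinearMap.range (ExteriorAlgebra.ι ℝ : (κ → ℝ) →ₗ[ℝ] _) ≤
      LinearMap.range (ExteriorAlgebra.ι ℝ : (κ → ℝ) →ₗ[ℝ] _) * ⊤ := by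
  rw [Submodule.mul_le]
  rintro x - _ ⟨v, rfl⟩
  rw [mul_ι_eq]
  exact Submodule.mul_mem_mul ⟨v, rfl⟩ trivial

theorem filt_one_mul_filt_le (k : ℕ) : filt (κ := κ) 1 * filt k ≤ filt (k + 1) := by
  set R := LinearMap.range (ExteriorAlgebra.ι ℝ : (κ → ℝ) →ₗ[ℝ] Ext κ)
  have h : ∀ k, (⊤ : Submodule ℝ (Ext κ)) * R ^ k ≤ R ^ k * ⊤ := fun k => by
    induction k with
    | zero => simp
    | succ k ih =>
      calc (⊤ : Submodule ℝ (Ext κ)) * R ^ (k + 1) = (⊤ * R ^ k) * R := by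
              rw [pow_succ, mul_assoc]
        _ ≤ (R ^ k * ⊤) * R := mul_le_mul_left ih R
        _ = R ^ k * (⊤ * R) := mul_assoc _ _ _
        _ ≤ R ^ k * (R * ⊤) := mul_le_mul_right top_mul_range_le _
        _ = R ^ (k + 1) * ⊤ := by rw [pow_succ, mul_assoc]
  calc filt (κ := κ) 1 * filt k = R * (⊤ * R ^ k) * ⊤ := by
        simp only [filt, pow_one, mul_assoc]; rfl
    _ ≤ R * (R ^ k * ⊤) * ⊤ := mul_le_mul_left (mul_le_mul_right (h k) _) _
    _ = R ^ (k + 1) * (⊤ * ⊤) := by rw [pow_succ']; simp only [mul_assoc]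
    _ ≤ R ^ (k + 1) * ⊤ := mul_le_mul_right le_top _

theorem mul_mem_filt {k : ℕ} {x y : Ext κ} (hx : x ∈ filt 1) (hy : y ∈ filt k) :
    x * y ∈ filt (k + 1) := filt_one_mul_filt_le k (Submodule.mul_mem_mul hx hy)

theorem mem_filt_zero (x : Ext κ) : x ∈ filt 0 := by simp [filt]

/-- A product of more than `card κ` generators is zero. Every later induction on the degree ends
here. -/
theorem filt_eq_bot : filt (κ := κ) (Fintype.card κ + 1) = ⊥ := by
  have h : ⋀[ℝ]^(Fintype.card κ + 1) (κ → ℝ) = ⊥ := by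
    apply Submodule.finrank_eq_zero.1
    rw [exteriorPower.finrank_eq]
    simp
  rw [filt]
  change (⋀[ℝ]^(Fintype.card κ + 1) (κ → ℝ)) * ⊤ = ⊥
  rw [h, Submodule.bot_mul]

theorem sub_algebraMap_mem_filt (x : Ext κ) :
    x - algebraMap ℝ _ (ExteriorAlgebra.algebraMapInv x) ∈ filt 1 := by
  induction x using CliffordAlgebra.left_induction with
  | algebraMap r => simp [ExteriorAlgebra.algebraMap_leftInverse (M := κ → ℝ) r]
  | add x y hx hy => simpa [add_sub_add_comm] using add_mem hx hy
  | ι_mul x m _ =>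
    have : ExteriorAlgebra.algebraMapInv (ExteriorAlgebra.ι ℝ m) = (0 : ℝ) := by
      simp [ExteriorAlgebra.algebraMapInv]
    rw [map_mul, this, zero_mul, map_zero, sub_zero, filt, pow_one]
    exact Submodule.mul_mem_mul ⟨m, rfl⟩ trivial

theorem mem_filt_of_algebraMapInv_eq_zero {x : Ext κ}
    (h : ExteriorAlgebra.algebraMapInv x = (0 : ℝ)) : x ∈ filt 1 := by
  simpa [h] using sub_algebraMap_mem_filt x

/-- Parity becomes an eigenvalue equation for the involution, so that parity statements can be
proved by rewriting. The converse direction needs that 2 is cancellable. -/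
theorem mem_evenOdd_iff (i : ZMod 2) (x : Ext κ) :
    x ∈ CliffordAlgebra.evenOdd (0 : QuadraticForm ℝ (κ → ℝ)) i ↔ inv x = (-1 : ℝ) ^ i.val • x := by
  obtain ⟨a, b, ha, hb, rfl⟩ : ∃ a b, a ∈ CliffordAlgebra.evenOdd (0 : QuadraticForm ℝ (κ → ℝ)) 0 ∧
      b ∈ CliffordAlgebra.evenOdd (0 : QuadraticForm ℝ (κ → ℝ)) 1 ∧ a + b = x := by
    obtain ⟨a, ha, b, hb, h⟩ := Submodule.mem_sup.1
      ((CliffordAlgebra.evenOdd_isCompl (0 : QuadraticForm ℝ (κ → ℝ))).sup_eq_top ▸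
        Submodule.mem_top (x := x))
    exact ⟨a, b, ha, hb, h⟩
  have hinv : inv (a + b) = a - b := by
    rw [map_add, inv, CliffordAlgebra.involute_eq_of_mem_even ha,
      CliffordAlgebra.involute_eq_of_mem_odd hb, sub_eq_add_neg]
  have htf : IsAddTorsionFree (Ext κ) := IsAddTorsionFree.of_isTorsionFree ℝ (Ext κ)
  rw [hinv]
  rcases zmod_two_cases i with rfl | rfl
  · rw [ZMod.val_zero, pow_zero, one_smul, sub_eq_add_neg, add_right_inj, neg_eq_self]
    refine ⟨fun h => ?_, fun h => ?_⟩
    · have := CliffordAlgebra.involute_eq_of_mem_even h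
      rw [show CliffordAlgebra.involute (a + b) = a - b from hinv, sub_eq_add_neg, add_right_inj,
        neg_eq_self] at this
      exact this
    · simpa [h] using ha
  · rw [ZMod.val_one, pow_one, neg_one_smul, neg_add, sub_eq_add_neg, add_left_inj, self_eq_neg]
    refine ⟨fun h => ?_, fun h => ?_⟩
    · have := CliffordAlgebra.involute_eq_of_mem_odd h
      rw [show CliffordAlgebra.involute (a + b) = a - b from hinv, sub_eq_add_neg, neg_add,
        add_left_inj, self_eq_neg] at this
      exact this
    · simpa [h] using hb

theorem mul_comm_of_even {x y : Ext κ} (hy : inv y = y) : x * y = y * x := by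
  have hy : y ∈ CliffordAlgebra.evenOdd (0 : QuadraticForm ℝ (κ → ℝ)) 0 :=
    (mem_evenOdd_iff 0 y).2 (by rwa [ZMod.val_zero, pow_zero, one_smul])
  clear * - hy
  induction y, hy using CliffordAlgebra.even_induction with
  | algebraMap r => exact (Algebra.commutes r x).symm
  | add a b _ _ ha hb => rw [mul_add, add_mul, ha, hb]
  | ι_mul_ι_mul m₁ m₂ a _ ha =>
    have h1 := mul_ι_eq x m₁
    have h2 := mul_ι_eq (inv x) m₂
    rw [inv, CliffordAlgebra.involute_involute] at h2
    change x * (ExteriorAlgebra.ι ℝ m₁ * ExteriorAlgebra.ι ℝ m₂ * a) =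
      ExteriorAlgebra.ι ℝ m₁ * ExteriorAlgebra.ι ℝ m₂ * a * x
    rw [mul_assoc _ a, ← ha, ← mul_assoc, ← mul_assoc, h1, mul_assoc _ (inv x), h2]
    simp only [mul_assoc]

theorem mul_comm_of_odd {x y : Ext κ} (hy : inv y = -y) : x * y = y * inv x := by
  have hy : y ∈ CliffordAlgebra.evenOdd (0 : QuadraticForm ℝ (κ → ℝ)) 1 :=
    (mem_evenOdd_iff 1 y).2 (by rwa [ZMod.val_one, pow_one, neg_one_smul])
  clear * - hy
  induction y, hy using CliffordAlgebra.odd_induction with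
  | ι v => exact mul_ι_eq x v
  | add a b _ _ ha hb => rw [mul_add, add_mul, ha, hb]
  | ι_mul_ι_mul m₁ m₂ a _ ha =>
    have h : inv (ExteriorAlgebra.ι ℝ m₁ * ExteriorAlgebra.ι ℝ m₂) =
        ExteriorAlgebra.ι ℝ m₁ * ExteriorAlgebra.ι ℝ m₂ := by
      simp [inv]
    change x * (ExteriorAlgebra.ι ℝ m₁ * ExteriorAlgebra.ι ℝ m₂ * a) =
      ExteriorAlgebra.ι ℝ m₁ * ExteriorAlgebra.ι ℝ m₂ * a * inv x
    rw [mul_assoc _ a, ← ha, ← mul_assoc, mul_comm_of_even h, mul_assoc, mul_assoc]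

end Ext

/-! ### Superdomains -/

namespace Model

variable {ι κ : Type} [Fintype ι] [Fintype κ] {V : Opens (ι → ℝ)}

/-- Evaluation of a smooth function at a point. -/
def evalSmooth (z : V) : Smooth ι V →ₐ[ℝ] ℝ where
  toFun f := f z
  map_one' := rfl
  map_mul' _ _ := rfl
  map_zero' := rfl
  map_add' _ _ := rfl
  commutes' _ := rfl

/-- The value of a function on a superdomain at a point of the body, as an element of the
exterior algebra. -/
def ev (z : V) : Model ι κ V →ₐ[ℝ] Ext κ :=
  Algebra.TensorProduct.lift ((Algebra.ofId ℝ (Ext κ)).comp (evalSmooth z)) (AlgHom.id ℝ _)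
    fun f w => Algebra.commutes (f z) w

@[simp]
theorem ev_tmul (z : V) (f : Smooth ι V) (w : Ext κ) :
    ev z (f ⊗ₜ[ℝ] w) = f z • w := by
  simp [ev, Algebra.smul_def]
  rfl

/-- The underlying smooth function of a function on a superdomain. -/
def body : Model ι κ V →ₐ[ℝ] Smooth ι V :=
  Algebra.TensorProduct.lift (AlgHom.id ℝ _)
    ((Algebra.ofId ℝ (Smooth ι V)).comp ExteriorAlgebra.algebraMapInv) fun _ _ => .all _ _

@[simp]
theorem body_tmul (f : Smooth ι V) (w : Ext κ) :
    body (f ⊗ₜ[ℝ] w : Model ι κ V) = (ExteriorAlgebra.algebraMapInv w : ℝ) • f := by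
  simp [body, Algebra.smul_def, mul_comm]

theorem algebraMapInv_ev (z : V) (a : Model ι κ V) :
    ExteriorAlgebra.algebraMapInv (ev z a) = body a z := by
  induction a using TensorProduct.induction_on with
  | zero => simp
  | tmul f w => simp [mul_comm]
  | add a b ha hb => simp [ha, hb]

/-- A basis of the exterior algebra. -/
abbrev extBasis (κ : Type) [Fintype κ] : Module.Basis (Module.Free.ChooseBasisIndex ℝ (Ext κ)) ℝ (Ext κ) :=
  Module.Free.chooseBasis ℝ (Ext κ)

/-- The coefficients of a function on a superdomain in a basis of the exterior algebra. -/
def coeff (i : Module.Free.ChooseBasisIndex ℝ (Ext κ)) : Model ι κ V →ₗ[ℝ] Smooth ι V :=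
  (TensorProduct.rid ℝ (Smooth ι V)).toLinearMap ∘ₗ
    LinearMap.lTensor (Smooth ι V) ((extBasis κ).coord i)

@[simp]
theorem coeff_tmul (i : Module.Free.ChooseBasisIndex ℝ (Ext κ)) (f : Smooth ι V) (w : Ext κ) :
    coeff i (f ⊗ₜ[ℝ] w : Model ι κ V) = (extBasis κ).repr w i • f := by
  simp [coeff]

theorem coeff_apply (i : Module.Free.ChooseBasisIndex ℝ (Ext κ)) (a : Model ι κ V) (z : V) :
    coeff i a z = (extBasis κ).repr (ev z a) i := by
  induction a using TensorProduct.induction_on with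
  | zero => simp
  | tmul f w => simp [mul_comm]
  | add a b ha hb => simp [ha, hb]

theorem sum_coeff (a : Model ι κ V) : ∑ i, coeff i a ⊗ₜ[ℝ] extBasis κ i = a := by
  induction a using TensorProduct.induction_on with
  | zero => simp
  | tmul f w =>
    simp only [coeff_tmul, TensorProduct.smul_tmul]
    rw [← TensorProduct.tmul_sum, Module.Basis.sum_repr]
  | add a b ha hb => simp only [map_add, TensorProduct.add_tmul, Finset.sum_add_distrib, ha, hb]

/-- The coefficients in a basis of the exterior algebra are honest smooth functions, hence
determined by their values. Identities on superdomains thus reduce to identities in a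
finite-dimensional algebra at each point. -/
theorem ext_ev {a b : Model ι κ V} (h : ∀ z, ev z a = ev z b) : a = b := by
  rw [← sum_coeff a, ← sum_coeff b]
  refine Finset.sum_congr rfl fun i _ => ?_
  congr 1
  ext z
  rw [coeff_apply, coeff_apply, h]

theorem eq_zero_of_ev {a : Model ι κ V} (h : ∀ z, ev z a = 0) : a = 0 :=
  ext_ev fun z => by rw [h, map_zero]

theorem ev_sub_body_mem (z : V) (a : Model ι κ V) :
    ev z (a - body a ⊗ₜ[ℝ] 1) ∈ Ext.filt 1 := by
  have := Ext.sub_algebraMap_mem_filt (ev z a)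
  rwa [algebraMapInv_ev, Algebra.algebraMap_eq_smul_one, ← ev_tmul, ← map_sub] at this

theorem eq_zero_of_mem_filt {a : Model ι κ V}
    (h : ∀ z, ev z a ∈ Ext.filt (Fintype.card κ + 1)) : a = 0 :=
  eq_zero_of_ev fun z => by simpa [Ext.filt_eq_bot] using h z

theorem pow_card_eq_zero {a : Model ι κ V} (h : ∀ z, ev z a ∈ Ext.filt 1) :
    a ^ (Fintype.card κ + 1) = 0 := by
  refine eq_zero_of_mem_filt fun z => ?_
  generalize Fintype.card κ + 1 = k
  induction k with
  | zero => exact Ext.mem_filt_zero _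
  | succ k ih => rw [pow_succ', map_mul]; exact Ext.mul_mem_filt (h z) ih

theorem tmul_one_commute (f : Smooth ι V) (a : Model ι κ V) :
    Commute (f ⊗ₜ[ℝ] (1 : Ext κ)) a := by
  refine ext_ev fun z => ?_
  simp

/-- A function on a superdomain whose body has no zero is invertible. -/
theorem isUnit_of_body_ne_zero {a : Model ι κ V} (h : ∀ z, body a z ≠ 0) : IsUnit a := by
  have h1 : IsUnit (body a ⊗ₜ[ℝ] (1 : Ext κ)) := by
    have hf : IsUnit (body a) := by
      refine IsUnit.of_mul_eq_one (Smooth.ofContDiffAt (fun x => (Smooth.extend (body a) x)⁻¹)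
        fun x hx => (Smooth.contDiffAt_extend _ hx).inv ?_) ?_
      · have := h ⟨x, hx⟩
        rwa [← Smooth.extend_coe (body a)] at this
      · ext z
        simp [h z]
    exact hf.map (Algebra.TensorProduct.includeLeft : Smooth ι V →ₐ[ℝ] Model ι κ V)
  have h2 : IsNilpotent (a - body a ⊗ₜ[ℝ] 1) :=
    ⟨_, pow_card_eq_zero fun z => ev_sub_body_mem z a⟩
  have := h2.isUnit_add_left_of_commute h1 (tmul_one_commute _ _).symm
  simpa using this

/-! #### Restriction -/

@[simp]
theorem ev_res {U V : Opens (ι → ℝ)} (h : U ≤ V) (a : Model ι κ V) (z : U) :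
    ev z (res h a) = ev (inclusion h z) a := by
  induction a using TensorProduct.induction_on with
  | zero => simp
  | tmul f w => simp [res]
  | add a b ha hb => simp [ha, hb]

@[simp]
theorem body_res {U V : Opens (ι → ℝ)} (h : U ≤ V) (a : Model ι κ V) (z : U) :
    body (res h a) z = body a (inclusion h z) := by
  rw [← algebraMapInv_ev, ev_res, algebraMapInv_ev]

@[simp]
theorem res_self (h : V ≤ V) (a : Model ι κ V) : res h a = a :=
  ext_ev fun z => by rw [ev_res]; rfl

@[simp]
theorem res_res {U V W : Opens (ι → ℝ)} (h : U ≤ V) (k : V ≤ W) (a : Model ι κ W) :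
    res h (res k a) = res (h.trans k) a :=
  ext_ev fun z => by simp only [ev_res]; try rfl

@[simp]
theorem res_even {U V : Opens (ι → ℝ)} (h : U ≤ V) (μ : ι) :
    res h (even V μ : Model ι κ V) = even U μ := by
  refine ext_ev fun z => ?_
  rw [ev_res]
  simp [even]

@[simp]
theorem res_odd {U V : Opens (ι → ℝ)} (h : U ≤ V) (j : κ) :
    res h (odd V j : Model ι κ V) = odd U j := by
  refine ext_ev fun z => ?_
  rw [ev_res]
  simp [odd]

@[simp]
theorem body_even (μ : ι) (z : V) : body (even V μ : Model ι κ V) z = z.1 μ := by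
  simp [even]

@[simp]
theorem body_odd (j : κ) (z : V) : body (odd V j : Model ι κ V) z = 0 := by
  simp [odd, ExteriorAlgebra.algebraMapInv]

/-- Functions on superdomains glue. -/
theorem exists_glue {I : Type*} (U : I → Opens (ι → ℝ)) (V : Opens (ι → ℝ)) (hU : ∀ i, U i ≤ V)
    (hV : ∀ x ∈ V, ∃ i, x ∈ U i) (s : ∀ i, Model ι κ (U i))
    (hs : ∀ i j, res (inf_le_left : U i ⊓ U j ≤ U i) (s i) = res inf_le_right (s j)) :
    ∃ f : Model ι κ V, ∀ i, res (hU i) f = s i := by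
  have h : ∀ k, ∃ f : Smooth ι V, ∀ i, Smooth.res (hU i) f = coeff k (s i) := fun k => by
    refine Smooth.exists_glue U V hU hV _ fun i j x hi hj => ?_
    have := congrArg (ev (⟨x, hi, hj⟩ : (U i ⊓ U j : Opens _))) (hs i j)
    rw [ev_res, ev_res] at this
    rw [coeff_apply, coeff_apply]
    exact congrArg (fun w => (extBasis κ).repr w k) this
  choose f hf using h
  refine ⟨∑ k, f k ⊗ₜ[ℝ] extBasis κ k, fun i => ?_⟩
  rw [← sum_coeff (s i), map_sum]
  refine Finset.sum_congr rfl fun k _ => ?_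
  rw [← hf]
  simp [res]

theorem eq_of_res_eq {I : Type*} (U : I → Opens (ι → ℝ)) (V : Opens (ι → ℝ)) (hU : ∀ i, U i ≤ V)
    (hV : ∀ x ∈ V, ∃ i, x ∈ U i) {a b : Model ι κ V} (h : ∀ i, res (hU i) a = res (hU i) b) :
    a = b := by
  refine ext_ev fun z => ?_
  obtain ⟨i, hi⟩ := hV z.1 z.2
  have := congrArg (ev ⟨z.1, hi⟩) (h i)
  rwa [ev_res, ev_res] at this

/-! #### Parity -/

/-- The parity involution. -/
def inv : Model ι κ V →ₐ[ℝ] Model ι κ V := Algebra.TensorProduct.map (AlgHom.id ℝ _) Ext.inv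

@[simp]
theorem inv_tmul (f : Smooth ι V) (w : Ext κ) :
    inv (f ⊗ₜ[ℝ] w : Model ι κ V) = f ⊗ₜ[ℝ] Ext.inv w := by
  simp [inv]

@[simp]
theorem ev_inv (z : V) (a : Model ι κ V) : ev z (inv a) = Ext.inv (ev z a) := by
  induction a using TensorProduct.induction_on with
  | zero => simp
  | tmul f w => simp
  | add a b ha hb => simp [ha, hb]

@[simp]
theorem inv_inv (a : Model ι κ V) : inv (inv a) = a := ext_ev fun z => by simp

theorem inv_res {U V : Opens (ι → ℝ)} (h : U ≤ V) (a : Model ι κ V) :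
    inv (res h a) = res h (inv a) := ext_ev fun z => by simp

@[simp]
theorem inv_even (μ : ι) : inv (even V μ : Model ι κ V) = even V μ := by simp [even]

@[simp]
theorem inv_odd (j : κ) : inv (odd V j : Model ι κ V) = -odd V j := by
  simp [odd, Ext.inv, TensorProduct.tmul_neg]

/-- This is the projector onto parity i; eigenvectors of the involution are fixed by it and
therefore lie in `par V i`. -/
theorem half_add_mem_par (i : ZMod 2) (a : Model ι κ V) :
    (2⁻¹ : ℝ) • (a + (-1 : ℝ) ^ i.val • inv a) ∈ par V i := by
  induction a using TensorProduct.induction_on with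
  | zero => simp
  | tmul f w =>
    rw [inv_tmul, ← TensorProduct.tmul_smul, ← TensorProduct.tmul_add, ← TensorProduct.tmul_smul]
    refine ⟨f ⊗ₜ ⟨(2⁻¹ : ℝ) • (w + (-1 : ℝ) ^ i.val • Ext.inv w), ?_⟩, by simp⟩
    rw [Ext.mem_evenOdd_iff, map_smul, map_add, map_smul, Ext.inv,
      CliffordAlgebra.involute_involute, smul_comm, smul_add ((-1 : ℝ) ^ i.val), smul_smul,
      ← pow_add, ← two_mul, pow_mul]
    simp [add_comm]
  | add a b ha hb =>
    convert add_mem ha hb using 1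
    simp only [map_add, smul_add]
    abel

theorem mem_par_iff {i : ZMod 2} {a : Model ι κ V} :
    a ∈ par V i ↔ inv a = (-1 : ℝ) ^ i.val • a := by
  constructor
  · rintro ⟨t, rfl⟩
    induction t using TensorProduct.induction_on with
    | zero => simp
    | tmul f w =>
      simp [(Ext.mem_evenOdd_iff i w.1).1 w.2]
    | add a b ha hb => simp only [map_add, smul_add, ha, hb]
  · intro h
    have := half_add_mem_par i a
    rw [h, smul_smul, ← pow_add, ← two_mul, pow_mul] at this
    simpa [← two_smul ℝ, smul_smul] using this

theorem neg_one_smul' (a : Model ι κ V) : (-1 : ℝ) • a = -a := neg_one_smul ℝ a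

theorem mem_par_zero {a : Model ι κ V} : a ∈ par V 0 ↔ inv a = a := by simp [mem_par_iff]

theorem mem_par_one {a : Model ι κ V} : a ∈ par V 1 ↔ inv a = -a := by
  rw [mem_par_iff, ZMod.val_one, pow_one, neg_one_smul']

theorem mul_comm_of_even {x y : Model ι κ V} (hy : inv y = y) : x * y = y * x :=
  ext_ev fun z => by
    rw [map_mul, map_mul, Ext.mul_comm_of_even]
    rw [← ev_inv, hy]

theorem mul_comm_of_odd {x y : Model ι κ V} (hy : inv y = -y) : x * y = y * inv x :=
  ext_ev fun z => by
    rw [map_mul, map_mul, ev_inv, Ext.mul_comm_of_odd]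
    rw [← ev_inv, hy, map_neg]

theorem supercomm {i j : ZMod 2} {x y : Model ι κ V} (hx : x ∈ par V i) (hy : y ∈ par V j) :
    x * y = (-1 : ℝ) ^ (i * j).val • (y * x) := by
  rcases zmod_two_cases j with rfl | rfl
  · rw [mul_comm_of_even (mem_par_zero.1 hy)]; simp
  · rw [mul_comm_of_odd (mem_par_one.1 hy), mem_par_iff.1 hx, mul_smul_comm, mul_one]

end Model


/-! ### Taylor expansion in nilpotent directions -/

section Taylor

variable {ι S A : Type} [Fintype ι] [CommRing S] [Algebra ℝ S] [Ring A] [Algebra ℝ A]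
  (D : ι → S →ₗ[ℝ] S) (n : ι → A)

/-- The derivation `∑ D μ ⊗ n μ` of `S ⊗ A`. -/
def tensorDer : Module.End ℝ (S ⊗[ℝ] A) :=
  ∑ μ, TensorProduct.map (D μ) (LinearMap.mulLeft ℝ (n μ))

theorem tensorDer_tmul (f : S) (a : A) : tensorDer D n (f ⊗ₜ a) = ∑ μ, D μ f ⊗ₜ (n μ * a) := by
  simp [tensorDer, LinearMap.sum_apply]

variable {D n}

/-- Centrality of the n μ is what allows them to pass the left factor without a sign, giving an
untwisted derivation, which can then be exponentiated. -/
theorem tensorDer_mul (hD : ∀ μ f g, D μ (f * g) = D μ f * g + f * D μ g)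
    (hn : ∀ μ a, Commute (n μ) a) (a b : S ⊗[ℝ] A) :
    tensorDer D n (a * b) = a * tensorDer D n b + tensorDer D n a * b := by
  induction a using TensorProduct.induction_on with
  | zero => simp
  | add a a' h h' => simp only [add_mul, map_add, h, h']; abel
  | tmul f a =>
    induction b using TensorProduct.induction_on with
    | zero => simp
    | add b b' h h' => simp only [mul_add, map_add, h, h']; abel
    | tmul g b =>
      simp only [Algebra.TensorProduct.tmul_mul_tmul, tensorDer_tmul, Finset.mul_sum,
        Finset.sum_mul, ← Finset.sum_add_distrib]
      refine Finset.sum_congr rfl fun μ _ => ?_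
      rw [hD, TensorProduct.add_tmul, ← mul_assoc, ← mul_assoc, (hn μ a).eq, add_comm]

/-- Each application multiplies the second tensor factor by some n μ and so moves it one step down
the filtration `F`. -/
theorem tensorDer_pow_eq_zero {F : ℕ → Submodule ℝ A} (h0 : F 0 = ⊤)
    (hF : ∀ k μ, ∀ a ∈ F k, n μ * a ∈ F (k + 1)) {N : ℕ} (hN : F N = ⊥) :
    tensorDer D n ^ N = 0 := by
  have key : ∀ k (t : S ⊗[ℝ] A),
      (tensorDer D n ^ k) t ∈ LinearMap.range (LinearMap.lTensor S (F k).subtype) := by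
    intro k
    induction k with
    | zero =>
      intro t
      induction t using TensorProduct.induction_on with
      | zero => simp
      | add a b ha hb => rw [map_add]; exact add_mem ha hb
      | tmul f a => exact ⟨f ⊗ₜ ⟨a, h0 ▸ trivial⟩, by simp⟩
    | succ k ih =>
      intro t
      rw [pow_succ', Module.End.mul_apply]
      obtain ⟨u, hu⟩ := ih t
      rw [← hu]
      clear hu
      induction u using TensorProduct.induction_on with
      | zero => simp
      | add a b ha hb => rw [map_add, map_add]; exact add_mem ha hb
      | tmul f a =>
        rw [LinearMap.lTensor_tmul, tensorDer_tmul]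
        exact Submodule.sum_mem _ fun μ _ => ⟨D μ f ⊗ₜ ⟨n μ * a.1, hF k μ _ a.2⟩, by simp⟩
  refine LinearMap.ext fun t => ?_
  obtain ⟨u, hu⟩ := key N t
  rw [← hu]
  have : (F N).subtype = 0 := LinearMap.ext fun a => by simpa [hN] using a.2
  rw [this]
  simp

/-- A homomorphism `c` composed with the Taylor expansion in the direction of nilpotent
central elements `n μ` is a homomorphism. -/
theorem exists_taylor (hD : ∀ μ f g, D μ (f * g) = D μ f * g + f * D μ g)
    (hn : ∀ μ a, Commute (n μ) a) (hnil : IsNilpotent (tensorDer D n)) (c : S →ₐ[ℝ] A)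
    (hc : ∀ f a, Commute (c f) a) :
    ∃ φ : S →ₐ[ℝ] A, ∀ f, (∀ μ ν, D ν (D μ f) = 0) → φ f = c f + ∑ μ, c (D μ f) * n μ := by
  -- The exponential of a nilpotent endomorphism is formed with rational coefficients 1/k!.
  let _ : Module ℚ (S ⊗[ℝ] A) := Module.compHom _ (algebraMap ℚ ℝ)
  have hmul := Module.End.exp_mul_of_derivation ℝ _ (tensorDer D n) (tensorDer_mul hD hn) hnil
  obtain ⟨N, hN⟩ := hnil
  have hD1 : ∀ μ, D μ 1 = 0 := fun μ => by simpa using hD μ 1 1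
  have hexp : ∀ t, tensorDer D n (tensorDer D n t) = 0 →
      IsNilpotent.exp (tensorDer D n) t = t + tensorDer D n t := fun t ht => by
    -- Taking N + 2 terms instead of N guarantees that the terms of order 0 and 1 can be split off.
    rw [IsNilpotent.exp_eq_sum (k := N + 2) (by rw [pow_add, hN, zero_mul]), LinearMap.sum_apply,
      Finset.sum_range_succ', Finset.sum_range_succ', Finset.sum_eq_zero]
    · simp [add_comm]
    · intro k _
      rw [LinearMap.smul_apply, pow_succ, pow_succ, Module.End.mul_apply, Module.End.mul_apply, ht,
        map_zero, smul_zero]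
  have h1 : IsNilpotent.exp (tensorDer D n) (1 : S ⊗[ℝ] A) = 1 := by
    have : tensorDer D n (1 : S ⊗[ℝ] A) = 0 := by
      rw [Algebra.TensorProduct.one_def, tensorDer_tmul]
      simp [hD1]
    rw [hexp _ (by rw [this, map_zero]), this, add_zero]
  let m : S ⊗[ℝ] A →ₐ[ℝ] A := Algebra.TensorProduct.lift c (AlgHom.id ℝ A) fun f a => hc f a
  have hm : ∀ f a, m (f ⊗ₜ a) = c f * a := fun f a => by
    simpa using Algebra.TensorProduct.lift_tmul (S := ℝ) c (AlgHom.id ℝ A) (fun f a => hc f a) f a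
  let e : S ⊗[ℝ] A →ₐ[ℝ] S ⊗[ℝ] A := AlgHom.ofLinearMap (IsNilpotent.exp (tensorDer D n)) h1 hmul
  -- The exponential of a nilpotent derivation is multiplicative; applied to f ⊗ 1 and then
  -- contracted by m it is the Taylor series of f about c in the direction n.
  refine ⟨(m.comp e).comp Algebra.TensorProduct.includeLeft, fun f hf => ?_⟩
  have h2 : tensorDer D n (tensorDer D n (f ⊗ₜ 1)) = 0 := by
    rw [tensorDer_tmul, map_sum]
    refine Finset.sum_eq_zero fun μ _ => ?_
    rw [tensorDer_tmul]
    simp [hf]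
  change m (IsNilpotent.exp (tensorDer D n) (f ⊗ₜ 1)) = _
  rw [hexp _ h2, tensorDer_tmul, map_add, map_sum]
  simp only [hm, mul_one]

theorem exists_tensorLift {L : Type} [Ring L] [Algebra ℝ L] (φ : S →ₐ[ℝ] A) (ψ : L →ₐ[ℝ] A)
    (h : ∀ f w, φ f * ψ w = ψ w * φ f) :
    ∃ θ : S ⊗[ℝ] L →ₐ[ℝ] A, ∀ f w, θ (f ⊗ₜ w) = φ f * ψ w :=
  ⟨Algebra.TensorProduct.lift φ ψ h, fun f w => by
    simpa using Algebra.TensorProduct.lift_tmul (S := ℝ) φ ψ h f w⟩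

theorem mul_self_eq_zero_of_eq_neg {x : A} (h : x * x = x * -x) : x * x = 0 := by
  have h2 : (2 : ℝ) • (x * x) = 0 := by
    rw [two_smul]; nth_rewrite 2 [h]; simp
  exact (smul_eq_zero.1 h2).resolve_left two_ne_zero

end Taylor

namespace Model

variable {ι κ ι' κ' : Type} [Fintype ι] [Fintype κ] [Fintype ι'] [Fintype κ']
  {V : Opens (ι → ℝ)} {W : Opens (ι' → ℝ)}

/-! #### Maps that are determined by the coordinates -/

/-- With q the body of y at z, Hadamard's lemma gives Δ f = Σ (y μ − q μ) Δ(g μ), the constant f(q)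
being killed by `h1`. Since y μ − q μ has no scalar part at z, each round raises by one the degree
known for the value at z of Δ f, simultaneously for all f. -/
theorem eq_zero_of_smooth (Δ : Smooth ι V →ₗ[ℝ] Model ι' κ' W) (y : ι → Model ι' κ' W)
    (h1 : Δ 1 = 0) (he : ∀ μ g, Δ (Smooth.coord V μ * g) = y μ * Δ g)
    (hb : ∀ z, (fun μ => body (y μ) z) ∈ V) : Δ = 0 := by
  ext1 f
  refine eq_zero_of_mem_filt fun z => ?_
  generalize Fintype.card κ' + 1 = k
  induction k generalizing f with
  | zero => exact Ext.mem_filt_zero _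
  | succ k ih =>
    set q : V := ⟨_, hb z⟩ with hq
    obtain ⟨g, hg⟩ := Smooth.exists_hadamard f q
    have hf : f = f q • (1 : Smooth ι V) +
        ∑ μ, (Smooth.coord V μ * g μ - q.1 μ • g μ) := by
      ext x
      rw [hg x]
      simp only [ContMDiffMap.coe_add, Pi.add_apply, ContMDiffMap.coe_smul, Pi.smul_apply,
        ContMDiffMap.coe_one, Pi.one_apply, smul_eq_mul, mul_one]
      congr 1
      change _ = Model.evalSmooth x (∑ μ, (Smooth.coord V μ * g μ - q.1 μ • g μ))
      rw [map_sum]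
      refine Finset.sum_congr rfl fun μ _ => ?_
      rw [sub_mul]; rfl
    have hΔ : Δ f = ∑ μ, (y μ - q.1 μ • 1) * Δ (g μ) := by
      conv_lhs => rw [hf]
      rw [map_add, map_smul, h1, smul_zero, zero_add, map_sum]
      refine Finset.sum_congr rfl fun μ _ => ?_
      rw [map_sub, he, map_smul, sub_mul, smul_mul_assoc, one_mul]
    rw [hΔ, map_sum]
    refine Submodule.sum_mem _ fun μ _ => ?_
    rw [map_mul]
    refine Ext.mul_mem_filt (Ext.mem_filt_of_algebraMapInv_eq_zero ?_) (ih (g μ))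
    rw [algebraMapInv_ev, map_sub, map_smul, map_one]
    simp [hq]

/-- A linear map of functions on superdomains that annihilates the constants and is linear over
the coordinates vanishes. -/
theorem eq_zero_of_coord (Δ : Model ι κ V →ₗ[ℝ] Model ι' κ' W) (y : ι → Model ι' κ' W)
    (s : κ → Model ι' κ' W) (h1 : Δ 1 = 0) (he : ∀ μ g, Δ (even V μ * g) = y μ * Δ g)
    (ho : ∀ j g, Δ (odd V j * g) = s j * Δ g)
    (hb : ∀ z, (fun μ => body (y μ) z) ∈ V) : Δ = 0 := by
  classical
  have h0 : ∀ f : Smooth ι V, Δ (f ⊗ₜ 1) = 0 := by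
    have := eq_zero_of_smooth (Δ ∘ₗ (TensorProduct.mk ℝ (Smooth ι V) (Ext κ)).flip 1) y h1
      (fun μ g => by
        have := he μ (g ⊗ₜ 1)
        simpa [even] using this) hb
    exact fun f => LinearMap.congr_fun this f
  refine TensorProduct.ext' fun f w => ?_
  rw [LinearMap.zero_apply]
  induction w using CliffordAlgebra.left_induction with
  | algebraMap r =>
    rw [Algebra.algebraMap_eq_smul_one, TensorProduct.tmul_smul, map_smul, h0, smul_zero]
  | add x y hx hy => rw [TensorProduct.tmul_add, map_add, hx, hy, add_zero]
  | ι_mul x v hx =>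
    have : f ⊗ₜ[ℝ] (ExteriorAlgebra.ι ℝ v * x) = ∑ j, v j • (odd V j * f ⊗ₜ[ℝ] x) := by
      conv_lhs => rw [pi_eq_sum_univ' v]
      simp only [map_sum, map_smul, Finset.sum_mul, TensorProduct.tmul_sum, smul_mul_assoc,
        TensorProduct.tmul_smul, odd, Algebra.TensorProduct.tmul_mul_tmul, one_mul]
    change Δ (f ⊗ₜ[ℝ] (ExteriorAlgebra.ι ℝ v * x)) = 0
    rw [this, map_sum]
    exact Finset.sum_eq_zero fun j _ => by rw [map_smul, ho, hx, mul_zero, smul_zero]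

/-- Homomorphisms of functions on superdomains are determined by their values on coordinates. -/
theorem algHom_ext {φ ψ : Model ι κ V →ₐ[ℝ] Model ι' κ' W}
    (he : ∀ μ, φ (even V μ) = ψ (even V μ)) (ho : ∀ j, φ (odd V j) = ψ (odd V j))
    (hb : ∀ z, (fun μ => body (φ (even V μ)) z) ∈ V) : φ = ψ := by
  -- Since φ and ψ agree on a coordinate x, their difference satisfies (φ − ψ)(x g) = φ(x) (φ −
  -- ψ)(g).
  have := eq_zero_of_coord (φ.toLinearMap - ψ.toLinearMap) (fun μ => φ (even V μ))
    (fun j => φ (odd V j)) (by simp) (fun μ g => by simp [he, mul_sub])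
    (fun j g => by simp [ho, mul_sub]) hb
  exact AlgHom.ext fun f => sub_eq_zero.1 (LinearMap.congr_fun this f)

/-! #### Substitution -/

section Subst

variable (y : ι → Model ι' κ' W) (η : κ → Model ι' κ' W) (hy : ∀ μ, inv (y μ) = y μ)
  (hη : ∀ j, inv (η j) = -η j) (hb : ∀ z, (fun μ => body (y μ) z) ∈ V)

-- The image of f is its Taylor series about the bodies of the y μ in the nilpotent parts n μ, which
-- are central because they are even. The filtration `F` measures the degree of the value at every
-- point. That the images are even follows by rigidity: composing with the involution does not
-- change the values on coordinates.
include hy hb in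
theorem exists_substSmooth : ∃ φ : Smooth ι V →ₐ[ℝ] Model ι' κ' W,
    (∀ μ, φ (Smooth.coord V μ) = y μ) ∧ ∀ f, inv (φ f) = φ f := by
  classical
  let n : ι → Model ι' κ' W := fun μ => y μ - body (y μ) ⊗ₜ 1
  have hn : ∀ μ a, Commute (n μ) a := fun μ a =>
    (mul_comm_of_even (x := a) (by simp [n, hy])).symm
  let F : ℕ → Submodule ℝ (Model ι' κ' W) := fun k =>
    ⨅ z, (Ext.filt k).comap (ev z).toLinearMap
  have hF : ∀ k a, a ∈ F k ↔ ∀ z, ev z a ∈ Ext.filt k := fun k a => by simp [F]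
  have hnil : IsNilpotent (tensorDer (Smooth.pderiv V) n) :=
    ⟨Fintype.card κ' + 1, tensorDer_pow_eq_zero (F := F)
      (eq_top_iff.2 fun a _ => (hF 0 a).2 fun z => Ext.mem_filt_zero _)
      (fun k μ a ha => (hF _ _).2 fun z => by
        rw [map_mul]
        exact Ext.mul_mem_filt (ev_sub_body_mem z (y μ)) ((hF _ _).1 ha z))
      (eq_bot_iff.2 fun a ha => eq_zero_of_mem_filt fun z => (hF _ _).1 ha z)⟩
  let c : Smooth ι V →ₐ[ℝ] Model ι' κ' W :=
    Algebra.TensorProduct.includeLeft.comp (Smooth.comp (fun μ => body (y μ)) hb)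
  obtain ⟨φ, hφ⟩ := exists_taylor (D := Smooth.pderiv V) (fun μ => Smooth.pderiv_mul μ) hn hnil c
    fun f a => tmul_one_commute _ a
  have hcoord : ∀ μ, φ (Smooth.coord V μ) = y μ := fun μ => by
    have h1 : ∀ ν, Smooth.pderiv V ν (1 : Smooth ι V) = 0 := fun ν => by
      simpa using Smooth.pderiv_mul ν (1 : Smooth ι V) 1
    rw [hφ _ fun ν ρ => by rw [Smooth.pderiv_coord]; split_ifs <;> simp [h1],
      Finset.sum_eq_single μ]
    · rw [Smooth.pderiv_coord, if_pos rfl, map_one, one_mul]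
      have : c (Smooth.coord V μ) = body (y μ) ⊗ₜ 1 := rfl
      rw [this]
      exact add_sub_cancel _ _
    · intro ν _ hν
      rw [Smooth.pderiv_coord, if_neg hν, map_zero, zero_mul]
    · simp
  refine ⟨φ, hcoord, fun f => ?_⟩
  have := eq_zero_of_smooth ((inv.toLinearMap ∘ₗ φ.toLinearMap) - φ.toLinearMap) y (by simp)
    (fun μ g => by simp [hcoord, hy, mul_sub]) hb
  exact sub_eq_zero.1 (LinearMap.congr_fun this f)

-- Odd elements square to zero, so the universal property of the exterior algebra takes care of the
-- odd coordinates. The two halves combine because images of smooth functions are even, hence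
-- central.
include hy hη hb in
theorem exists_subst : ∃ φ : Model ι κ V →ₐ[ℝ] Model ι' κ' W,
    (∀ μ, φ (even V μ) = y μ) ∧ ∀ j, φ (odd V j) = η j := by
  classical
  obtain ⟨φ, hφ, hinv⟩ := exists_substSmooth y hy hb
  let L : (κ → ℝ) →ₗ[ℝ] Model ι' κ' W := ∑ j, (LinearMap.proj j).smulRight (η j)
  have hL : ∀ v, inv (L v) = -L v := fun v => by
    simp [L, LinearMap.sum_apply, hη]
  let ψ : Ext κ →ₐ[ℝ] Model ι' κ' W := ExteriorAlgebra.lift ℝ ⟨L, fun v => by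
    exact mul_self_eq_zero_of_eq_neg ((mul_comm_of_odd (x := L v) (hL v)).trans (by rw [hL]))⟩
  obtain ⟨θ, hθ⟩ := exists_tensorLift φ ψ fun f w => (mul_comm_of_even (hinv f)).symm
  refine ⟨θ, fun μ => ?_, fun j => ?_⟩
  · rw [even, hθ, map_one, mul_one, hφ]
  · rw [odd, hθ, map_one, one_mul]
    simp only [ψ]
    rw [ExteriorAlgebra.lift_ι_apply]
    simp [L, LinearMap.sum_apply, Pi.single_apply]

/-- The homomorphism which substitutes even functions `y μ` for the even coordinates and odd
functions `η j` for the odd ones. -/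
def subst : Model ι κ V →ₐ[ℝ] Model ι' κ' W := (exists_subst y η hy hη hb).choose

@[simp]
theorem subst_even (μ : ι) : subst y η hy hη hb (even V μ) = y μ :=
  (exists_subst y η hy hη hb).choose_spec.1 μ

@[simp]
theorem subst_odd (j : κ) : subst y η hy hη hb (odd V j) = η j :=
  (exists_subst y η hy hη hb).choose_spec.2 j

end Subst

/-- Homomorphisms that preserve the parity of the coordinates preserve parity. -/
theorem inv_map {φ : Model ι κ V →ₐ[ℝ] Model ι' κ' W}
    (he : ∀ μ, inv (φ (even V μ)) = φ (even V μ)) (ho : ∀ j, inv (φ (odd V j)) = -φ (odd V j))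
    (hb : ∀ z, (fun μ => body (φ (even V μ)) z) ∈ V) (f : Model ι κ V) :
    φ (inv f) = inv (φ f) := by
  have : φ.comp inv = inv.comp φ := algHom_ext (fun μ => by simp [he])
    (fun j => by simp [ho]) (by simpa using hb)
  exact DFunLike.congr_fun this f

/-- The bodies of functions are pulled back along the map of the bodies. -/
theorem body_map {φ : Model ι κ V →ₐ[ℝ] Model ι' κ' W}
    (ho : ∀ j, inv (φ (odd V j)) = -φ (odd V j))
    (hb : ∀ z, (fun μ => body (φ (even V μ)) z) ∈ V) (f : Model ι κ V) (z : W) :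
    body (φ f) z = body f ⟨_, hb z⟩ := by
  -- The scalar part is unchanged by the parity involution, so an odd function has body b = −b.
  have hodd : ∀ a : Model ι' κ' W, inv a = -a → body a = 0 := fun a ha => by
    have h : body (inv a) = body a := by
      ext z
      rw [← algebraMapInv_ev, ← algebraMapInv_ev, ev_inv]
      have : (ExteriorAlgebra.algebraMapInv : Ext κ' →ₐ[ℝ] ℝ).comp Ext.inv =
          ExteriorAlgebra.algebraMapInv := by
        ext v
        simp [Ext.inv, ExteriorAlgebra.algebraMapInv]
      exact DFunLike.congr_fun this _
    rw [ha, map_neg] at h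
    ext z
    have := congrArg (fun f : Smooth ι' W => f z) h
    simp only [ContMDiffMap.coe_neg, Pi.neg_apply] at this
    simp only [ContMDiffMap.coe_zero, Pi.zero_apply]
    linarith
  -- Bodies are embedded again as functions on the superdomain, because `algHom_ext` compares
  -- homomorphisms into a superdomain.
  let i : Smooth ι' W →ₐ[ℝ] Model ι' κ' W := Algebra.TensorProduct.includeLeft
  have hi : ∀ f, body (i f) = f := fun f => by simp [i]
  have : (i.comp body).comp φ =
      (i.comp (Smooth.comp (fun μ => body (φ (even V μ))) hb)).comp body := by
    refine algHom_ext (fun μ => ?_) (fun j => ?_) fun z => ?_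
    · simp only [AlgHom.comp_apply]
      congr 1
      ext z
      rw [Smooth.comp_apply, body_even]
    · simp only [AlgHom.comp_apply]
      rw [hodd _ (ho j), map_zero]
      have : body (odd V j : Model ι κ V) = 0 := by ext z; simp
      rw [this, map_zero, map_zero]
    · simpa [hi] using hb z
  have h := congrArg body (DFunLike.congr_fun this f)
  simp only [AlgHom.comp_apply, hi] at h
  rw [h, Smooth.comp_apply]

end Model


/-! ### Partial derivatives and the de Rham differential on superdomains -/

namespace Ext

variable {κ : Type} [Fintype κ]

/-- The derivative along an odd coordinate direction. -/
def contract (d : Module.Dual ℝ (κ → ℝ)) : Ext κ →ₗ[ℝ] Ext κ := CliffordAlgebra.contractLeft d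

theorem contract_ι_mul (d : Module.Dual ℝ (κ → ℝ)) (v : κ → ℝ) (x : Ext κ) :
    contract d (ExteriorAlgebra.ι ℝ v * x) = d v • x - ExteriorAlgebra.ι ℝ v * contract d x :=
  CliffordAlgebra.contractLeft_ι_mul d v x

theorem contract_algebraMap (d : Module.Dual ℝ (κ → ℝ)) (r : ℝ) :
    contract d (algebraMap ℝ (Ext κ) r) = 0 :=
  CliffordAlgebra.contractLeft_algebraMap _ d r

theorem contract_ι (d : Module.Dual ℝ (κ → ℝ)) (v : κ → ℝ) :
    contract d (ExteriorAlgebra.ι ℝ v) = algebraMap ℝ _ (d v) :=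
  CliffordAlgebra.contractLeft_ι _ d v

theorem contract_mul (d : Module.Dual ℝ (κ → ℝ)) (x y : Ext κ) :
    contract d (x * y) = contract d x * y + inv x * contract d y := by
  induction x using CliffordAlgebra.left_induction with
  | algebraMap r =>
    rw [contract_algebraMap, AlgHom.commutes, zero_mul, zero_add, ← Algebra.smul_def, map_smul,
      Algebra.smul_def]
  | add x x' h h' => simp only [add_mul, map_add, h, h']; abel
  | ι_mul x v h =>
    change contract d (ExteriorAlgebra.ι ℝ v * x * y) = contract d (ExteriorAlgebra.ι ℝ v * x) * y +
      inv (ExteriorAlgebra.ι ℝ v * x) * contract d y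
    rw [mul_assoc, contract_ι_mul, contract_ι_mul, h, map_mul]
    have : inv (ExteriorAlgebra.ι ℝ v) = -ExteriorAlgebra.ι ℝ v := CliffordAlgebra.involute_ι v
    rw [this, mul_add, sub_mul, smul_mul_assoc, neg_mul, neg_mul, mul_assoc, mul_assoc]
    abel

theorem inv_contract (d : Module.Dual ℝ (κ → ℝ)) (x : Ext κ) :
    inv (contract d x) = -contract d (inv x) := by
  induction x using CliffordAlgebra.left_induction with
  | algebraMap r => rw [AlgHom.commutes, contract_algebraMap, map_zero, neg_zero]
  | add x x' h h' => simp only [map_add, h, h']; abel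
  | ι_mul x v h =>
    change inv (contract d (ExteriorAlgebra.ι ℝ v * x)) =
      -contract d (inv (ExteriorAlgebra.ι ℝ v * x))
    have : inv (ExteriorAlgebra.ι ℝ v) = -ExteriorAlgebra.ι ℝ v := CliffordAlgebra.involute_ι v
    rw [contract_ι_mul, map_mul, this, neg_mul, map_neg, contract_ι_mul, map_sub, map_mul, h, this,
      map_smul]
    simp

end Ext

namespace Model

section Derivations

variable {ι κ : Type} [Fintype ι] [Fintype κ] {V : Opens (ι → ℝ)}

theorem neg_mul' (a b : Model ι κ V) : -a * b = -(a * b) := neg_mul a b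

theorem mul_neg' (a b : Model ι κ V) : a * -b = -(a * b) := mul_neg a b

/-- The derivative along an even coordinate. -/
def dEven (μ : ι) : Model ι κ V →ₗ[ℝ] Model ι κ V := LinearMap.rTensor _ (Smooth.pderiv V μ)

/-- The derivative along an odd coordinate. -/
def dOdd (j : κ) : Model ι κ V →ₗ[ℝ] Model ι κ V :=
  LinearMap.lTensor _ (Ext.contract (LinearMap.proj j))

@[simp]
theorem dEven_tmul (μ : ι) (f : Smooth ι V) (w : Ext κ) :
    dEven μ (f ⊗ₜ[ℝ] w : Model ι κ V) = Smooth.pderiv V μ f ⊗ₜ w := rfl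

@[simp]
theorem dOdd_tmul (j : κ) (f : Smooth ι V) (w : Ext κ) :
    dOdd j (f ⊗ₜ[ℝ] w : Model ι κ V) = f ⊗ₜ Ext.contract (LinearMap.proj j) w := rfl

theorem dEven_mul (μ : ι) (a b : Model ι κ V) :
    dEven μ (a * b) = dEven μ a * b + a * dEven μ b := by
  induction a using TensorProduct.induction_on with
  | zero => simp
  | add a a' h h' => simp only [add_mul, map_add, h, h']; abel
  | tmul f v =>
    induction b using TensorProduct.induction_on with
    | zero => simp
    | add b b' h h' => simp only [mul_add, map_add, h, h']; abel
    | tmul g w =>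
      simp only [Algebra.TensorProduct.tmul_mul_tmul, dEven_tmul, Smooth.pderiv_mul,
        TensorProduct.add_tmul]

theorem dOdd_mul (j : κ) (a b : Model ι κ V) :
    dOdd j (a * b) = dOdd j a * b + inv a * dOdd j b := by
  induction a using TensorProduct.induction_on with
  | zero => simp
  | add a a' h h' => simp only [add_mul, map_add, h, h']; abel
  | tmul f v =>
    induction b using TensorProduct.induction_on with
    | zero => simp
    | add b b' h h' => simp only [mul_add, map_add, h, h']; abel
    | tmul g w =>
      simp only [Algebra.TensorProduct.tmul_mul_tmul, dOdd_tmul, Ext.contract_mul, inv_tmul,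
        TensorProduct.tmul_add]

theorem inv_dEven (μ : ι) (a : Model ι κ V) : inv (dEven μ a) = dEven μ (inv a) := by
  induction a using TensorProduct.induction_on with
  | zero => simp
  | add a a' h h' => simp only [map_add, h, h']
  | tmul f v => simp

theorem inv_dOdd (j : κ) (a : Model ι κ V) : inv (dOdd j a) = -dOdd j (inv a) := by
  induction a using TensorProduct.induction_on with
  | zero => simp
  | add a a' h h' => simp only [map_add, h, h', neg_add]
  | tmul f v => simp only [dOdd_tmul, inv_tmul, Ext.inv_contract, TensorProduct.tmul_neg]

theorem dEven_res {U V : Opens (ι → ℝ)} (h : U ≤ V) (μ : ι) (a : Model ι κ V) :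
    dEven μ (res h a) = res h (dEven μ a) := by
  induction a using TensorProduct.induction_on with
  | zero => simp
  | add a a' h h' => simp only [map_add, h, h']
  | tmul f v => simp [res, Smooth.pderiv_res]

theorem dOdd_res {U V : Opens (ι → ℝ)} (h : U ≤ V) (j : κ) (a : Model ι κ V) :
    dOdd j (res h a) = res h (dOdd j a) := by
  induction a using TensorProduct.induction_on with
  | zero => simp
  | add a a' h h' => simp only [map_add, h, h']
  | tmul f v => simp [res]

theorem dEven_even [DecidableEq ι] (μ ν : ι) :
    dEven μ (even V ν : Model ι κ V) = if μ = ν then 1 else 0 := by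
  rw [even, dEven_tmul, Smooth.pderiv_coord]
  split_ifs
  · rfl
  · simp

theorem pderiv_one (μ : ι) : Smooth.pderiv V μ 1 = 0 := by
  simpa using Smooth.pderiv_mul μ (1 : Smooth ι V) 1

theorem dEven_odd (μ : ι) (j : κ) : dEven μ (odd V j : Model ι κ V) = 0 := by
  rw [odd, dEven_tmul, pderiv_one, TensorProduct.zero_tmul]

theorem dOdd_even (j : κ) (μ : ι) : dOdd j (even V μ : Model ι κ V) = 0 := by
  have : Ext.contract (LinearMap.proj j) (1 : Ext κ) = 0 := by
    simpa using Ext.contract_algebraMap (LinearMap.proj j) 1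
  rw [even, dOdd_tmul, this, TensorProduct.tmul_zero]

theorem dOdd_odd [DecidableEq κ] (j k : κ) :
    dOdd j (odd V k : Model ι κ V) = if j = k then 1 else 0 := by
  rw [odd, dOdd_tmul, Ext.contract_ι]
  split_ifs with h
  · subst h; simp [Algebra.TensorProduct.one_def]
  · simp [h]

end Derivations

section DeRham

variable {ι κ : Type} [Fintype ι] [Fintype κ] {V : Opens (ι ⊕ κ → ℝ)}

/-- The de Rham differential on the superdomain with even coordinates `x^μ, dξ^j` and odd
coordinates `ξ^j, dx^μ`. -/
def deRham : Model (ι ⊕ κ) (κ ⊕ ι) V →ₗ[ℝ] Model (ι ⊕ κ) (κ ⊕ ι) V :=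
  ∑ μ : ι, LinearMap.mulLeft ℝ (odd V (Sum.inr μ)) ∘ₗ dEven (Sum.inl μ) +
    ∑ j : κ, LinearMap.mulLeft ℝ (even V (Sum.inr j)) ∘ₗ dOdd (Sum.inl j)

theorem deRham_apply (a : Model (ι ⊕ κ) (κ ⊕ ι) V) :
    deRham a = ∑ μ : ι, odd V (Sum.inr μ) * dEven (Sum.inl μ) a +
      ∑ j : κ, even V (Sum.inr j) * dOdd (Sum.inl j) a := by
  simp [deRham, LinearMap.sum_apply]

/-- The sign has two sources with the same effect: an odd coefficient dx^μ has to move past a, while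
for the even coefficient dξ^j it is the odd derivative that already carries the sign. -/
theorem deRham_mul (a b : Model (ι ⊕ κ) (κ ⊕ ι) V) :
    deRham (a * b) = deRham a * b + inv a * deRham b := by
  have h1 : ∀ (μ : ι), odd V (Sum.inr μ) * dEven (Sum.inl μ) (a * b) =
      odd V (Sum.inr μ) * dEven (Sum.inl μ) a * b +
        inv a * (odd V (Sum.inr μ) * dEven (Sum.inl μ) b) := fun μ => by
    have := mul_comm_of_odd (x := inv a) (inv_odd (κ := κ ⊕ ι) (V := V) (Sum.inr μ))
    rw [inv_inv] at this
    rw [dEven_mul, mul_add, ← mul_assoc, ← mul_assoc, ← mul_assoc, this]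
  have h2 : ∀ (j : κ), even V (Sum.inr j) * dOdd (Sum.inl j) (a * b) =
      even V (Sum.inr j) * dOdd (Sum.inl j) a * b +
        inv a * (even V (Sum.inr j) * dOdd (Sum.inl j) b) := fun j => by
    have := mul_comm_of_even (x := inv a) (inv_even (κ := κ ⊕ ι) (V := V) (Sum.inr j))
    rw [dOdd_mul, mul_add, ← mul_assoc, ← mul_assoc, ← mul_assoc, this]
  simp only [deRham_apply, h1, h2, Finset.sum_add_distrib, add_mul, mul_add, Finset.sum_mul,
    Finset.mul_sum]
  abel

theorem inv_deRham (a : Model (ι ⊕ κ) (κ ⊕ ι) V) : inv (deRham a) = -deRham (inv a) := by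
  simp only [deRham_apply, map_add, map_sum, map_mul, inv_odd, inv_even, inv_dEven, inv_dOdd,
    neg_mul', mul_neg', Finset.sum_neg_distrib, neg_add]

theorem deRham_res {U V : Opens (ι ⊕ κ → ℝ)} (h : U ≤ V) (a : Model (ι ⊕ κ) (κ ⊕ ι) V) :
    deRham (res h a) = res h (deRham a) := by
  simp only [deRham_apply, map_add, map_sum, map_mul, res_odd, res_even, dEven_res, dOdd_res]

@[simp]
theorem deRham_even_inl (μ : ι) :
    deRham (even V (Sum.inl μ) : Model (ι ⊕ κ) (κ ⊕ ι) V) = odd V (Sum.inr μ) := by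
  classical
  rw [deRham_apply, Finset.sum_eq_single μ]
  · simp [dEven_even, dOdd_even]
  · intro ν _ h
    rw [dEven_even, if_neg (by simpa using h), mul_zero]
  · simp

@[simp]
theorem deRham_odd_inl (j : κ) :
    deRham (odd V (Sum.inl j) : Model (ι ⊕ κ) (κ ⊕ ι) V) = even V (Sum.inr j) := by
  classical
  rw [deRham_apply, add_comm, Finset.sum_eq_single j]
  · simp [dEven_odd, dOdd_odd]
  · intro ν _ h
    rw [dOdd_odd, if_neg (by simpa using h), mul_zero]
  · simp

@[simp]
theorem deRham_even_inr (j : κ) :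
    deRham (even V (Sum.inr j) : Model (ι ⊕ κ) (κ ⊕ ι) V) = 0 := by
  classical
  simp [deRham_apply, dEven_even, dOdd_even]

@[simp]
theorem deRham_odd_inr (μ : ι) :
    deRham (odd V (Sum.inr μ) : Model (ι ⊕ κ) (κ ⊕ ι) V) = 0 := by
  classical
  simp [deRham_apply, dEven_odd, dOdd_odd]

/-- The mixed terms cancel, so d² is linear over every x with d² x = 0, and all coordinates have
this property. -/
theorem deRham_deRham (a : Model (ι ⊕ κ) (κ ⊕ ι) V) : deRham (deRham a) = 0 := by
  have hone : deRham (1 : Model (ι ⊕ κ) (κ ⊕ ι) V) = 0 := by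
    have := deRham_mul (1 : Model (ι ⊕ κ) (κ ⊕ ι) V) 1
    simpa using this
  have key : ∀ x g : Model (ι ⊕ κ) (κ ⊕ ι) V, deRham (deRham x) = 0 →
      deRham (deRham (x * g)) = x * deRham (deRham g) := fun x g hx => by
    rw [deRham_mul, map_add, deRham_mul, deRham_mul, hx, inv_deRham, inv_inv,
      neg_mul', zero_mul, zero_add, neg_add_cancel_left]
  have := eq_zero_of_coord (deRham ∘ₗ deRham : Model (ι ⊕ κ) (κ ⊕ ι) V →ₗ[ℝ] _)
    (fun μ => even V μ) (fun j => odd V j) (by simp [hone])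
    (fun μ g => key _ _ (by rcases μ with μ | j <;> simp))
    (fun j g => key _ _ (by rcases j with j | μ <;> simp))
    (fun z => by simp)
  exact LinearMap.congr_fun this a

end DeRham

end Model


/-! ### Sheaves of superalgebras -/

namespace SuperSheaf

variable {X : Type u} [TopologicalSpace X] (O : SuperSheaf X)

theorem res_eq_self {U : Opens X} (h : U ≤ U) (f : O.Sec U) : O.res h f = f := O.res_self U f

theorem exists_glue {I : Type u} (U : I → Opens X) (W : Opens X) (hU : ∀ i, U i ≤ W)
    (hW : ∀ x ∈ W, ∃ i, x ∈ U i) (s : ∀ i, O.Sec (U i))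
    (hs : ∀ i j, O.res (inf_le_left : U i ⊓ U j ≤ U i) (s i) = O.res inf_le_right (s j)) :
    ∃ f : O.Sec W, ∀ i, O.res (hU i) f = s i := by
  obtain rfl : W = ⨆ i, U i := le_antisymm
    (fun x hx => Opens.mem_iSup.2 (hW x hx)) (iSup_le hU)
  obtain ⟨f, hf, -⟩ := O.glue U s hs
  exact ⟨f, hf⟩

theorem eq_of_cover {I : Type u} (U : I → Opens X) (W : Opens X) (hU : ∀ i, U i ≤ W)
    (hW : ∀ x ∈ W, ∃ i, x ∈ U i) {f g : O.Sec W} (h : ∀ i, O.res (hU i) f = O.res (hU i) g) :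
    f = g := by
  obtain rfl : W = ⨆ i, U i := le_antisymm
    (fun x hx => Opens.mem_iSup.2 (hW x hx)) (iSup_le hU)
  obtain ⟨e, -, he⟩ := O.glue U (fun i => O.res (le_iSup U i) g) fun i j => by
    rw [O.res_res, O.res_res]
  rw [he f h, he g fun _ => rfl]

theorem eq_of_locally {W : Opens X} {f g : O.Sec W}
    (h : ∀ x ∈ W, ∃ U : Opens X, ∃ hU : U ≤ W, x ∈ U ∧ O.res hU f = O.res hU g) : f = g := by
  choose U hU hx he using h
  exact O.eq_of_cover (fun x : W => U x.1 x.2) W (fun x => hU x.1 x.2)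
    (fun x hx' => ⟨⟨x, hx'⟩, hx x hx'⟩) fun x => he x.1 x.2

theorem exists_add_eq (U : Opens X) (i : ZMod 2) (f : O.Sec U) :
    ∃ a b, a ∈ O.par U i ∧ b ∈ O.par U (i + 1) ∧ a + b = f := by
  classical
  have h := DirectSum.sum_support_decompose (O.par U) f
  have hs : ∑ j : ZMod 2, (DirectSum.decompose (O.par U) f j : O.Sec U) = f :=
    (Finset.sum_subset (Finset.subset_univ _) fun j _ hj => by simpa using hj).symm.trans h
  have hu : (Finset.univ : Finset (ZMod 2)) = {i, i + 1} := by decide +revert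
  have hne : i ≠ i + 1 := by decide +revert
  rw [hu, Finset.sum_pair hne] at hs
  exact ⟨_, _, SetLike.coe_mem _, SetLike.coe_mem _, hs⟩

theorem eq_zero_of_mem_par {U : Opens X} {i : ZMod 2} {f : O.Sec U} (h : f ∈ O.par U i)
    (h' : f ∈ O.par U (i + 1)) : f = 0 := by
  by_contra hf
  have := DirectSum.degree_eq_of_mem_mem (O.par U) h h' hf
  exact absurd this (by clear * -; decide +revert)

/-- The component of the wrong parity is locally of both parities, hence locally zero, hence zero.
-/
theorem mem_par_of_locally {W : Opens X} {i : ZMod 2} {f : O.Sec W}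
    (h : ∀ x ∈ W, ∃ U : Opens X, ∃ hU : U ≤ W, x ∈ U ∧ O.res hU f ∈ O.par U i) :
    f ∈ O.par W i := by
  obtain ⟨a, b, ha, hb, rfl⟩ := O.exists_add_eq W i f
  have : b = 0 := O.eq_of_locally fun x hx => by
    obtain ⟨U, hU, hxU, hf⟩ := h x hx
    refine ⟨U, hU, hxU, ?_⟩
    rw [map_zero]
    refine O.eq_zero_of_mem_par ?_ (O.res_par hU _ _ hb)
    rw [map_add] at hf
    simpa using sub_mem hf (O.res_par hU _ _ ha)
  rw [this, add_zero]
  exact ha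

end SuperSheaf

/-! ### Coordinate representations -/

namespace Chart

variable {X : Type u} [TopologicalSpace X] {O : SuperSheaf X} {ι κ : Type}
  [Fintype ι] [Fintype κ] (c : Chart O ι κ)

/-- The open set of points with coordinates in `V`. -/
def pre (V : Opens (ι → ℝ)) : Opens X :=
  ⟨c.e.source ∩ c.e ⁻¹' V, c.e.isOpen_inter_preimage V.2⟩

/-- The image of an open set in the coordinate space. -/
def image (U : Opens X) : Opens (ι → ℝ) :=
  ⟨c.e.target ∩ c.e.symm ⁻¹' U, c.e.isOpen_inter_preimage_symm U.2⟩

theorem e_mem_image {U : Opens X} {x : X} (hx : x ∈ c.dom) (hU : x ∈ U) : c.e x ∈ c.image U :=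
  ⟨c.e.map_source hx, by
    change c.e.symm (c.e x) ∈ U
    rwa [c.e.left_inv hx]⟩

theorem pre_subset (V : Opens (ι → ℝ)) : (c.pre V : Set X) ⊆ c.e.source := fun _ hx => hx.1

theorem image_pre {V : Opens (ι → ℝ)} (hV : V ≤ c.img) : c.e '' c.pre V = V := by
  ext z
  constructor
  · rintro ⟨x, hx, rfl⟩
    exact hx.2
  · intro hz
    refine ⟨c.e.symm z, ⟨c.e.map_target (hV hz), ?_⟩, c.e.right_inv (hV hz)⟩
    change c.e (c.e.symm z) ∈ V
    rwa [c.e.right_inv (hV hz)]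

theorem coe_image {U : Opens X} (hU : U ≤ c.dom) : c.e '' U = c.image U := by
  ext z
  constructor
  · rintro ⟨x, hx, rfl⟩
    exact c.e_mem_image (hU hx) hx
  · rintro ⟨h1, h2⟩
    exact ⟨_, h2, c.e.right_inv h1⟩

/-- The condition that the points with coordinates in `V` form an open subset of `U`. -/
def Covers (U : Opens X) (V : Opens (ι → ℝ)) : Prop :=
  ∀ z ∈ V, z ∈ c.e.target ∧ c.e.symm z ∈ U

variable {c}

theorem Covers.le_img {U : Opens X} {V : Opens (ι → ℝ)} (h : c.Covers U V) : V ≤ c.img :=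
  fun z hz => (h z hz).1

theorem Covers.pre_le {U : Opens X} {V : Opens (ι → ℝ)} (h : c.Covers U V) : c.pre V ≤ U :=
  fun x hx => by
    have := (h _ hx.2).2
    rwa [c.e.left_inv hx.1] at this

theorem Covers.mono {U U' : Opens X} {V V' : Opens (ι → ℝ)} (h : c.Covers U V) (hU : U ≤ U')
    (hV : V' ≤ V) : c.Covers U' V' := fun z hz => ⟨(h z (hV hz)).1, hU (h z (hV hz)).2⟩

theorem covers_image (U : Opens X) : c.Covers U (c.image U) := fun _ hz => hz

variable (c)

/-- The coordinate representation over `V` of a section over `U`. -/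
def rep {U : Opens X} {V : Opens (ι → ℝ)} (h : c.Covers U V) : O.Sec U →ₐ[ℝ] Model ι κ V :=
  (c.iso (c.pre V) V (c.pre_subset V) (c.image_pre h.le_img)).symm.toAlgHom.comp (O.res h.pre_le)

theorem iso_rep {U : Opens X} {V : Opens (ι → ℝ)} (h : c.Covers U V) (f : O.Sec U) :
    c.iso (c.pre V) V (c.pre_subset V) (c.image_pre h.le_img) (c.rep h f) = O.res h.pre_le f :=
  AlgEquiv.apply_symm_apply _ _

theorem rep_res {U U' : Opens X} {V : Opens (ι → ℝ)} (h : c.Covers U V) (hU : U ≤ U')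
    (f : O.Sec U') : c.rep h (O.res hU f) = c.rep (h.mono hU le_rfl) f := by
  simp [rep, O.res_res]

theorem res_rep {U : Opens X} {V V' : Opens (ι → ℝ)} (h : c.Covers U V) (hV : V' ≤ V)
    (f : O.Sec U) : Model.res hV (c.rep h f) = c.rep (h.mono le_rfl hV) f := by
  have hp : c.pre V' ≤ c.pre V := fun x hx => ⟨hx.1, hV hx.2⟩
  apply (c.iso (c.pre V') V' (c.pre_subset V') (c.image_pre (hV.trans h.le_img))).injective
  rw [← c.iso_res (c.pre V) (c.pre V') V V' (c.pre_subset V) (c.image_pre h.le_img) _ _ hp hV,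
    iso_rep, O.res_res, iso_rep c (h.mono le_rfl hV)]

theorem rep_iso {U : Opens X} {V V' : Opens (ι → ℝ)} (hU : (U : Set X) ⊆ c.e.source)
    (hV : c.e '' U = V) (h : c.Covers U V') (k : V' ≤ V) (g : Model ι κ V) :
    c.rep h (c.iso U V hU hV g) = Model.res k g := by
  apply (c.iso (c.pre V') V' (c.pre_subset V') (c.image_pre h.le_img)).injective
  rw [iso_rep, c.iso_res U (c.pre V') V V' hU hV (c.pre_subset V') (c.image_pre h.le_img) h.pre_le k]

theorem rep_even {V : Opens (ι → ℝ)} (h : c.Covers c.dom V) (μ : ι) :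
    c.rep h (c.even μ) = Model.even V μ := by
  exact (c.rep_iso subset_rfl c.e.image_source_eq_target h h.le_img _).trans (Model.res_even _ μ)

theorem rep_odd {V : Opens (ι → ℝ)} (h : c.Covers c.dom V) (j : κ) :
    c.rep h (c.odd j) = Model.odd V j := by
  exact (c.rep_iso subset_rfl c.e.image_source_eq_target h h.le_img _).trans (Model.res_odd _ j)

theorem rep_mem_par {U : Opens X} {V : Opens (ι → ℝ)} (h : c.Covers U V) {i : ZMod 2}
    {f : O.Sec U} (hf : f ∈ O.par U i) : c.rep h f ∈ Model.par V i := by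
  rw [← c.iso_par (c.pre V) V (c.pre_subset V) (c.image_pre h.le_img), iso_rep]
  exact O.res_par _ _ _ hf

theorem even_mem_par (μ : ι) : c.even μ ∈ O.par c.dom 0 :=
  (c.iso_par _ _ _ _ _ _).2 (Model.mem_par_zero.2 (Model.inv_even μ))

theorem odd_mem_par (j : κ) : c.odd j ∈ O.par c.dom 1 :=
  (c.iso_par _ _ _ _ _ _).2 (Model.mem_par_one.2 (Model.inv_odd j))

theorem image_le {U : Opens X} {V : Opens (ι → ℝ)} (h : ∀ x ∈ U, x ∈ c.dom ∧ c.e x ∈ V) :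
    c.image U ≤ V := fun z hz => by
  have := (h _ hz.2).2
  rwa [c.e.right_inv hz.1] at this

theorem subset_source {U : Opens X} {V : Opens (ι → ℝ)} (h : ∀ x ∈ U, x ∈ c.dom ∧ c.e x ∈ V) :
    (U : Set X) ⊆ c.e.source := fun x hx => (h x hx).1

/-- The section over `U` with a given coordinate representation. -/
def sec {U : Opens X} {V : Opens (ι → ℝ)} (h : ∀ x ∈ U, x ∈ c.dom ∧ c.e x ∈ V) :
    Model ι κ V →ₐ[ℝ] O.Sec U :=
  (c.iso U (c.image U) (c.subset_source h)
    (c.coe_image fun x hx => (h x hx).1)).toAlgHom.comp (Model.res (c.image_le h))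

theorem rep_sec {U : Opens X} {V V' : Opens (ι → ℝ)} (h : ∀ x ∈ U, x ∈ c.dom ∧ c.e x ∈ V)
    (h' : c.Covers U V') (g : Model ι κ V) :
    c.rep h' (c.sec h g) = Model.res (fun z hz => c.image_le h (h' z hz)) g := by
  exact (c.rep_iso (c.subset_source h) (c.coe_image fun x hx => (h x hx).1) h'
    (fun z hz => h' z hz) _).trans (Model.res_res _ _ _)

theorem rep_injective {U : Opens X} (hU : U ≤ c.dom) :
    Function.Injective (c.rep (covers_image (c := c) U)) := by
  intro f g hfg
  have hp : U ≤ c.pre (c.image U) := fun x hx => ⟨hU hx, c.e_mem_image (hU hx) hx⟩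
  have h := congrArg (fun a => O.res hp
    (c.iso (c.pre (c.image U)) _ (c.pre_subset _) (c.image_pre fun z hz => hz.1) a)) hfg
  beta_reduce at h
  rw [iso_rep c (covers_image U), iso_rep c (covers_image U), O.res_res, O.res_res] at h
  rwa [O.res_eq_self, O.res_eq_self] at h

theorem sec_rep {U U' : Opens X} {V : Opens (ι → ℝ)} (h : ∀ x ∈ U, x ∈ c.dom ∧ c.e x ∈ V)
    (h' : c.Covers U' V) (hU : U ≤ U') (f : O.Sec U') :
    c.sec h (c.rep h' f) = O.res hU f := by
  apply c.rep_injective fun x hx => (h x hx).1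
  rw [rep_sec, res_rep, rep_res]

theorem sec_mem_par {U : Opens X} {V : Opens (ι → ℝ)} (h : ∀ x ∈ U, x ∈ c.dom ∧ c.e x ∈ V)
    {i : ZMod 2} {g : Model ι κ V} (hg : g ∈ Model.par V i) : c.sec h g ∈ O.par U i := by
  refine (c.iso_par _ _ _ _ _ _).2 ?_
  rw [Model.mem_par_iff] at hg ⊢
  change Model.inv (Model.res _ g) = _ • Model.res _ g
  rw [Model.inv_res, hg, map_smul]

theorem sec_even {U : Opens X} {V : Opens (ι → ℝ)} (h : ∀ x ∈ U, x ∈ c.dom ∧ c.e x ∈ V) (μ : ι) :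
    c.sec h (Model.even V μ) = O.res (fun x hx => (h x hx).1) (c.even μ) := by
  apply c.rep_injective fun x hx => (h x hx).1
  rw [rep_sec, Model.res_even, rep_res, rep_even]

theorem sec_odd {U : Opens X} {V : Opens (ι → ℝ)} (h : ∀ x ∈ U, x ∈ c.dom ∧ c.e x ∈ V) (j : κ) :
    c.sec h (Model.odd V j) = O.res (fun x hx => (h x hx).1) (c.odd j) := by
  apply c.rep_injective fun x hx => (h x hx).1
  rw [rep_sec, Model.res_odd, rep_res, rep_odd]

end Chart


variable {ι κ ι' κ' : Type} [Fintype ι] [Fintype κ] [Fintype ι'] [Fintype κ']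

/-! ### Values of functions at points -/

namespace Chart

variable {X : Type u} [TopologicalSpace X] {O : SuperSheaf X} (c : Chart O ι κ)

/-- The value at a point of the coordinate representation of a section. -/
def value {U : Opens X} {x : X} (hx : x ∈ c.dom) (hU : x ∈ U) : O.Sec U →ₐ[ℝ] ℝ :=
  (Model.evalSmooth ⟨c.e x, c.e_mem_image hx hU⟩).comp (Model.body.comp (c.rep (covers_image U)))

theorem value_eq {U : Opens X} {V : Opens (ι → ℝ)} (h : c.Covers U V) {x : X} (hx : x ∈ c.dom)
    (hU : x ∈ U) (hV : c.e x ∈ V) (f : O.Sec U) :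
    c.value hx hU f = Model.body (c.rep h f) ⟨c.e x, hV⟩ := by
  have hVU : V ≤ c.image U := h
  have := c.res_rep (covers_image U) hVU f
  rw [← this, Model.body_res]
  rfl

theorem value_res {U U' : Opens X} (h : U ≤ U') {x : X} (hx : x ∈ c.dom) (hU : x ∈ U)
    (f : O.Sec U') : c.value hx hU (O.res h f) = c.value hx (h hU) f := by
  rw [c.value_eq ((covers_image U).mono h le_rfl) hx (h hU) (c.e_mem_image hx hU), ← c.rep_res (covers_image U) h]
  rfl

/-- A section with non-zero value at a point is invertible near the point. -/
theorem exists_isUnit {U : Opens X} {x : X} (hx : x ∈ c.dom) (hU : x ∈ U) (f : O.Sec U)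
    (hf : c.value hx hU f ≠ 0) : ∃ U₁ : Opens X, ∃ h : U₁ ≤ U, x ∈ U₁ ∧ IsUnit (O.res h f) := by
  set a := c.rep (covers_image U) f with ha
  have hopen : IsOpen {z : c.image U | Model.body a z ≠ 0} :=
    isOpen_ne_fun (Model.body a).contMDiff.continuous continuous_const
  let V : Opens (ι → ℝ) := ⟨Subtype.val '' {z : c.image U | Model.body a z ≠ 0},
    (c.image U).2.isOpenMap_subtype_val _ hopen⟩
  have hV : V ≤ c.image U := by
    rintro _ ⟨z, -, rfl⟩
    exact z.2
  have hc : c.Covers U V := (covers_image U).mono le_rfl hV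
  refine ⟨c.pre V, hc.pre_le, ⟨hx, ⟨c.e x, c.e_mem_image hx hU⟩, hf, rfl⟩, ?_⟩
  rw [← c.iso_rep hc, ← c.res_rep (covers_image U) hV]
  refine IsUnit.map _ (Model.isUnit_of_body_ne_zero fun z => ?_)
  rw [Model.body_res]
  obtain ⟨_, w, hw, rfl⟩ := z
  exact hw

/-- The value of a section at a point does not depend on the chart. -/
theorem value_eq_value (c' : Chart O ι κ) {U : Opens X} {x : X} (hx : x ∈ c.dom)
    (hx' : x ∈ c'.dom) (hU : x ∈ U) (f : O.Sec U) : c.value hx hU f = c'.value hx' hU f := by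
  by_contra hne
  -- The value of f at x has an intrinsic meaning: it is the real number r for which f − r is not
  -- invertible near x. If the two charts disagreed, subtracting the second value would give a unit
  -- near x whose value in the second chart is 0.
  obtain ⟨U₁, h, hxU, hunit⟩ := c.exists_isUnit hx hU
    (f - algebraMap ℝ _ (c'.value hx' hU f)) (by
      rw [map_sub, AlgHom.commutes]
      exact sub_ne_zero.2 hne)
  have := hunit.map (c'.value hx' hxU)
  rw [value_res, map_sub, AlgHom.commutes] at this
  simp at this

end Chart

namespace Supermanifold

variable {M : Supermanifold.{u} ι κ}

/-- The value of a section at a point. -/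
def val {U : Opens M.X} {x : M.X} (hx : x ∈ U) : M.O.Sec U →ₐ[ℝ] ℝ :=
  (M.exists_chart x).choose.value (M.exists_chart x).choose_spec hx

theorem val_eq_value (c : Chart M.O ι κ) {U : Opens M.X} {x : M.X} (hx : x ∈ c.dom) (hU : x ∈ U)
    (f : M.O.Sec U) : val hU f = c.value hx hU f :=
  Chart.value_eq_value _ _ _ _ _ _

theorem val_eq (c : Chart M.O ι κ) {U : Opens M.X} {V : Opens (ι → ℝ)} (h : c.Covers U V)
    {x : M.X} (hx : x ∈ c.dom) (hU : x ∈ U) (hV : c.e x ∈ V) (f : M.O.Sec U) :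
    val hU f = Model.body (c.rep h f) ⟨c.e x, hV⟩ := by
  rw [val_eq_value c hx, c.value_eq]

@[simp]
theorem val_res {U U' : Opens M.X} (h : U ≤ U') {x : M.X} (hU : x ∈ U) (f : M.O.Sec U') :
    val hU (M.O.res h f) = val (h hU) f := Chart.value_res _ _ _ _ _

theorem exists_isUnit {U : Opens M.X} {x : M.X} (hU : x ∈ U) (f : M.O.Sec U)
    (hf : val hU f ≠ 0) : ∃ U₁ : Opens M.X, ∃ h : U₁ ≤ U, x ∈ U₁ ∧ IsUnit (M.O.res h f) :=
  Chart.exists_isUnit _ _ _ _ hf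

@[simp]
theorem val_even (c : Chart M.O ι κ) {x : M.X} (hx : x ∈ c.dom) (μ : ι) :
    val hx (c.even μ) = c.e x μ := by
  rw [val_eq c (Chart.covers_image _) hx hx (c.e_mem_image hx hx), c.rep_even, Model.body_even]

theorem body_rep (c : Chart M.O ι κ) {U : Opens M.X} {V : Opens (ι → ℝ)} (h : c.Covers U V)
    (f : M.O.Sec U) (z : V) : Model.body (c.rep h f) z = val (h z z.2).2 f := by
  have hz : c.e (c.e.symm z) = z := c.e.right_inv (h z z.2).1
  rw [val_eq c h (c.e.map_target (h z z.2).1) _ (by rw [hz]; exact z.2)]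
  congr
  exact Subtype.ext hz.symm

theorem continuous_val (c : Chart M.O ι κ) {U : Opens M.X} (hU : U ≤ c.dom) (f : M.O.Sec U) :
    Continuous fun x : U => val x.2 f := by
  have h : ∀ x : U, val x.2 f = Model.body (c.rep (Chart.covers_image U) f)
      ⟨c.e x, c.e_mem_image (hU x.2) x.2⟩ := fun x => val_eq c _ (hU x.2) _ _ f
  simp only [h]
  refine (Model.body (c.rep (Chart.covers_image U) f)).contMDiff.continuous.comp
    (Continuous.subtype_mk ?_ _)
  exact c.e.continuousOn.comp_continuous continuous_subtype_val fun x => hU x.2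

/-- A linear map of sections that annihilates the constants and is linear over the coordinates of
a chart vanishes. -/
theorem eq_zero_of_chart {Y : Type u} [TopologicalSpace Y] {O : SuperSheaf Y} (C : Chart O ι' κ')
    {U : Opens Y} (hU : U ≤ C.dom) {U' : Opens M.X} (Δ : O.Sec U →ₗ[ℝ] M.O.Sec U')
    (y : ι' → M.O.Sec U') (s : κ' → M.O.Sec U') (h1 : Δ 1 = 0)
    (he : ∀ μ g, Δ (O.res hU (C.even μ) * g) = y μ * Δ g)
    (ho : ∀ j g, Δ (O.res hU (C.odd j) * g) = s j * Δ g)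
    (hb : ∀ x (hx : x ∈ U'), ∃ p ∈ U, ∀ μ, val hx (y μ) = C.e p μ) : Δ = 0 := by
  refine LinearMap.ext fun g => M.O.eq_of_locally fun x hx => ?_
  obtain ⟨c, hc⟩ := M.exists_chart x
  have hU₁ : U' ⊓ c.dom ≤ U' := inf_le_left
  refine ⟨U' ⊓ c.dom, hU₁, ⟨hx, hc⟩, c.rep_injective inf_le_right ?_⟩
  let R : M.O.Sec U' →ₐ[ℝ] Model ι κ (c.image (U' ⊓ c.dom)) :=
    (c.rep (Chart.covers_image _)).comp (M.O.res hU₁)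
  have hUC : ∀ p ∈ U, p ∈ C.dom ∧ C.e p ∈ C.image U := fun p hp =>
    ⟨hU hp, C.e_mem_image (hU hp) hp⟩
  -- Read in the charts C and c, Δ becomes a map between superdomains. Only the target had to be
  -- shrunk to a chart domain, since U already lies in that of C.
  have hzero := Model.eq_zero_of_coord (R.toLinearMap ∘ₗ Δ ∘ₗ (C.sec hUC).toLinearMap)
    (fun μ => R (y μ)) (fun j => R (s j)) (by simp [h1])
    (fun μ g => by simp [C.sec_even, he]) (fun j g => by simp [C.sec_odd, ho]) fun z => by
      obtain ⟨p, hp, hpy⟩ := hb _ (hU₁ z.2.2)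
      convert (hUC p hp).2 using 1
      ext μ
      change Model.body (c.rep (Chart.covers_image _) (M.O.res hU₁ (y μ))) z = _
      rw [body_rep, val_res, hpy]
  have := LinearMap.congr_fun hzero (C.rep (Chart.covers_image U) g)
  simpa [R, C.sec_rep hUC (Chart.covers_image U) le_rfl, O.res_eq_self] using this

/-- Sections over part of a chart can be mapped by prescribing the images of the coordinates. -/
theorem exists_algHom_of_chart {N : Supermanifold.{u} ι' κ'} (C : Chart N.O ι' κ')
    {U : Opens N.X} (hU : U ≤ C.dom) (c : Chart M.O ι κ) {U' : Opens M.X} (hU' : U' ≤ c.dom)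
    (y : ι' → M.O.Sec U') (η : κ' → M.O.Sec U') (hy : ∀ μ, y μ ∈ M.O.par U' 0)
    (hη : ∀ j, η j ∈ M.O.par U' 1)
    (hb : ∀ x (hx : x ∈ U'), ∃ p ∈ U, ∀ μ, val hx (y μ) = C.e p μ) :
    ∃ φ : N.O.Sec U →ₐ[ℝ] M.O.Sec U', (∀ μ, φ (N.O.res hU (C.even μ)) = y μ) ∧
      (∀ j, φ (N.O.res hU (C.odd j)) = η j) ∧
      (∀ i f, f ∈ N.O.par U i → φ f ∈ M.O.par U' i) ∧
      ∀ x (hx : x ∈ U') p (hp : p ∈ U), (∀ μ, val hx (y μ) = C.e p μ) →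
        ∀ f, val hx (φ f) = val hp f := by
  let R : M.O.Sec U' →ₐ[ℝ] Model ι κ (c.image U') := c.rep (Chart.covers_image _)
  have hUC : ∀ p ∈ U, p ∈ C.dom ∧ C.e p ∈ C.image U := fun p hp =>
    ⟨hU hp, C.e_mem_image (hU hp) hp⟩
  have hUc : ∀ p ∈ U', p ∈ c.dom ∧ c.e p ∈ c.image U' := fun p hp =>
    ⟨hU' hp, c.e_mem_image (hU' hp) hp⟩
  have hRy : ∀ μ, Model.inv (R (y μ)) = R (y μ) := fun μ =>
    Model.mem_par_zero.1 (c.rep_mem_par _ (hy μ))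
  have hRη : ∀ j, Model.inv (R (η j)) = -R (η j) := fun j =>
    Model.mem_par_one.1 (c.rep_mem_par _ (hη j))
  have hRb : ∀ z, (fun μ => Model.body (R (y μ)) z) ∈ C.image U := fun z => by
    obtain ⟨p, hp, hpy⟩ := hb _ z.2.2
    convert (hUC p hp).2 using 1
    ext μ
    change Model.body (c.rep (Chart.covers_image _) (y μ)) z = _
    rw [body_rep, hpy]
  let ψ := Model.subst (fun μ => R (y μ)) (fun j => R (η j)) hRy hRη hRb
  have hψe : ∀ μ, ψ (Model.even _ μ) = R (y μ) := Model.subst_even _ _ hRy hRη hRb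
  have hψo : ∀ j, ψ (Model.odd _ j) = R (η j) := Model.subst_odd _ _ hRy hRη hRb
  have hψb : ∀ z, (fun μ => Model.body (ψ (Model.even _ μ)) z) ∈ C.image U := by
    simpa only [hψe] using hRb
  have hψo' : ∀ j, Model.inv (ψ (Model.odd _ j)) = -ψ (Model.odd _ j) := by
    simpa only [hψo] using hRη
  have hsR : ∀ f, c.sec hUc (R f) = f := fun f => by
    rw [c.sec_rep hUc (Chart.covers_image U') le_rfl, M.O.res_eq_self]
  refine ⟨((c.sec hUc).comp ψ).comp (C.rep (Chart.covers_image U)), fun μ => ?_, fun j => ?_,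
    fun i f hf => ?_, fun x hx p hp hpy f => ?_⟩
  · simp only [AlgHom.comp_apply]
    rw [C.rep_res, C.rep_even, hψe, hsR]
  · simp only [AlgHom.comp_apply]
    rw [C.rep_res, C.rep_odd, hψo, hsR]
  · simp only [AlgHom.comp_apply]
    refine c.sec_mem_par hUc ?_
    have hf' := Model.mem_par_iff.1 (C.rep_mem_par (Chart.covers_image U) hf)
    rw [Model.mem_par_iff, ← Model.inv_map (by simpa only [hψe] using hRy) hψo' hψb, hf', map_smul]
  · simp only [AlgHom.comp_apply]
    rw [val_eq c (Chart.covers_image U') (hU' hx) hx (hUc x hx).2, c.rep_sec hUc,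
      Model.res_self, Model.body_map hψo' hψb,
      val_eq C (Chart.covers_image U) (hU hp) hp (hUC p hp).2]
    congr 1
    ext μ
    change Model.body (ψ (Model.even _ μ)) _ = C.e p μ
    rw [hψe, ← hpy, val_eq c (Chart.covers_image U') (hU' hx) hx (hUc x hx).2]

end Supermanifold

open Supermanifold

namespace Hom

variable {M : Supermanifold.{u} ι κ} {N : Supermanifold.{u} ι' κ'}

theorem comap_le (ψ : Hom M N) {V W : Opens N.X} (h : V ≤ W) :
    Opens.comap ψ.base V ≤ Opens.comap ψ.base W := fun _ hx => h hx

theorem pull_res' (ψ : Hom M N) {V W : Opens N.X} (h : V ≤ W) (f : N.O.Sec W) :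
    ψ.pull V (N.O.res h f) = M.O.res (ψ.comap_le h) (ψ.pull W f) := ψ.pull_res h f

/-- Pull-backs have the expected values. -/
theorem val_pull (ψ : Hom M N) {V : Opens N.X} {x : M.X} (hx : x ∈ Opens.comap ψ.base V)
    (hx' : ψ.base x ∈ V) (f : N.O.Sec V) : val hx (ψ.pull V f) = val hx' f := by
  by_contra hne
  set r := val hx (ψ.pull V f) with hr
  -- If the values differed, f − r would be a unit near the image point, so its pull-back would be a
  -- unit near x; but this has value r − r = 0. In this way locality on stalks is automatic.
  obtain ⟨V₁, h, hxV, hunit⟩ := exists_isUnit hx' (f - algebraMap ℝ _ r) (by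
    rw [map_sub, AlgHom.commutes]
    exact sub_ne_zero.2 (Ne.symm hne))
  have hxV' : x ∈ Opens.comap ψ.base V₁ := hxV
  have := hunit.map ((val hxV').comp (ψ.pull V₁))
  rw [AlgHom.comp_apply, ψ.pull_res' h, val_res, map_sub, AlgHom.commutes, map_sub,
    AlgHom.commutes, ← hr] at this
  simp at this

end Hom


variable {ι κ ι' κ' : Type} [Fintype ι] [Fintype κ] [Fintype ι'] [Fintype κ']

open Supermanifold

/-! ### Squares of odd vector fields and parities of coordinates -/

namespace OddVectorField

variable {M : Supermanifold.{u} ι κ} (Q : OddVectorField M)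

theorem map_one (U : Opens M.X) : Q.map U 1 = 0 := by
  have := Q.leibniz U 0 1 1 (SetLike.GradedOne.one_mem)
  simpa using this

/-- The square of an odd derivation is an even derivation: the two terms containing both Q f and Q g
have opposite signs. -/
theorem map_map_mul {U : Opens M.X} {i : ZMod 2} {f : M.O.Sec U} (hf : f ∈ M.O.par U i)
    (h : Q.map U (Q.map U f) = 0) (g : M.O.Sec U) :
    Q.map U (Q.map U (f * g)) = f * Q.map U (Q.map U g) := by
  rw [Q.leibniz U i f g hf, map_add, map_smul, Q.leibniz U (i + 1) _ g (Q.map_par U i f hf),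
    Q.leibniz U i f _ hf, h]
  rcases zmod_two_cases i with rfl | rfl
  · simp [ZMod.val_one]
  · simp [ZMod.val_one, show (1 + 1 : ZMod 2) = 0 from rfl]

end OddVectorField

namespace Chart

variable {X : Type u} [TopologicalSpace X] {O : SuperSheaf X} (c : Chart O ι κ)

/-- The parity of a coordinate. -/
def parity : ι ⊕ κ → ZMod 2 := Sum.elim (fun _ => 0) (fun _ => 1)

theorem coord_mem_par (b : ι ⊕ κ) : c.coord b ∈ O.par c.dom (parity b) := by
  rcases b with μ | j
  · exact c.even_mem_par μ
  · exact c.odd_mem_par j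

end Chart

/-! ### Gluing of morphisms -/

/-- Once the map of spaces is fixed, the pull-back of each section is glued separately. Uniqueness
of gluing then gives the algebra laws and compatibility with restriction, and parity is checked
locally. -/
theorem exists_pull_glue {M : Supermanifold.{u} ι κ} {N : Supermanifold.{u} ι' κ'} {I : Type u}
    (b : C(M.X, N.X)) (U : I → Opens M.X) (hU : ∀ x, ∃ i, x ∈ U i)
    (α : ∀ i V, N.O.Sec V →ₐ[ℝ] M.O.Sec (U i ⊓ Opens.comap b V))
    (hpar : ∀ i V k f, f ∈ N.O.par V k → α i V f ∈ M.O.par _ k)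
    (hres : ∀ i V W (h : V ≤ W) (h' : U i ⊓ Opens.comap b V ≤ U i ⊓ Opens.comap b W) f,
      α i V (N.O.res h f) = M.O.res h' (α i W f))
    (hcompat : ∀ i j V f,
      M.O.res (inf_le_left : (U i ⊓ Opens.comap b V) ⊓ (U j ⊓ Opens.comap b V) ≤ _) (α i V f) =
        M.O.res inf_le_right (α j V f)) :
    ∃ a : Hom M N, a.base = b ∧ ∀ i V f (hle : U i ⊓ Opens.comap b V ≤ Opens.comap a.base V),
      M.O.res hle (a.pull V f) = α i V f := by
  have hcov : ∀ V : Opens N.X, ∀ x ∈ Opens.comap b V, ∃ i, x ∈ U i ⊓ Opens.comap b V :=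
    fun V x hx => (hU x).imp fun i hi => ⟨hi, hx⟩
  have hle : ∀ i (V : Opens N.X), U i ⊓ Opens.comap b V ≤ Opens.comap b V := fun i V => inf_le_right
  have hex : ∀ V (f : N.O.Sec V), ∃ g : M.O.Sec (Opens.comap b V),
      ∀ i, M.O.res (hle i V) g = α i V f := fun V f =>
    M.O.exists_glue _ _ (fun i => hle i V) (hcov V) (fun i => α i V f) fun i j => hcompat i j V f
  choose p hp using hex
  have hext : ∀ V (g g' : M.O.Sec (Opens.comap b V)),
      (∀ i, M.O.res (hle i V) g = M.O.res (hle i V) g') → g = g' := fun V g g' h =>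
    M.O.eq_of_cover _ _ (fun i => hle i V) (hcov V) h
  let P : ∀ V, N.O.Sec V →ₐ[ℝ] M.O.Sec (Opens.comap b V) := fun V =>
    { toFun := p V
      map_one' := hext V _ _ fun i => by rw [hp, _root_.map_one, _root_.map_one]
      map_mul' := fun f g => hext V _ _ fun i => by simp only [hp, map_mul]
      map_zero' := hext V _ _ fun i => by rw [hp, map_zero, map_zero]
      map_add' := fun f g => hext V _ _ fun i => by simp only [hp, map_add]
      commutes' := fun r => hext V _ _ fun i => by simp only [hp, AlgHom.commutes] }
  refine ⟨⟨b, P, fun V k f hf => ?_, fun {V W} h f => ?_⟩, rfl, fun i V f hle' => hp V f i⟩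
  · refine M.O.mem_par_of_locally fun x hx => ?_
    obtain ⟨i, hi⟩ := hcov V x hx
    refine ⟨_, hle i V, hi, ?_⟩
    change M.O.res (hle i V) (p V f) ∈ _
    rw [hp]
    exact hpar i V k f hf
  · have hm : Opens.comap b V ≤ Opens.comap b W := fun x hx => h hx
    change p V (N.O.res h f) = M.O.res hm (p W f)
    refine hext V _ _ fun i => ?_
    have h' : U i ⊓ Opens.comap b V ≤ U i ⊓ Opens.comap b W := inf_le_inf_left _ hm
    rw [hp, M.O.res_res, hres i V W h h', ← hp, M.O.res_res]

/-! ### The antitangent bundle in coordinates -/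

namespace AntitangentBundle

variable {M : Supermanifold.{u} ι κ} (T : AntitangentBundle M)

/-- The chart of the antitangent bundle over a chart of the base. -/
def chart (c : Chart M.O ι κ) : Chart T.total.O (ι ⊕ κ) (κ ⊕ ι) := (T.exists_chart c).choose

theorem chart_dom (c : Chart M.O ι κ) : (T.chart c).dom = Opens.comap T.proj.base c.dom :=
  (T.exists_chart c).choose_spec.choose

theorem mem_chart_dom {c : Chart M.O ι κ} {p : T.total.X} :
    p ∈ (T.chart c).dom ↔ T.proj.base p ∈ c.dom := by
  rw [chart_dom]; rfl

theorem chart_target (c : Chart M.O ι κ) :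
    (T.chart c).e.target = {z | (fun μ => z (Sum.inl μ)) ∈ c.e.target} :=
  (T.exists_chart c).choose_spec.choose_spec.1

theorem chart_even_inl (c : Chart M.O ι κ) (μ : ι) : (T.chart c).even (Sum.inl μ) =
    T.total.O.res (T.chart_dom c).le (T.proj.pull c.dom (c.coord (Sum.inl μ))) :=
  (T.exists_chart c).choose_spec.choose_spec.2.1 μ

theorem chart_odd_inl (c : Chart M.O ι κ) (j : κ) : (T.chart c).odd (Sum.inl j) =
    T.total.O.res (T.chart_dom c).le (T.proj.pull c.dom (c.coord (Sum.inr j))) :=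
  (T.exists_chart c).choose_spec.choose_spec.2.2.1 j

theorem chart_even_inr (c : Chart M.O ι κ) (j : κ) : (T.chart c).even (Sum.inr j) =
    T.total.O.res (T.chart_dom c).le (T.d.map _ (T.proj.pull c.dom (c.coord (Sum.inr j)))) :=
  (T.exists_chart c).choose_spec.choose_spec.2.2.2.1 j

theorem chart_odd_inr (c : Chart M.O ι κ) (μ : ι) : (T.chart c).odd (Sum.inr μ) =
    T.total.O.res (T.chart_dom c).le (T.d.map _ (T.proj.pull c.dom (c.coord (Sum.inl μ)))) :=
  (T.exists_chart c).choose_spec.choose_spec.2.2.2.2 μ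

theorem pull_coord_mem_par (c : Chart M.O ι κ) (b : ι ⊕ κ) :
    T.proj.pull c.dom (c.coord b) ∈ T.total.O.par _ (Chart.parity b) :=
  T.proj.pull_par _ _ _ (c.coord_mem_par b)

/-- A linear map of sections that annihilates the constants and is linear over the coordinates
`x^a, dx^a` vanishes. -/
theorem eq_zero_of_coord {N : Supermanifold.{u} ι' κ'} (c : Chart M.O ι κ) {V : Opens T.total.X}
    (hV : V ≤ Opens.comap T.proj.base c.dom) {U : Opens N.X}
    (Δ : T.total.O.Sec V →ₗ[ℝ] N.O.Sec U) (s s' : ι ⊕ κ → N.O.Sec U) (h1 : Δ 1 = 0)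
    (hs : ∀ b g, Δ (T.total.O.res hV (T.proj.pull c.dom (c.coord b)) * g) = s b * Δ g)
    (hs' : ∀ b g,
      Δ (T.total.O.res hV (T.d.map _ (T.proj.pull c.dom (c.coord b))) * g) = s' b * Δ g)
    (hb : ∀ x (hx : x ∈ U), ∃ p, ∃ hp : p ∈ V,
      (∀ μ, val hx (s (Sum.inl μ)) = val (hV hp) (T.proj.pull c.dom (c.coord (Sum.inl μ)))) ∧
      ∀ j, val hx (s' (Sum.inr j)) =
        val (hV hp) (T.d.map _ (T.proj.pull c.dom (c.coord (Sum.inr j))))) : Δ = 0 := by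
  have hV' : V ≤ (T.chart c).dom := hV.trans (T.chart_dom c).ge
  -- The even coordinates of ΠTM are x^μ and dξ^j, the odd ones ξ^j and dx^μ, hence the crosswise
  -- regrouping; only the even ones are subject to a condition on values.
  refine eq_zero_of_chart (T.chart c) hV' Δ
    (Sum.elim (fun μ => s (Sum.inl μ)) fun j => s' (Sum.inr j))
    (Sum.elim (fun j => s (Sum.inr j)) fun μ => s' (Sum.inl μ)) h1 ?_ ?_ fun x hx => ?_
  · rintro (μ | j) g
    · rw [chart_even_inl, T.total.O.res_res]; exact hs _ g
    · rw [chart_even_inr, T.total.O.res_res]; exact hs' _ g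
  · rintro (j | μ) g
    · rw [chart_odd_inl, T.total.O.res_res]; exact hs _ g
    · rw [chart_odd_inr, T.total.O.res_res]; exact hs' _ g
  · obtain ⟨p, hp, he, ho⟩ := hb x hx
    refine ⟨p, hp, ?_⟩
    rintro (μ | j)
    · rw [← val_even _ (hV' hp), chart_even_inl, val_res]; exact he μ
    · rw [← val_even _ (hV' hp), chart_even_inr, val_res]; exact ho j

/-- The de Rham differential is homological. -/
theorem d_isHomological : T.d.IsHomological := by
  intro V f
  refine T.total.O.eq_of_locally fun z hz => ?_
  obtain ⟨c, hc⟩ := M.exists_chart (T.proj.base z)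
  have hU : V ⊓ Opens.comap T.proj.base c.dom ≤ V := inf_le_left
  have hU' : V ⊓ Opens.comap T.proj.base c.dom ≤ Opens.comap T.proj.base c.dom := inf_le_right
  refine ⟨_, hU, ⟨hz, hc⟩, ?_⟩
  -- d² kills x^a by `d_d`, and it kills dx^a because d²(dx^a) = d(d(dx^a)) = d(0).
  have := T.eq_zero_of_coord c hU' (T.d.map _ ∘ₗ T.d.map _)
    (fun b => T.total.O.res hU' (T.proj.pull c.dom (c.coord b)))
    (fun b => T.total.O.res hU' (T.d.map _ (T.proj.pull c.dom (c.coord b))))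
    (by rw [LinearMap.comp_apply, T.d.map_one, map_zero])
    (fun b g => T.d.map_map_mul (T.total.O.res_par hU' _ _ (T.pull_coord_mem_par c b))
      (by rw [T.d.map_res, T.d.map_res, T.d_d, map_zero]) g)
    (fun b g => T.d.map_map_mul
      (T.total.O.res_par hU' _ _ (T.d.map_par _ _ _ (T.pull_coord_mem_par c b)))
      (by rw [T.d.map_res, T.d.map_res, T.d_d, map_zero, map_zero]) g)
    (fun x hx => ⟨x, hx, fun μ => by rw [val_res], fun j => by rw [val_res]⟩)
  have h := LinearMap.congr_fun this (T.total.O.res hU f)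
  rw [LinearMap.comp_apply, T.d.map_res, T.d.map_res] at h
  rw [h, map_zero, LinearMap.zero_apply]

end AntitangentBundle


variable {ι κ : Type} [Fintype ι] [Fintype κ]

open Supermanifold

/-! ### The odd anchor over a single chart and its independence of the chart -/

namespace AntitangentBundle

variable {M : Supermanifold.{u} ι κ} (T : AntitangentBundle M) (Q : OddVectorField M)

/-- The point of the antitangent bundle over `x` which is the value of the vector field at `x`. -/
def IsAnchorPoint (x : M.X) (p : T.total.X) : Prop :=
  T.proj.base p = x ∧ ∀ (U : Opens M.X) (hx : x ∈ U) (hp : p ∈ Opens.comap T.proj.base U)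
    (h : M.O.Sec U), val hp (T.d.map _ (T.proj.pull U h)) = val hx (Q.map U h)

/-- A homomorphism of sections is given by the odd anchor in the coordinates of a chart. -/
structure HasCoords (c : Chart M.O ι κ) {V : Opens T.total.X} {U : Opens M.X}
    (hV : V ≤ Opens.comap T.proj.base c.dom) (hU : U ≤ c.dom)
    (α : T.total.O.Sec V →ₐ[ℝ] M.O.Sec U) : Prop where
  coord : ∀ b, α (T.total.O.res hV (T.proj.pull c.dom (c.coord b))) = M.O.res hU (c.coord b)
  d_coord : ∀ b, α (T.total.O.res hV (T.d.map _ (T.proj.pull c.dom (c.coord b)))) =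
    M.O.res hU (Q.map _ (c.coord b))

/-- The points of `V` over the points of `U` have the values of the vector field as
coordinates. -/
def HasPoints (c : Chart M.O ι κ) (V : Opens T.total.X) (U : Opens M.X)
    (hV : V ≤ Opens.comap T.proj.base c.dom) (hU : U ≤ c.dom) : Prop :=
  ∀ x (hx : x ∈ U), ∃ p, ∃ hp : p ∈ V, T.proj.base p = x ∧
    ∀ j, val (hV hp) (T.d.map _ (T.proj.pull c.dom (c.coord (Sum.inr j)))) =
      val (hU hx) (Q.map _ (c.coord (Sum.inr j)))

variable {T Q} {c : Chart M.O ι κ} {V : Opens T.total.X} {U : Opens M.X}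
  {hV : V ≤ Opens.comap T.proj.base c.dom} {hU : U ≤ c.dom}

theorem val_pull_of_base_eq {W : Opens M.X} {p : T.total.X} {x : M.X}
    (hp : p ∈ Opens.comap T.proj.base W) (hx : x ∈ W) (h : T.proj.base p = x) (f : M.O.Sec W) :
    val hp (T.proj.pull W f) = val hx f := by
  subst h
  exact T.proj.val_pull hp hx f

/-- The values condition in the form used for uniqueness statements. -/
theorem HasPoints.values (h : T.HasPoints Q c V U hV hU) (x : M.X) (hx : x ∈ U) :
    ∃ p, ∃ hp : p ∈ V,
      (∀ μ, val hx (M.O.res hU (c.coord (Sum.inl μ))) =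
        val (hV hp) (T.proj.pull c.dom (c.coord (Sum.inl μ)))) ∧
      ∀ j, val hx (M.O.res hU (Q.map _ (c.coord (Sum.inr j)))) =
        val (hV hp) (T.d.map _ (T.proj.pull c.dom (c.coord (Sum.inr j)))) := by
  obtain ⟨p, hp, hpx, hd⟩ := h x hx
  refine ⟨p, hp, fun μ => ?_, fun j => ?_⟩
  · rw [val_res, val_pull_of_base_eq (hV hp) (hU hx) hpx]
  · rw [val_res, hd]

theorem HasCoords.unique {α β : T.total.O.Sec V →ₐ[ℝ] M.O.Sec U} (hα : T.HasCoords Q c hV hU α)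
    (hβ : T.HasCoords Q c hV hU β) (hp : T.HasPoints Q c V U hV hU) : α = β := by
  have := T.eq_zero_of_coord c hV (α.toLinearMap - β.toLinearMap)
    (fun b => M.O.res hU (c.coord b)) (fun b => M.O.res hU (Q.map _ (c.coord b)))
    (by simp)
    (fun b g => by simp [hα.coord, hβ.coord, mul_sub])
    (fun b g => by simp [hα.d_coord, hβ.d_coord, mul_sub]) hp.values
  exact AlgHom.ext fun f => sub_eq_zero.1 (LinearMap.congr_fun this f)

/-- The odd anchor intertwines the vector field with the de Rham differential. -/
theorem HasCoords.map_d {α : T.total.O.Sec V →ₐ[ℝ] M.O.Sec U} (hα : T.HasCoords Q c hV hU α)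
    (hpar : ∀ i f, f ∈ T.total.O.par V i → α f ∈ M.O.par U i)
    (hp : T.HasPoints Q c V U hV hU) (hQ : Q.IsHomological) (f : T.total.O.Sec V) :
    Q.map U (α f) = α (T.d.map V f) := by
  -- The defect E = Q∘α − α∘d satisfies E(x g) = ± α(x) E(g) as soon as E x = 0, since both terms
  -- obey the same twisted Leibniz rule along α.
  have key : ∀ (i : ZMod 2) (x g : T.total.O.Sec V), x ∈ T.total.O.par V i →
      Q.map U (α x) = α (T.d.map V x) → Q.map U (α (x * g)) - α (T.d.map V (x * g)) =
        (-1 : ℝ) ^ i.val • α x * (Q.map U (α g) - α (T.d.map V g)) := fun i x g hx h => by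
    rw [map_mul, Q.leibniz U i _ _ (hpar i x hx), T.d.leibniz V i _ _ hx, h, map_add, map_mul,
      map_smul, map_mul, smul_mul_assoc, mul_sub, smul_sub]
    abel
  have := T.eq_zero_of_coord c hV (Q.map U ∘ₗ α.toLinearMap - α.toLinearMap ∘ₗ T.d.map V)
    (fun b => (-1 : ℝ) ^ (Chart.parity b).val • M.O.res hU (c.coord b))
    (fun b => (-1 : ℝ) ^ (Chart.parity b + 1).val • M.O.res hU (Q.map _ (c.coord b)))
    (by simp [OddVectorField.map_one])
    (fun b g => by
      have := key _ _ g (T.total.O.res_par hV _ _ (T.pull_coord_mem_par c b))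
        (by rw [T.d.map_res, hα.d_coord, hα.coord, Q.map_res])
      simpa [hα.coord] using this)
    (fun b g => by
      have := key _ _ g (T.total.O.res_par hV _ _ (T.d.map_par _ _ _ (T.pull_coord_mem_par c b)))
        -- The only use of Q² = 0: Q(α(dx^b)) = Q(Q(x^b)) has to match α(d(dx^b)) = 0.
        (by rw [T.d.map_res, T.d_d, hα.d_coord, Q.map_res, hQ, map_zero, map_zero, map_zero])
      simpa [hα.d_coord] using this)
    (fun x hx => by
      obtain ⟨p, hpV, h1, h2⟩ := hp.values x hx
      refine ⟨p, hpV, fun μ => ?_, fun j => ?_⟩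
      · rw [map_smul, h1]
        simp [Chart.parity]
      · rw [map_smul, h2]
        simp [Chart.parity, show (1 + 1 : ZMod 2) = 0 from rfl])
  exact sub_eq_zero.1 (LinearMap.congr_fun this f)

/-- Both sides are homomorphisms on functions of M with the same values on the coordinates of c.
Passing to W ⊓ c.dom is needed because W may leave the chart. -/
theorem HasCoords.map_pull {α : T.total.O.Sec V →ₐ[ℝ] M.O.Sec U} (hα : T.HasCoords Q c hV hU α)
    {W : Opens M.X} (hUW : U ≤ W) (hVW : V ≤ Opens.comap T.proj.base W) (h : M.O.Sec W) :
    α (T.total.O.res hVW (T.proj.pull W h)) = M.O.res hUW h := by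
  have hle : W ⊓ c.dom ≤ c.dom := inf_le_right
  have hleW : W ⊓ c.dom ≤ W := inf_le_left
  have hUW' : U ≤ W ⊓ c.dom := le_inf hUW hU
  have hVW' : V ≤ Opens.comap T.proj.base (W ⊓ c.dom) := fun p hp => ⟨hVW hp, hV hp⟩
  let β : M.O.Sec (W ⊓ c.dom) →ₐ[ℝ] M.O.Sec U :=
    α.comp ((T.total.O.res hVW').comp (T.proj.pull (W ⊓ c.dom)))
  have hβ : ∀ b, β (M.O.res hle (c.coord b)) = M.O.res hU (c.coord b) := fun b => by
    simp only [β, AlgHom.comp_apply]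
    rw [T.proj.pull_res' hle, T.total.O.res_res, hα.coord]
  have := eq_zero_of_chart c hle (β.toLinearMap - (M.O.res hUW').toLinearMap)
    (fun μ => M.O.res hU (c.even μ)) (fun j => M.O.res hU (c.odd j)) (by simp)
    (fun μ g => by
      have := hβ (Sum.inl μ)
      simp only [Chart.coord, Sum.elim_inl] at this
      simp [this, M.O.res_res, mul_sub])
    (fun j g => by
      have := hβ (Sum.inr j)
      simp only [Chart.coord, Sum.elim_inr] at this
      simp [this, M.O.res_res, mul_sub])
    (fun x hx => ⟨x, hUW' hx, fun μ => by rw [val_res, val_even]⟩)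
  have h2 := sub_eq_zero.1 (LinearMap.congr_fun this (M.O.res hleW h))
  simp only [AlgHom.toLinearMap_apply, β, AlgHom.comp_apply, M.O.res_res,
    T.proj.pull_res' hleW, T.total.O.res_res] at h2
  exact h2

/-- The chain rule without partial derivatives: α∘d∘π^* and the restriction of Q are odd derivations
along the same homomorphism, equal on the coordinates of c. Applied to the coordinates of another
chart, it shows that the anchor is independent of the chart. -/
theorem HasCoords.map_d_pull {α : T.total.O.Sec V →ₐ[ℝ] M.O.Sec U}
    (hα : T.HasCoords Q c hV hU α) {W : Opens M.X} (hUW : U ≤ W)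
    (hVW : V ≤ Opens.comap T.proj.base W) (h : M.O.Sec W) :
    α (T.total.O.res hVW (T.d.map _ (T.proj.pull W h))) = M.O.res hUW (Q.map W h) := by
  have hle : W ⊓ c.dom ≤ c.dom := inf_le_right
  have hleW : W ⊓ c.dom ≤ W := inf_le_left
  have hUW' : U ≤ W ⊓ c.dom := le_inf hUW hU
  have hVW' : V ≤ Opens.comap T.proj.base (W ⊓ c.dom) := fun p hp => ⟨hVW hp, hV hp⟩
  let β : M.O.Sec (W ⊓ c.dom) →ₐ[ℝ] M.O.Sec U :=
    α.comp ((T.total.O.res hVW').comp (T.proj.pull (W ⊓ c.dom)))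
  let δ : M.O.Sec (W ⊓ c.dom) →ₗ[ℝ] M.O.Sec U :=
    α.toLinearMap ∘ₗ (T.total.O.res hVW').toLinearMap ∘ₗ T.d.map _ ∘ₗ
      (T.proj.pull (W ⊓ c.dom)).toLinearMap
  have hβ : ∀ f, β f = M.O.res hUW' f := fun f => hα.map_pull hUW' hVW' f
  have hδ : ∀ b, δ (M.O.res hle (c.coord b)) = M.O.res hUW' (Q.map _ (M.O.res hle (c.coord b))) :=
    fun b => by
      change α (T.total.O.res hVW' (T.d.map _ (T.proj.pull _ (M.O.res hle (c.coord b))))) = _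
      rw [T.proj.pull_res' hle, T.d.map_res, T.total.O.res_res, hα.d_coord, Q.map_res, M.O.res_res]
  have hδmul : ∀ i x g, x ∈ M.O.par _ i →
      δ (x * g) = δ x * M.O.res hUW' g + (-1 : ℝ) ^ i.val • (M.O.res hUW' x * δ g) :=
    fun i x g hx => by
      rw [← hβ, ← hβ]
      change α (T.total.O.res hVW' (T.d.map _ (T.proj.pull _ (x * g)))) = _
      rw [map_mul, T.d.leibniz _ i _ _ (T.proj.pull_par _ _ _ hx), map_add, map_smul, map_mul,
        map_mul, map_add, map_smul, map_mul, map_mul]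
      rfl
  have key : ∀ b g, δ (M.O.res hle (c.coord b) * g) - M.O.res hUW' (Q.map _ (M.O.res hle (c.coord b) * g))
      = (-1 : ℝ) ^ (Chart.parity b).val • M.O.res hU (c.coord b) *
        (δ g - M.O.res hUW' (Q.map _ g)) := fun b g => by
    have hx := M.O.res_par hle _ _ (c.coord_mem_par b)
    rw [hδmul _ _ _ hx, Q.leibniz _ _ _ _ hx, hδ, map_add, map_smul, map_mul, map_mul,
      M.O.res_res, smul_mul_assoc, mul_sub, smul_sub]
    abel
  have := eq_zero_of_chart c hle (δ - (M.O.res hUW').toLinearMap ∘ₗ Q.map _)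
    -- The minus sign is the one by which an odd derivation passes an odd coordinate.
    (fun μ => M.O.res hU (c.even μ)) (fun j => -M.O.res hU (c.odd j))
    (by simp [δ, OddVectorField.map_one])
    (fun μ g => by
      have := key (Sum.inl μ) g
      simpa [Chart.parity, Chart.coord] using this)
    (fun j g => by
      have := key (Sum.inr j) g
      simpa [Chart.parity, Chart.coord, ZMod.val_one] using this)
    (fun x hx => ⟨x, hUW' hx, fun μ => by rw [val_res, val_even]⟩)
  have h2 := sub_eq_zero.1 (LinearMap.congr_fun this (M.O.res hleW h))
  change α (T.total.O.res hVW' (T.d.map _ (T.proj.pull _ (M.O.res hleW h)))) =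
    M.O.res hUW' (Q.map _ (M.O.res hleW h)) at h2
  rwa [T.proj.pull_res' hleW, T.d.map_res, T.total.O.res_res, Q.map_res, M.O.res_res] at h2

/-- The odd anchor exists locally. -/
theorem HasPoints.exists_hasCoords (h : T.HasPoints Q c V U hV hU) :
    ∃ α : T.total.O.Sec V →ₐ[ℝ] M.O.Sec U, T.HasCoords Q c hV hU α ∧
      (∀ i f, f ∈ T.total.O.par V i → α f ∈ M.O.par U i) ∧
      ∀ x (hx : x ∈ U) p (hp : p ∈ V), T.proj.base p = x →
        (∀ j, val (hV hp) (T.d.map _ (T.proj.pull c.dom (c.coord (Sum.inr j)))) =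
          val (hU hx) (Q.map _ (c.coord (Sum.inr j)))) → ∀ f, val hx (α f) = val hp f := by
  have hV' : V ≤ (T.chart c).dom := hV.trans (T.chart_dom c).ge
  have hcoord : ∀ x (hx : x ∈ U) p (hp : p ∈ V), T.proj.base p = x →
        (∀ j, val (hV hp) (T.d.map _ (T.proj.pull c.dom (c.coord (Sum.inr j)))) =
          val (hU hx) (Q.map _ (c.coord (Sum.inr j)))) → ∀ s, val hx (M.O.res hU
            ((Sum.elim (fun μ => c.coord (Sum.inl μ)) fun j => Q.map _ (c.coord (Sum.inr j))) s)) =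
            (T.chart c).e p s := by
    intro x hx p hp hpx hd s
    rw [val_res, ← val_even (T.chart c) (hV' hp)]
    rcases s with μ | j
    · rw [chart_even_inl, val_res, val_pull_of_base_eq (hV hp) (hU hx) hpx]; rfl
    · rw [chart_even_inr, val_res, hd]; rfl
  obtain ⟨α, hαe, hαo, hpar, hval⟩ := exists_algHom_of_chart (T.chart c) hV' c hU
    (fun s => M.O.res hU
      ((Sum.elim (fun μ => c.coord (Sum.inl μ)) fun j => Q.map _ (c.coord (Sum.inr j))) s))
    (fun s => M.O.res hU
      ((Sum.elim (fun j => c.coord (Sum.inr j)) fun μ => Q.map _ (c.coord (Sum.inl μ))) s))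
    (by
      rintro (μ | j)
      · exact M.O.res_par hU _ _ (c.coord_mem_par (Sum.inl μ))
      · exact M.O.res_par hU _ _ (Q.map_par _ 1 _ (c.coord_mem_par (Sum.inr j))))
    (by
      rintro (j | μ)
      · exact M.O.res_par hU _ _ (c.coord_mem_par (Sum.inr j))
      · exact M.O.res_par hU _ _ (Q.map_par _ 0 _ (c.coord_mem_par (Sum.inl μ))))
    (fun x hx => by
      obtain ⟨p, hp, hpx, hd⟩ := h x hx
      exact ⟨p, hp, hcoord x hx p hp hpx hd⟩)
  refine ⟨α, ⟨?_, ?_⟩, hpar, fun x hx p hp hpx hd => hval x hx p hp (hcoord x hx p hp hpx hd)⟩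
  · rintro (μ | j)
    · have := hαe (Sum.inl μ)
      rwa [chart_even_inl, T.total.O.res_res] at this
    · have := hαo (Sum.inl j)
      rwa [chart_odd_inl, T.total.O.res_res] at this
  · rintro (μ | j)
    · have := hαo (Sum.inr μ)
      rwa [chart_odd_inr, T.total.O.res_res] at this
    · have := hαe (Sum.inr j)
      rwa [chart_even_inr, T.total.O.res_res] at this

end AntitangentBundle


variable {ι κ : Type} [Fintype ι] [Fintype κ]

open Supermanifold

namespace AntitangentBundle

variable {M : Supermanifold.{u} ι κ} (T : AntitangentBundle M) (Q : OddVectorField M)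

/-! ### The underlying map of the odd anchor -/

theorem chart_e_inl (c : Chart M.O ι κ) {p : T.total.X} (hp : T.proj.base p ∈ c.dom) (μ : ι) :
    (T.chart c).e p (Sum.inl μ) = c.e (T.proj.base p) μ := by
  rw [← val_even (T.chart c) (T.mem_chart_dom.2 hp), chart_even_inl, val_res,
    val_pull_of_base_eq _ hp rfl]
  exact val_even c hp μ

theorem chart_e_inr (c : Chart M.O ι κ) {p : T.total.X} (hp : p ∈ Opens.comap T.proj.base c.dom)
    (j : κ) : (T.chart c).e p (Sum.inr j) =
      val hp (T.d.map _ (T.proj.pull c.dom (c.coord (Sum.inr j)))) := by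
  rw [← val_even (T.chart c) (T.mem_chart_dom.2 hp), chart_even_inr, val_res]

theorem eq_of_coords (c : Chart M.O ι κ) {p q : T.total.X}
    (hp : p ∈ Opens.comap T.proj.base c.dom) (hq : q ∈ Opens.comap T.proj.base c.dom)
    (h : T.proj.base p = T.proj.base q)
    (hd : ∀ j, val hp (T.d.map _ (T.proj.pull c.dom (c.coord (Sum.inr j)))) =
      val hq (T.d.map _ (T.proj.pull c.dom (c.coord (Sum.inr j))))) : p = q := by
  refine (T.chart c).e.injOn (T.mem_chart_dom.2 hp) (T.mem_chart_dom.2 hq) (funext ?_)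
  rintro (μ | j)
  · rw [T.chart_e_inl c hp, T.chart_e_inl c hq, h]
  · rw [T.chart_e_inr c hp, T.chart_e_inr c hq, hd]

/-- The description of the chart's target enters here: the fibre over x contains every tuple of real
values of the dξ^j, in particular the values of the Q(ξ^j). -/
theorem exists_point (c : Chart M.O ι κ) {x : M.X} (hx : x ∈ c.dom) :
    ∃ p, ∃ hp : p ∈ Opens.comap T.proj.base c.dom, T.proj.base p = x ∧
      ∀ j, val hp (T.d.map _ (T.proj.pull c.dom (c.coord (Sum.inr j)))) =
        val hx (Q.map _ (c.coord (Sum.inr j))) := by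
  set z : ι ⊕ κ → ℝ := Sum.elim (c.e x) fun j => val hx (Q.map _ (c.coord (Sum.inr j)))
  have hz : z ∈ (T.chart c).e.target := by
    rw [chart_target]
    exact c.e.map_source hx
  have hp' : T.proj.base ((T.chart c).e.symm z) ∈ c.dom :=
    T.mem_chart_dom.1 ((T.chart c).e.map_target hz)
  have he : (T.chart c).e ((T.chart c).e.symm z) = z := (T.chart c).e.right_inv hz
  refine ⟨(T.chart c).e.symm z, hp', c.e.injOn hp' hx (funext fun μ => ?_), fun j => ?_⟩
  · rw [← T.chart_e_inl c hp', he]; rfl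
  · rw [← T.chart_e_inr c hp', he]; rfl

/-- The point is found in one chart but characterised by all functions. Evaluating the local anchor
α at it turns α(dh) = Q h into the required equality of values. -/
theorem exists_isAnchorPoint (x : M.X) : ∃ p, T.IsAnchorPoint Q x p := by
  obtain ⟨c, hc⟩ := M.exists_chart x
  obtain ⟨p, hp, hpx, hd⟩ := T.exists_point Q c hc
  refine ⟨p, hpx, fun W hx hpW h => ?_⟩
  have hV : Opens.comap T.proj.base (W ⊓ c.dom) ≤ Opens.comap T.proj.base c.dom := fun _ hq => hq.2
  have hVW : Opens.comap T.proj.base (W ⊓ c.dom) ≤ Opens.comap T.proj.base W := fun _ hq => hq.1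
  have hU : W ⊓ c.dom ≤ c.dom := inf_le_right
  have hUW : W ⊓ c.dom ≤ W := inf_le_left
  have hpts : T.HasPoints Q c _ _ hV hU := fun y hy => by
    obtain ⟨q, hq, hqy, hdq⟩ := T.exists_point Q c (hU hy)
    have hq' : T.proj.base q ∈ W ⊓ c.dom := by rwa [hqy]
    exact ⟨q, hq', hqy, hdq⟩
  obtain ⟨α, hα, -, hval⟩ := hpts.exists_hasCoords
  have hpV : p ∈ Opens.comap T.proj.base (W ⊓ c.dom) := ⟨hpW, hp⟩
  have hxc : x ∈ W ⊓ c.dom := ⟨hx, hc⟩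
  have := hval x hxc p hpV hpx hd (T.total.O.res hVW (T.d.map _ (T.proj.pull W h)))
  rw [hα.map_d_pull hUW, val_res, val_res] at this
  exact this.symm

/-- The underlying map of the odd anchor. -/
def anchorPoint (x : M.X) : T.total.X := (T.exists_isAnchorPoint Q x).choose

theorem isAnchorPoint_anchorPoint (x : M.X) : T.IsAnchorPoint Q x (T.anchorPoint Q x) :=
  (T.exists_isAnchorPoint Q x).choose_spec

/-- In the charts the map has coordinates x^μ and the values of Q(ξ^j), all continuous. The
chart-free description of anchor points permits using any chart near x. -/
theorem continuous_anchorPoint : Continuous (T.anchorPoint Q) := by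
  refine continuous_iff_continuousAt.2 fun x => ?_
  obtain ⟨c, hc⟩ := M.exists_chart x
  refine ContinuousOn.continuousAt (s := c.dom) ?_ (c.dom.isOpen.mem_nhds hc)
  rw [continuousOn_iff_continuous_domRestrict]
  have hmem : ∀ y : c.dom, T.proj.base (T.anchorPoint Q y) ∈ c.dom := fun y => by
    rw [(T.isAnchorPoint_anchorPoint Q y).1]
    exact y.2
  have hg : Continuous fun y : c.dom => (T.chart c).e (T.anchorPoint Q y) := by
    refine continuous_pi ?_
    rintro (μ | j)
    · have : ∀ y : c.dom, (T.chart c).e (T.anchorPoint Q y) (Sum.inl μ) = c.e y μ := fun y => by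
        rw [T.chart_e_inl c (hmem y), (T.isAnchorPoint_anchorPoint Q y).1]
      simp only [this]
      exact (continuous_apply μ).comp
        (c.e.continuousOn.comp_continuous continuous_subtype_val fun y => y.2)
    · have : ∀ y : c.dom, (T.chart c).e (T.anchorPoint Q y) (Sum.inr j) =
          val y.2 (Q.map _ (c.coord (Sum.inr j))) := fun y => by
        rw [T.chart_e_inr c (hmem y), (T.isAnchorPoint_anchorPoint Q y).2 c.dom y.2 (hmem y)]
      simp only [this]
      exact continuous_val c le_rfl _
  have h2 := (T.chart c).e.symm.continuousOn.comp_continuous hg fun y =>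
    (T.chart c).e.map_source (T.mem_chart_dom.2 (hmem y))
  refine h2.congr fun y => ?_
  exact (T.chart c).e.left_inv (T.mem_chart_dom.2 (hmem y))

/-! ### Existence and uniqueness of the odd anchor -/

variable {T Q}

theorem hasPoints_of_anchorPoint_mem {c : Chart M.O ι κ} {V : Opens T.total.X} {U : Opens M.X}
    (hV : V ≤ Opens.comap T.proj.base c.dom) (hU : U ≤ c.dom)
    (h : ∀ x ∈ U, T.anchorPoint Q x ∈ V) : T.HasPoints Q c V U hV hU := fun x hx =>
  ⟨_, h x hx, (T.isAnchorPoint_anchorPoint Q x).1, fun _ =>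
    (T.isAnchorPoint_anchorPoint Q x).2 c.dom _ _ _⟩

theorem HasCoords.change_chart {c c' : Chart M.O ι κ} {V : Opens T.total.X} {U : Opens M.X}
    {hV : V ≤ Opens.comap T.proj.base c.dom} {hU : U ≤ c.dom}
    {α : T.total.O.Sec V →ₐ[ℝ] M.O.Sec U} (hα : T.HasCoords Q c hV hU α)
    (hV' : V ≤ Opens.comap T.proj.base c'.dom) (hU' : U ≤ c'.dom) :
    T.HasCoords Q c' hV' hU' α :=
  ⟨fun _ => hα.map_pull _ _ _, fun _ => hα.map_d_pull _ _ _⟩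

/-- Uniqueness of local anchors, in the form that serves both for compatibility with restriction and
for agreement on overlaps of two charts. -/
theorem HasCoords.res_eq {c c' : Chart M.O ι κ} {V V' : Opens T.total.X} {U U' : Opens M.X}
    {hV : V ≤ Opens.comap T.proj.base c.dom} {hU : U ≤ c.dom}
    {hV' : V' ≤ Opens.comap T.proj.base c'.dom} {hU' : U' ≤ c'.dom}
    {α : T.total.O.Sec V →ₐ[ℝ] M.O.Sec U} (hα : T.HasCoords Q c hV hU α)
    {β : T.total.O.Sec V' →ₐ[ℝ] M.O.Sec U'} (hβ : T.HasCoords Q c' hV' hU' β)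
    (hVV : V' ≤ V) (hUU : U' ≤ U) (h : ∀ x ∈ U', T.anchorPoint Q x ∈ V) (f : T.total.O.Sec V) :
    M.O.res hUU (α f) = β (T.total.O.res hVV f) := by
  have hβ' := hβ.change_chart (hVV.trans hV) (hUU.trans hU)
  have h1 : T.HasCoords Q c hV (hUU.trans hU) ((M.O.res hUU).comp α) :=
    ⟨fun b => by rw [AlgHom.comp_apply, hα.coord, M.O.res_res],
      fun b => by rw [AlgHom.comp_apply, hα.d_coord, M.O.res_res]⟩
  have h2 : T.HasCoords Q c hV (hUU.trans hU) (β.comp (T.total.O.res hVV)) :=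
    ⟨fun b => by rw [AlgHom.comp_apply, T.total.O.res_res, hβ'.coord],
      fun b => by rw [AlgHom.comp_apply, T.total.O.res_res, hβ'.d_coord]⟩
  exact AlgHom.congr_fun (h1.unique h2 (hasPoints_of_anchorPoint_mem _ _ h)) f

variable (T Q) in
theorem exists_isOddAnchor : ∃ a : Hom M T.total, IsOddAnchor Q T a := by
  let b : C(M.X, T.total.X) := ⟨T.anchorPoint Q, T.continuous_anchorPoint Q⟩
  have hVc : ∀ (c : Chart M.O ι κ) (V : Opens T.total.X),
      V ⊓ Opens.comap T.proj.base c.dom ≤ Opens.comap T.proj.base c.dom := fun _ _ => inf_le_right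
  have hVV : ∀ (c : Chart M.O ι κ) (V : Opens T.total.X),
      V ⊓ Opens.comap T.proj.base c.dom ≤ V := fun _ _ => inf_le_left
  have hUc : ∀ (c : Chart M.O ι κ) (V : Opens T.total.X), c.dom ⊓ Opens.comap b V ≤ c.dom :=
    fun _ _ => inf_le_left
  have hbase : ∀ x, T.proj.base (b x) = x := fun x => (T.isAnchorPoint_anchorPoint Q x).1
  have hmem : ∀ (c : Chart M.O ι κ) (V : Opens T.total.X), ∀ x ∈ c.dom ⊓ Opens.comap b V,
      T.anchorPoint Q x ∈ V ⊓ Opens.comap T.proj.base c.dom := fun c V x hx => by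
    have h1 : T.proj.base (b x) ∈ c.dom := by
      rw [hbase]
      exact hx.1
    exact ⟨hx.2, h1⟩
  have hex := fun (c : Chart M.O ι κ) V =>
    (hasPoints_of_anchorPoint_mem (Q := Q) (hVc c V) (hUc c V) (hmem c V)).exists_hasCoords
  choose α hα hpar hval using hex
  obtain ⟨a, hab, ha⟩ := exists_pull_glue b (fun c : Chart M.O ι κ => c.dom) M.exists_chart
    (fun c V => (α c V).comp (T.total.O.res (hVV c V)))
    (fun c V k f hf => hpar c V k _ (T.total.O.res_par _ _ _ hf))
    (fun c V W h h' f => by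
      have hle : V ⊓ Opens.comap T.proj.base c.dom ≤ W ⊓ Opens.comap T.proj.base c.dom :=
        inf_le_inf_right _ h
      simp only [AlgHom.comp_apply]
      rw [(hα c W).res_eq (hα c V) hle h' fun x hx => hle (hmem c V x hx), T.total.O.res_res,
        T.total.O.res_res])
    (fun c c' V f => by
      have hV' : V ⊓ Opens.comap T.proj.base c.dom ⊓ (V ⊓ Opens.comap T.proj.base c'.dom) ≤
        V ⊓ Opens.comap T.proj.base c.dom := inf_le_left
      have hV'' : V ⊓ Opens.comap T.proj.base c.dom ⊓ (V ⊓ Opens.comap T.proj.base c'.dom) ≤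
        V ⊓ Opens.comap T.proj.base c'.dom := inf_le_right
      have hU' : c.dom ⊓ Opens.comap b V ⊓ (c'.dom ⊓ Opens.comap b V) ≤ c.dom ⊓ Opens.comap b V :=
        inf_le_left
      have hU'' : c.dom ⊓ Opens.comap b V ⊓ (c'.dom ⊓ Opens.comap b V) ≤
        c'.dom ⊓ Opens.comap b V := inf_le_right
      -- On the overlap of two charts both local anchors are compared with a third one, defined on
      -- the intersections.
      obtain ⟨β, hβ, -, -⟩ := (hasPoints_of_anchorPoint_mem (Q := Q) (hV'.trans (hVc c V))
        (hU'.trans (hUc c V)) fun x hx =>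
          ⟨hmem c V x (hU' hx), hmem c' V x (hU'' hx)⟩).exists_hasCoords
      simp only [AlgHom.comp_apply]
      rw [(hα c V).res_eq hβ hV' hU' fun x hx => hmem c V x (hU' hx),
        (hα c' V).res_eq hβ hV'' hU'' fun x hx => hmem c' V x (hU'' hx), T.total.O.res_res,
        T.total.O.res_res])
  have key : ∀ (c : Chart M.O ι κ) (V : Opens T.total.X) (hcV : c.dom ≤ Opens.comap a.base V)
      (h1 : c.dom ≤ c.dom ⊓ Opens.comap b V) (f : T.total.O.Sec V),
      M.O.res hcV (a.pull V f) = M.O.res h1 (α c V (T.total.O.res (hVV c V) f)) :=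
    fun c V hcV h1 f => by
      have hle : c.dom ⊓ Opens.comap b V ≤ Opens.comap a.base V := by
        rw [hab]
        exact inf_le_right
      have := ha c V f hle
      rw [AlgHom.comp_apply] at this
      rw [← this, M.O.res_res]
  have hdom : ∀ c : Chart M.O ι κ,
      c.dom ≤ c.dom ⊓ Opens.comap b (Opens.comap T.proj.base c.dom) := fun c x hx => by
    have h1 : T.proj.base (b x) ∈ c.dom := by
      rw [hbase]
      exact hx
    exact ⟨hx, h1⟩
  refine ⟨a, fun x => by rw [hab, hbase], fun c s h => ?_, fun c s h => ?_⟩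
  · rw [key c _ h (hdom c), (hα c _).coord, M.O.res_res, M.O.res_eq_self]
  · rw [key c _ h (hdom c), (hα c _).d_coord, M.O.res_res, M.O.res_eq_self]

end AntitangentBundle

namespace IsOddAnchor

open AntitangentBundle

variable {M : Supermanifold.{u} ι κ} {T : AntitangentBundle M} {Q : OddVectorField M}
  {a b : Hom M T.total}

theorem dom_le (ha : IsOddAnchor Q T a) (c : Chart M.O ι κ) :
    c.dom ≤ Opens.comap a.base (Opens.comap T.proj.base c.dom) := fun x hx => by
  have h1 : T.proj.base (a.base x) ∈ c.dom := by
    rw [ha.base]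
    exact hx
  exact h1

theorem hasCoords (ha : IsOddAnchor Q T a) (c : Chart M.O ι κ) {V : Opens T.total.X}
    {U : Opens M.X} (hV : V ≤ Opens.comap T.proj.base c.dom) (hU : U ≤ c.dom)
    (h : U ≤ Opens.comap a.base V) :
    T.HasCoords Q c hV hU ((M.O.res h).comp (a.pull V)) := by
  refine ⟨fun s => ?_, fun s => ?_⟩
  · have := congrArg (M.O.res hU) (ha.pull_coord c s (ha.dom_le c))
    rw [AlgHom.comp_apply, a.pull_res' hV, M.O.res_res, ← this, M.O.res_res]
  · have := congrArg (M.O.res hU) (ha.pull_d_coord c s (ha.dom_le c))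
    rw [AlgHom.comp_apply, a.pull_res' hV, M.O.res_res, ← this, M.O.res_res]

/-- The underlying map is forced: pull-backs preserve values, so the dξ^j-coordinates of the image
of x are the values of a^*(dξ^j) = Q(ξ^j) at x. -/
theorem base_eq (ha : IsOddAnchor Q T a) (x : M.X) : a.base x = T.anchorPoint Q x := by
  obtain ⟨c, hc⟩ := M.exists_chart x
  have hp : a.base x ∈ Opens.comap T.proj.base c.dom := ha.dom_le c hc
  have hp' := T.isAnchorPoint_anchorPoint Q x
  have hq : T.proj.base (T.anchorPoint Q x) ∈ c.dom := by rwa [hp'.1]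
  refine T.eq_of_coords c hp hq ((ha.base x).trans hp'.1.symm) fun j => ?_
  rw [hp'.2 c.dom hc hq, ← a.val_pull (ha.dom_le c hc) hp, ← ha.pull_d_coord c _ (ha.dom_le c),
    val_res]

theorem anchorPoint_mem (ha : IsOddAnchor Q T a) {V : Opens T.total.X} {x : M.X}
    (hx : x ∈ Opens.comap a.base V) : T.anchorPoint Q x ∈ V := by
  rw [← ha.base_eq]
  exact hx

theorem hasPoints (ha : IsOddAnchor Q T a) {c : Chart M.O ι κ} {V : Opens T.total.X}
    {U : Opens M.X} (hV : V ≤ Opens.comap T.proj.base c.dom) (hU : U ≤ c.dom)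
    (h : U ≤ Opens.comap a.base V) : T.HasPoints Q c V U hV hU :=
  hasPoints_of_anchorPoint_mem hV hU fun _ hx => ha.anchorPoint_mem (h hx)

theorem eq (ha : IsOddAnchor Q T a) (hb : IsOddAnchor Q T b) : a = b := by
  have hbase : a.base = b.base := ContinuousMap.ext fun x => by rw [ha.base_eq, hb.base_eq]
  -- The two pull-backs live over open sets that are equal only through `hbase`; the restriction map
  -- makes them comparable.
  have hpull : ∀ V f (h : Opens.comap a.base V ≤ Opens.comap b.base V),
      a.pull V f = M.O.res h (b.pull V f) := fun V f h => by
    refine M.O.eq_of_locally fun x hx => ?_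
    obtain ⟨c, hc⟩ := M.exists_chart x
    have hU : Opens.comap a.base V ⊓ c.dom ≤ Opens.comap a.base V := inf_le_left
    have hUc : Opens.comap a.base V ⊓ c.dom ≤ c.dom := inf_le_right
    have hVc : V ⊓ Opens.comap T.proj.base c.dom ≤ Opens.comap T.proj.base c.dom := inf_le_right
    have hVV : V ⊓ Opens.comap T.proj.base c.dom ≤ V := inf_le_left
    have hUa : Opens.comap a.base V ⊓ c.dom ≤
        Opens.comap a.base (V ⊓ Opens.comap T.proj.base c.dom) := fun y hy =>
      ⟨hy.1, ha.dom_le c hy.2⟩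
    have hUb : Opens.comap a.base V ⊓ c.dom ≤
        Opens.comap b.base (V ⊓ Opens.comap T.proj.base c.dom) := by
      rw [← hbase]
      exact hUa
    refine ⟨_, hU, ⟨hx, hc⟩, ?_⟩
    have := AlgHom.congr_fun ((ha.hasCoords c hVc hUc hUa).unique (hb.hasCoords c hVc hUc hUb)
      (ha.hasPoints hVc hUc hUa)) (T.total.O.res hVV f)
    rw [AlgHom.comp_apply, AlgHom.comp_apply, a.pull_res' hVV, b.pull_res' hVV, M.O.res_res,
      M.O.res_res] at this
    rw [M.O.res_res]
    exact this
  obtain ⟨ab, ap, apar, ares⟩ := a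
  obtain ⟨bb, bp, bpar, bres⟩ := b
  obtain rfl : ab = bb := hbase
  obtain rfl : ap = bp := funext fun V => AlgHom.ext fun f =>
    (hpull V f le_rfl).trans (M.O.res_self _ _)
  rfl

theorem map_d (ha : IsOddAnchor Q T a) (hQ : Q.IsHomological) (V : Opens T.total.X)
    (f : T.total.O.Sec V) :
    Q.map (Opens.comap a.base V) (a.pull V f) = a.pull V (T.d.map V f) := by
  refine M.O.eq_of_locally fun x hx => ?_
  obtain ⟨c, hc⟩ := M.exists_chart x
  have hU : Opens.comap a.base V ⊓ c.dom ≤ Opens.comap a.base V := inf_le_left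
  have hUc : Opens.comap a.base V ⊓ c.dom ≤ c.dom := inf_le_right
  have hVc : V ⊓ Opens.comap T.proj.base c.dom ≤ Opens.comap T.proj.base c.dom := inf_le_right
  have hVV : V ⊓ Opens.comap T.proj.base c.dom ≤ V := inf_le_left
  have hUa : Opens.comap a.base V ⊓ c.dom ≤
      Opens.comap a.base (V ⊓ Opens.comap T.proj.base c.dom) := fun y hy =>
    ⟨hy.1, ha.dom_le c hy.2⟩
  refine ⟨_, hU, ⟨hx, hc⟩, ?_⟩
  have := (ha.hasCoords c hVc hUc hUa).map_d
    (fun i f hf => M.O.res_par _ _ _ (a.pull_par _ _ _ hf)) (ha.hasPoints hVc hUc hUa) hQ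
    (T.total.O.res hVV f)
  rwa [AlgHom.comp_apply, AlgHom.comp_apply, T.d.map_res, a.pull_res' hVV, a.pull_res' hVV,
    M.O.res_res, M.O.res_res, Q.map_res] at this

end IsOddAnchor


variable {ι κ : Type} [Fintype ι] [Fintype κ]

/-! ### Functions on a superdomain as functions on its antitangent bundle -/

namespace Model

variable {V V' : Opens (ι → ℝ)} {O O' : Opens (ι ⊕ κ → ℝ)}

/-- The pull-back of functions to the antitangent bundle. -/
def lift (h : ∀ z ∈ O, (fun μ => z (Sum.inl μ)) ∈ V) :
    Model ι κ V →ₐ[ℝ] Model (ι ⊕ κ) (κ ⊕ ι) O :=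
  subst (fun μ => even O (Sum.inl μ)) (fun j => odd O (Sum.inl j)) (fun μ => inv_even _)
    (fun j => inv_odd _) fun z => by simpa using h z z.2

@[simp]
theorem lift_even (h : ∀ z ∈ O, (fun μ => z (Sum.inl μ)) ∈ V) (μ : ι) :
    lift h (even V μ : Model ι κ V) = even O (Sum.inl μ) := subst_even _ _ _ _ _ μ

@[simp]
theorem lift_odd (h : ∀ z ∈ O, (fun μ => z (Sum.inl μ)) ∈ V) (j : κ) :
    lift h (odd V j : Model ι κ V) = odd O (Sum.inl j) := subst_odd _ _ _ _ _ j

theorem lift_res (h : ∀ z ∈ O, (fun μ => z (Sum.inl μ)) ∈ V) (hV : V ≤ V') (f : Model ι κ V') :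
    lift h (res hV f) = lift (fun z hz => hV (h z hz)) f := by
  have : (lift h).comp (res hV) = lift (κ := κ) (fun z hz => hV (h z hz)) :=
    algHom_ext (fun μ => by simp) (fun j => by simp) fun z => by simpa using hV (h z z.2)
  exact AlgHom.congr_fun this f

theorem res_lift (h : ∀ z ∈ O, (fun μ => z (Sum.inl μ)) ∈ V) (hO : O' ≤ O) (f : Model ι κ V) :
    res hO (lift h f) = lift (fun z hz => h z (hO hz)) f := by
  have : (res hO).comp (lift h) = lift (κ := κ) (fun z hz => h z (hO hz)) :=
    algHom_ext (fun μ => by simp) (fun j => by simp) fun z => by simpa using h z (hO z.2)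
  exact AlgHom.congr_fun this f

theorem inv_lift (h : ∀ z ∈ O, (fun μ => z (Sum.inl μ)) ∈ V) (f : Model ι κ V) :
    inv (lift h f) = lift h (inv f) :=
  (inv_map (by simp) (by simp) (fun z => by simpa using h z z.2) f).symm

theorem body_lift (h : ∀ z ∈ O, (fun μ => z (Sum.inl μ)) ∈ V) (f : Model ι κ V) (z : O) :
    body (lift h f) z = body f ⟨_, h z z.2⟩ := by
  rw [body_map (by simp) (fun z => by simpa using h z z.2)]
  congr
  simp

end Model

open Model Supermanifold

namespace Chart

section Lift

variable {X : Type u} [TopologicalSpace X] {A : SuperSheaf X} (c : Chart A ι κ)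

/-- The coordinates of the points of the antitangent bundle over an open set. -/
def cyl (V : Opens X) : Opens (ι ⊕ κ → ℝ) :=
  Opens.comap ⟨fun z μ => z (Sum.inl μ), by fun_prop⟩ (c.image V)

theorem cyl_mono {V V' : Opens X} (h : V ≤ V') : c.cyl V ≤ c.cyl V' := fun _ hz =>
  ⟨hz.1, h hz.2⟩

variable {c} in
theorem mem_image_of_le_cyl {V : Opens X} {O : Opens (ι ⊕ κ → ℝ)} (h : O ≤ c.cyl V) :
    ∀ z ∈ O, (fun μ => z (Sum.inl μ)) ∈ c.image V := fun _ hz => h hz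

variable {V V' : Opens X} {O O' : Opens (ι ⊕ κ → ℝ)}

/-- The coordinate representation of the pull-back of a section to the antitangent bundle. -/
def lift (h : O ≤ c.cyl V) : A.Sec V →ₐ[ℝ] Model (ι ⊕ κ) (κ ⊕ ι) O :=
  (Model.lift (mem_image_of_le_cyl h)).comp (c.rep (covers_image V))

theorem lift_apply (h : O ≤ c.cyl V) (f : A.Sec V) :
    c.lift h f = Model.lift (mem_image_of_le_cyl h) (c.rep (covers_image V) f) := rfl

theorem lift_res (h : O ≤ c.cyl V) (hV : V ≤ V') (f : A.Sec V') :
    c.lift h (A.res hV f) = c.lift (h.trans (c.cyl_mono hV)) f := by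
  have hi : c.image V ≤ c.image V' := fun z hz => ⟨hz.1, hV hz.2⟩
  rw [lift_apply, rep_res, lift_apply, ← c.res_rep (covers_image V') hi, Model.lift_res]

theorem res_lift (h : O ≤ c.cyl V) (hO : O' ≤ O) (f : A.Sec V) :
    Model.res hO (c.lift h f) = c.lift (hO.trans h) f := by
  rw [lift_apply, Model.res_lift, lift_apply]

theorem lift_even (h : O ≤ c.cyl c.dom) (μ : ι) : c.lift h (c.even μ) = Model.even O (Sum.inl μ) := by
  rw [lift_apply, rep_even, Model.lift_even]

theorem lift_odd (h : O ≤ c.cyl c.dom) (j : κ) : c.lift h (c.odd j) = Model.odd O (Sum.inl j) := by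
  rw [lift_apply, rep_odd, Model.lift_odd]

theorem lift_mem_par (h : O ≤ c.cyl V) {i : ZMod 2} {f : A.Sec V} (hf : f ∈ A.par V i) :
    c.lift h f ∈ Model.par O i := by
  have := Model.mem_par_iff.1 (c.rep_mem_par (covers_image V) hf)
  rw [Model.mem_par_iff, lift_apply, Model.inv_lift, this, map_smul]

end Lift

variable {M : Supermanifold.{u} ι κ} (c c' c'' : Chart M.O ι κ)
  {V V' : Opens M.X} {O O' O'' : Opens (ι ⊕ κ → ℝ)}

theorem body_lift (h : O ≤ c.cyl V) (f : M.O.Sec V) (z : O) :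
    body (c.lift h f) z = val (h z.2).2 f := by
  rw [lift_apply, Model.body_lift, body_rep]

/-! ### Coordinate changes of the antitangent bundle -/

/-- The even coordinates of a second chart on the antitangent bundle. -/
def tEven (h : O ≤ c.cyl c'.dom) : ι ⊕ κ → Model (ι ⊕ κ) (κ ⊕ ι) O :=
  Sum.elim (fun μ => c.lift h (c'.even μ)) fun j => deRham (c.lift h (c'.odd j))

/-- The odd coordinates of a second chart on the antitangent bundle. -/
def tOdd (h : O ≤ c.cyl c'.dom) : κ ⊕ ι → Model (ι ⊕ κ) (κ ⊕ ι) O :=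
  Sum.elim (fun j => c.lift h (c'.odd j)) fun μ => deRham (c.lift h (c'.even μ))

theorem inv_lift_even (h : O ≤ c.cyl c'.dom) (μ : ι) :
    inv (c.lift h (c'.even μ)) = c.lift h (c'.even μ) :=
  mem_par_zero.1 (c.lift_mem_par h (c'.even_mem_par μ))

theorem inv_lift_odd (h : O ≤ c.cyl c'.dom) (j : κ) :
    inv (c.lift h (c'.odd j)) = -c.lift h (c'.odd j) :=
  mem_par_one.1 (c.lift_mem_par h (c'.odd_mem_par j))

theorem inv_tEven (h : O ≤ c.cyl c'.dom) (s : ι ⊕ κ) :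
    inv (c.tEven c' h s) = c.tEven c' h s := by
  rcases s with μ | j
  · exact c.inv_lift_even c' h μ
  · simp only [tEven, Sum.elim_inr]
    rw [inv_deRham, inv_lift_odd, map_neg, neg_neg]

theorem inv_tOdd (h : O ≤ c.cyl c'.dom) (s : κ ⊕ ι) :
    inv (c.tOdd c' h s) = -c.tOdd c' h s := by
  rcases s with j | μ
  · exact c.inv_lift_odd c' h j
  · simp only [tOdd, Sum.elim_inr]
    rw [inv_deRham, inv_lift_even]

theorem res_tEven (h : O ≤ c.cyl c'.dom) (hO : O' ≤ O) (s : ι ⊕ κ) :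
    Model.res hO (c.tEven c' h s) = c.tEven c' (hO.trans h) s := by
  rcases s with μ | j
  · exact c.res_lift h hO _
  · simp only [tEven, Sum.elim_inr]
    rw [← deRham_res, res_lift]

/-- The coordinate change of the underlying space of the antitangent bundle. -/
def tmap (z : ι ⊕ κ → ℝ) (s : ι ⊕ κ) : ℝ :=
  Smooth.extend (body (c.tEven c' (le_refl (c.cyl c'.dom)) s)) z

theorem body_tEven (h : O ≤ c.cyl c'.dom) (s : ι ⊕ κ) (z : O) :
    body (c.tEven c' h s) z = c.tmap c' z s := by
  have hz := Smooth.extend_coe (body (c.tEven c' (le_refl (c.cyl c'.dom)) s)) (inclusion h z)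
  rw [tmap, ← c.res_tEven c' le_rfl h, body_res, ← hz]

theorem continuousOn_tmap : ContinuousOn (c.tmap c') (c.cyl c'.dom) := fun _ hz =>
  (continuousAt_pi.2 fun s => (Smooth.contDiffAt_extend
    (body (c.tEven c' (le_refl (c.cyl c'.dom)) s)) hz).continuousAt).continuousWithinAt

theorem tmap_inl {z : ι ⊕ κ → ℝ} (hz : z ∈ c.cyl c'.dom) :
    (fun μ => c.tmap c' z (Sum.inl μ)) = c'.e (c.e.symm fun μ => z (Sum.inl μ)) := by
  funext μ
  rw [← c.body_tEven c' le_rfl (Sum.inl μ) ⟨z, hz⟩]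
  simp only [tEven, Sum.elim_inl]
  rw [body_lift]
  exact val_even c' hz.2 μ

theorem tmap_self {z : ι ⊕ κ → ℝ} (hz : z ∈ c.cyl c.dom) : c.tmap c z = z := by
  funext s
  rw [← c.body_tEven c le_rfl s ⟨z, hz⟩]
  rcases s with μ | j
  · simp only [tEven, Sum.elim_inl]
    rw [lift_even, body_even]
  · simp only [tEven, Sum.elim_inr]
    rw [lift_odd, deRham_odd_inl, body_even]

theorem tmap_mem_cyl {z : ι ⊕ κ → ℝ} (hz : z ∈ c.cyl c'.dom) (hzV : z ∈ c.cyl V) :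
    c.tmap c' z ∈ c'.cyl V := by
  have : (fun μ => c.tmap c' z (Sum.inl μ)) ∈ c'.image V := by
    rw [tmap_inl c c' hz]
    exact c'.e_mem_image hz.2 hzV.2
  exact this

/-- The change of coordinates of functions on the antitangent bundle. -/
def trans (h : O ≤ c.cyl c'.dom) (h' : ∀ z ∈ O, c.tmap c' z ∈ O') :
    Model (ι ⊕ κ) (κ ⊕ ι) O' →ₐ[ℝ] Model (ι ⊕ κ) (κ ⊕ ι) O :=
  subst (c.tEven c' h) (c.tOdd c' h) (c.inv_tEven c' h) (c.inv_tOdd c' h) fun z => by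
    simp only [body_tEven]
    exact h' z z.2

section Trans

variable {c c'} (h : O ≤ c.cyl c'.dom) (h' : ∀ z ∈ O, c.tmap c' z ∈ O')

theorem trans_even (s : ι ⊕ κ) : c.trans c' h h' (Model.even O' s) = c.tEven c' h s :=
  subst_even _ _ _ _ _ s

theorem trans_odd (s : κ ⊕ ι) : c.trans c' h h' (Model.odd O' s) = c.tOdd c' h s :=
  subst_odd _ _ _ _ _ s

theorem body_trans_even_mem (z : O) :
    (fun s => body (c.trans c' h h' (Model.even O' s)) z) ∈ O' := by
  simp only [trans_even, body_tEven]
  exact h' z z.2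

theorem inv_trans (f : Model (ι ⊕ κ) (κ ⊕ ι) O') :
    inv (c.trans c' h h' f) = c.trans c' h h' (inv f) :=
  (inv_map (fun s => by rw [trans_even, inv_tEven]) (fun s => by rw [trans_odd, inv_tOdd])
    (body_trans_even_mem h h') f).symm

theorem body_trans (f : Model (ι ⊕ κ) (κ ⊕ ι) O') (z : O) :
    body (c.trans c' h h' f) z = body f ⟨c.tmap c' z, h' z z.2⟩ := by
  rw [body_map (fun s => by rw [trans_odd, inv_tOdd]) (body_trans_even_mem h h')]
  congr
  funext s
  rw [trans_even, body_tEven]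

/-- Pull-back to ΠTM is the same in every chart: both sides are homomorphisms on the superdomain of
c', and they agree on its coordinates by the choice of the substitution. -/
theorem trans_lift (k : O' ≤ c'.cyl V) (k' : O ≤ c.cyl V) (f : M.O.Sec V) :
    c.trans c' h h' (c'.lift k f) = c.lift k' f := by
  have hW : ∀ x ∈ V ⊓ c'.dom, x ∈ c'.dom ∧ c'.e x ∈ c'.image V := fun x hx =>
    ⟨hx.2, c'.e_mem_image hx.2 hx.1⟩
  have hO : O ≤ c.cyl (V ⊓ c'.dom) := fun z hz => ⟨(h hz).1, (k' hz).2, (h hz).2⟩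
  have he : ∀ μ, c.trans c' h h' (Model.lift (mem_image_of_le_cyl k) (Model.even (c'.image V) μ)) =
      c.lift h (c'.even μ) := fun μ => by
    rw [Model.lift_even, trans_even]
    rfl
  have := algHom_ext (φ := (c.trans c' h h').comp (Model.lift (V := c'.image V) (mem_image_of_le_cyl k)))
    (ψ := (c.lift hO).comp (c'.sec hW))
    (fun μ => by
      rw [AlgHom.comp_apply, AlgHom.comp_apply, he, sec_even, lift_res])
    (fun j => by
      rw [AlgHom.comp_apply, AlgHom.comp_apply, Model.lift_odd, trans_odd, sec_odd, lift_res]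
      rfl)
    (fun z => by
      simp only [AlgHom.comp_apply, he, body_lift]
      have := c'.e_mem_image (h z.2).2 (k' z.2).2
      convert this using 1
      funext μ
      exact val_even c' (h z.2).2 μ)
  have := AlgHom.congr_fun this (c'.rep (covers_image V) f)
  rw [AlgHom.comp_apply, AlgHom.comp_apply, c'.sec_rep hW (covers_image V) inf_le_left,
    lift_res] at this
  exact this

/-- Invariance of d. On x' it holds because dx' was defined as d of the new coordinate, on dx'
because d² = 0; rigidity of the twisted difference extends it to all functions. -/
theorem trans_deRham (f : Model (ι ⊕ κ) (κ ⊕ ι) O') :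
    c.trans c' h h' (deRham f) = deRham (c.trans c' h h' f) := by
  have hone : ∀ W : Opens (ι ⊕ κ → ℝ), deRham (1 : Model (ι ⊕ κ) (κ ⊕ ι) W) = 0 := fun W => by
    have := deRham_mul (1 : Model (ι ⊕ κ) (κ ⊕ ι) W) 1
    simpa using this
  have key : ∀ x g : Model (ι ⊕ κ) (κ ⊕ ι) O',
      c.trans c' h h' (deRham x) = deRham (c.trans c' h h' x) →
      c.trans c' h h' (deRham (x * g)) - deRham (c.trans c' h h' (x * g)) =
        inv (c.trans c' h h' x) * (c.trans c' h h' (deRham g) - deRham (c.trans c' h h' g)) :=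
    fun x g hx => by
      rw [deRham_mul, map_add, map_mul, map_mul, map_mul, deRham_mul, hx, inv_trans, mul_sub]
      abel
  have := Model.eq_zero_of_coord ((c.trans c' h h').toLinearMap ∘ₗ deRham -
      deRham ∘ₗ (c.trans c' h h').toLinearMap) (c.tEven c' h) (fun s => -c.tOdd c' h s)
    (by simp [hone])
    (fun s g => by
      have := key (Model.even O' s) g (by
        rcases s with μ | j
        · rw [deRham_even_inl, trans_odd, trans_even]; rfl
        · rw [deRham_even_inr, trans_even, map_zero]
          exact (deRham_deRham _).symm)
      rw [trans_even, inv_tEven] at this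
      exact this)
    (fun s g => by
      have := key (Model.odd O' s) g (by
        rcases s with μ | j
        · rw [deRham_odd_inl, trans_odd, trans_even]; rfl
        · rw [deRham_odd_inr, trans_odd, map_zero]
          exact (deRham_deRham _).symm)
      rw [trans_odd, inv_tOdd] at this
      exact this)
    (fun z => by
      simp only [body_tEven]
      exact h' z z.2)
  exact sub_eq_zero.1 (LinearMap.congr_fun this f)

theorem trans_tEven {c'' : Chart M.O ι κ} (k : O' ≤ c'.cyl c''.dom) (l : O ≤ c.cyl c''.dom)
    (s : ι ⊕ κ) : c.trans c' h h' (c'.tEven c'' k s) = c.tEven c'' l s := by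
  rcases s with μ | j
  · exact trans_lift h h' k l _
  · simp only [tEven, Sum.elim_inr]
    rw [trans_deRham, trans_lift h h' k l]

theorem trans_tOdd {c'' : Chart M.O ι κ} (k : O' ≤ c'.cyl c''.dom) (l : O ≤ c.cyl c''.dom)
    (s : κ ⊕ ι) : c.trans c' h h' (c'.tOdd c'' k s) = c.tOdd c'' l s := by
  rcases s with j | μ
  · exact trans_lift h h' k l _
  · simp only [tOdd, Sum.elim_inr]
    rw [trans_deRham, trans_lift h h' k l]

/-- The coordinates belonging to c'' are pulled-back functions and their differentials, both of
which are carried along correctly by coordinate changes. No Jacobians have to be multiplied. -/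
theorem trans_trans {c'' : Chart M.O ι κ} (k : O' ≤ c'.cyl c''.dom)
    (k' : ∀ z ∈ O', c'.tmap c'' z ∈ O'') (l : O ≤ c.cyl c''.dom)
    (l' : ∀ z ∈ O, c.tmap c'' z ∈ O'') (f : Model (ι ⊕ κ) (κ ⊕ ι) O'') :
    c.trans c' h h' (c'.trans c'' k k' f) = c.trans c'' l l' f := by
  have he : ∀ s, c.trans c' h h' (c'.trans c'' k k' (Model.even O'' s)) =
      c.trans c'' l l' (Model.even O'' s) := fun s => by
    rw [trans_even, trans_even, trans_tEven h h' k l]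
  have := algHom_ext (φ := (c.trans c' h h').comp (c'.trans c'' k k'))
    (ψ := c.trans c'' l l') he
    (fun s => by rw [AlgHom.comp_apply, trans_odd, trans_odd, trans_tOdd h h' k l])
    (fun z => by
      simp only [AlgHom.comp_apply, he]
      exact body_trans_even_mem l l' z)
  exact AlgHom.congr_fun this f

end Trans

theorem trans_self (h : O ≤ c.cyl c.dom) (h' : ∀ z ∈ O, c.tmap c z ∈ O') (hO : O ≤ O')
    (f : Model (ι ⊕ κ) (κ ⊕ ι) O') : c.trans c h h' f = Model.res hO f := by
  have := algHom_ext (φ := c.trans c h h') (ψ := Model.res hO)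
    (fun s => by
      rw [trans_even, res_even]
      rcases s with μ | j
      · exact c.lift_even h μ
      · simp only [tEven, Sum.elim_inr]
        rw [lift_odd, deRham_odd_inl])
    (fun s => by
      rw [trans_odd, res_odd]
      rcases s with j | μ
      · exact c.lift_odd h j
      · simp only [tOdd, Sum.elim_inr]
        rw [lift_even, deRham_even_inl])
    (body_trans_even_mem h h')
  exact AlgHom.congr_fun this f

/-- Obtained by taking bodies in the identity for functions, so the underlying maps need no chain
rule of their own. -/
theorem tmap_tmap {z : ι ⊕ κ → ℝ} (hz : z ∈ c.cyl c'.dom) (hz' : z ∈ c.cyl c''.dom) :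
    c'.tmap c'' (c.tmap c' z) = c.tmap c'' z := by
  funext s
  have h : c.cyl c'.dom ⊓ c.cyl c''.dom ≤ c.cyl c'.dom := inf_le_left
  have l : c.cyl c'.dom ⊓ c.cyl c''.dom ≤ c.cyl c''.dom := inf_le_right
  have h' : ∀ w ∈ c.cyl c'.dom ⊓ c.cyl c''.dom, c.tmap c' w ∈ c'.cyl c''.dom := fun w hw =>
    c.tmap_mem_cyl c' hw.1 hw.2
  have h1 := body_trans h h' (c'.tEven c'' le_rfl s) ⟨z, hz, hz'⟩
  rw [trans_tEven h h' le_rfl l, body_tEven, body_tEven] at h1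
  exact h1.symm

end Chart


/-! ### The grading of an algebra with an involution -/

section Involution

variable {A : Type*} [Ring A] [Algebra ℝ A] (σ : A →ₐ[ℝ] A)

/-- The eigenspaces of an involution. -/
def eigen (i : ZMod 2) : Submodule ℝ A :=
  LinearMap.ker (σ.toLinearMap - (-1 : ℝ) ^ i.val • LinearMap.id)

variable {σ}

theorem mem_eigen {i : ZMod 2} {a : A} : a ∈ eigen σ i ↔ σ a = (-1 : ℝ) ^ i.val • a := by
  simp [eigen, sub_eq_zero]

/-- The decomposition is a = (a + σ a)/2 + (a − σ a)/2. -/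
theorem isInternal_eigen (hσ : ∀ a, σ (σ a) = a) : DirectSum.IsInternal (eigen σ) := by
  rw [DirectSum.isInternal_submodule_iff_isCompl (eigen σ) (i := 0) (j := 1) (by decide)
    (by ext i; simpa using zmod_two_cases i)]
  constructor
  · rw [Submodule.disjoint_def]
    intro a h0 h1
    rw [mem_eigen] at h0 h1
    have h : a = -a := by simpa [ZMod.val_one] using h0.symm.trans h1
    have h2 : (2 : ℝ) • a = 0 := by
      rw [two_smul]
      nth_rewrite 2 [h]
      simp
    exact (smul_eq_zero.1 h2).resolve_left two_ne_zero
  · rw [codisjoint_iff, eq_top_iff]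
    intro a _
    refine Submodule.mem_sup.2 ⟨(2⁻¹ : ℝ) • (a + σ a), ?_, (2⁻¹ : ℝ) • (a - σ a), ?_, ?_⟩
    · simp [mem_eigen, hσ, add_comm]
    · rw [mem_eigen, map_smul, map_sub, hσ, ZMod.val_one, pow_one, ← neg_sub a (σ a), smul_neg,
        neg_one_smul]
    · rw [← smul_add, add_add_sub_cancel, ← two_smul ℝ a, smul_smul]
      norm_num

/-- An algebra with an involution is graded by the eigenspaces. -/
@[reducible]
def gradedOfInvolution (hσ : ∀ a, σ (σ a) = a) : GradedAlgebra (eigen σ) where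
  one_mem := by simp [mem_eigen]
  mul_mem i j a b ha hb := by
    rw [mem_eigen] at *
    rw [map_mul, ha, hb, smul_mul_smul_comm]
    rcases zmod_two_cases i with rfl | rfl <;> rcases zmod_two_cases j with rfl | rfl <;>
      simp [ZMod.val_one, show (1 + 1 : ZMod 2) = 0 from rfl]
  toDecomposition := (isInternal_eigen hσ).chooseDecomposition

end Involution

variable {ι κ : Type} [Fintype ι] [Fintype κ]

/-! ### Supermanifolds glued from superdomains -/

/-- The open set `O` of coordinates of the `i`-th chart is mapped to `O'` by the change to the
`j`-th chart. -/
def Overlap {Y : Type u} [TopologicalSpace Y] {ι : Type} {I : Type u}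
    (φ : I → OpenPartialHomeomorph Y (ι → ℝ)) (i j : I) (O O' : Opens (ι → ℝ)) : Prop :=
  ∀ z ∈ O, z ∈ (φ i).target ∧ (φ i).symm z ∈ (φ j).source ∧ φ j ((φ i).symm z) ∈ O'

/-- Superdomains with changes of coordinates over an atlas of a space. -/
structure SuperAtlas (Y : Type u) [TopologicalSpace Y] (ι κ : Type) [Fintype ι] [Fintype κ]
    (I : Type u) where
  /-- the charts of the underlying space -/
  φ : I → OpenPartialHomeomorph Y (ι → ℝ)
  exists_mem : ∀ y, ∃ i, y ∈ (φ i).source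
  /-- the changes of coordinates -/
  τ : ∀ (i j : I) (O O' : Opens (ι → ℝ)), Overlap φ i j O O' → (Model ι κ O' →ₐ[ℝ] Model ι κ O)
  τ_self : ∀ i O O' h (hO : O ≤ O') f, τ i i O O' h f = Model.res hO f
  τ_τ : ∀ i j k O O' O'' h h' h'' f, τ i j O O' h (τ j k O' O'' h' f) = τ i k O O'' h'' f
  inv_τ : ∀ i j O O' h f, Model.inv (τ i j O O' h f) = τ i j O O' h (Model.inv f)

namespace SuperAtlas

variable {Y : Type u} [TopologicalSpace Y] {I : Type u} (G : SuperAtlas Y ι κ I)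

/-- The image of an open set in a chart. -/
def img (i : I) (W : Opens Y) : Opens (ι → ℝ) :=
  ⟨(G.φ i).target ∩ (G.φ i).symm ⁻¹' W, (G.φ i).isOpen_inter_preimage_symm W.2⟩

theorem img_mono (i : I) {W W' : Opens Y} (h : W ≤ W') : G.img i W ≤ G.img i W' := fun _ hz =>
  ⟨hz.1, h hz.2⟩

variable {G}

theorem _root_.Super.Overlap.mono {i j : I} {O O' O₁ O₁' : Opens (ι → ℝ)} (h : Overlap G.φ i j O O')
    (hO : O₁ ≤ O) (hO' : O' ≤ O₁') : Overlap G.φ i j O₁ O₁' := fun z hz =>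
  ⟨(h z (hO hz)).1, (h z (hO hz)).2.1, hO' (h z (hO hz)).2.2⟩

theorem overlap_self {i : I} {O O' : Opens (ι → ℝ)} (hO : ∀ z ∈ O, z ∈ (G.φ i).target)
    (h : O ≤ O') : Overlap G.φ i i O O' := fun z hz =>
  ⟨hO z hz, (G.φ i).map_target (hO z hz), by
    rw [(G.φ i).right_inv (hO z hz)]
    exact h hz⟩

/-- Restriction is the change from a chart to itself, so compatibility with it is an instance of the
cocycle condition and no separate axiom of an atlas. -/
theorem res_τ {i j : I} {O O' O₁ : Opens (ι → ℝ)} (h : Overlap G.φ i j O O') (hO : O₁ ≤ O)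
    (f : Model ι κ O') :
    Model.res hO (G.τ i j O O' h f) = G.τ i j O₁ O' (h.mono hO le_rfl) f := by
  rw [← G.τ_self i O₁ O (overlap_self (fun z hz => (h z (hO hz)).1) hO),
    G.τ_τ _ _ _ _ _ _ _ _ (h.mono hO le_rfl)]

theorem τ_res {i j : I} {O O' O₁ : Opens (ι → ℝ)} (h : Overlap G.φ i j O O')
    (hj : ∀ z ∈ O', z ∈ (G.φ j).target) (hO : O' ≤ O₁) (f : Model ι κ O₁) :
    G.τ i j O O' h (Model.res hO f) = G.τ i j O O₁ (h.mono le_rfl hO) f := by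
  rw [← G.τ_self j O' O₁ (overlap_self hj hO), G.τ_τ _ _ _ _ _ _ _ _ (h.mono le_rfl hO)]

variable (G)

/-- The compatibility condition for families of functions in the charts. -/
def IsCompatible (W : Opens Y) (s : ∀ i, Model ι κ (G.img i W)) : Prop :=
  ∀ i j O (h : Overlap G.φ i j O (G.img j W)) (hO : O ≤ G.img i W),
    Model.res hO (s i) = G.τ i j O (G.img j W) h (s j)

/-- The algebra of compatible families of functions in the charts. -/
def compatible (W : Opens Y) : Subalgebra ℝ (∀ i, Model ι κ (G.img i W)) where
  carrier := {s | G.IsCompatible W s}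
  mul_mem' hs ht i j O h hO := by
    rw [Pi.mul_apply, Pi.mul_apply, map_mul, map_mul, hs i j O h hO, ht i j O h hO]
  add_mem' hs ht i j O h hO := by
    rw [Pi.add_apply, Pi.add_apply, map_add, map_add, hs i j O h hO, ht i j O h hO]
  algebraMap_mem' r i j O h hO := by
    rw [Pi.algebraMap_apply, Pi.algebraMap_apply, AlgHom.commutes, AlgHom.commutes]

/-- Sections over an open set. -/
def Sec (W : Opens Y) : Type u := G.compatible W

instance (W : Opens Y) : Ring (G.Sec W) := inferInstanceAs (Ring (G.compatible W))

instance (W : Opens Y) : Algebra ℝ (G.Sec W) := inferInstanceAs (Algebra ℝ (G.compatible W))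

variable {W W' : Opens Y}

/-- The function of a section in a chart. -/
def component (i : I) : G.Sec W →ₐ[ℝ] Model ι κ (G.img i W) where
  toFun s := s.1 i
  map_one' := rfl
  map_mul' _ _ := rfl
  map_zero' := rfl
  map_add' _ _ := rfl
  commutes' _ := rfl

variable {G} in
theorem Sec.ext {s t : G.Sec W} (h : ∀ i, G.component i s = G.component i t) : s = t :=
  Subtype.ext (funext h)

theorem res_component (s : G.Sec W) (i j : I) (O : Opens (ι → ℝ))
    (h : Overlap G.φ i j O (G.img j W)) (hO : O ≤ G.img i W) :
    Model.res hO (G.component i s) = G.τ i j O (G.img j W) h (G.component j s) := s.2 i j O h hO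

/-- The section with given components. -/
def ofFamily (s : ∀ i, Model ι κ (G.img i W)) (h : G.IsCompatible W s) : G.Sec W := ⟨s, h⟩

@[simp]
theorem component_ofFamily (s : ∀ i, Model ι κ (G.img i W)) (h : G.IsCompatible W s) (i : I) :
    G.component i (G.ofFamily s h) = s i := rfl

section MkHom

variable {A : Type*} [Ring A] [Algebra ℝ A] (F : ∀ i, A →ₐ[ℝ] Model ι κ (G.img i W))
  (hF : ∀ a, G.IsCompatible W fun i => F i a)

/-- The homomorphism with given components. -/
def mkHom : A →ₐ[ℝ] G.Sec W where
  toFun a := G.ofFamily (fun i => F i a) (hF a)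
  map_one' := Sec.ext fun i => by rw [component_ofFamily, map_one, map_one]
  map_mul' a b := Sec.ext fun i => by
    rw [map_mul, component_ofFamily, component_ofFamily, component_ofFamily, map_mul]
  map_zero' := Sec.ext fun i => by rw [component_ofFamily, map_zero, map_zero]
  map_add' a b := Sec.ext fun i => by
    rw [map_add, component_ofFamily, component_ofFamily, component_ofFamily, map_add]
  commutes' r := Sec.ext fun i => by rw [component_ofFamily, AlgHom.commutes, AlgHom.commutes]

end MkHom

/-- Restriction of sections. -/
def res (h : W ≤ W') : G.Sec W' →ₐ[ℝ] G.Sec W :=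
  G.mkHom (fun i => (Model.res (G.img_mono i h)).comp (G.component i)) fun s i j O k hO => by
    beta_reduce
    rw [AlgHom.comp_apply, AlgHom.comp_apply, Model.res_res,
      G.res_component s i j O (k.mono le_rfl (G.img_mono j h)) (hO.trans (G.img_mono i h)),
      τ_res k (fun z hz => hz.1)]

@[simp]
theorem component_res (h : W ≤ W') (s : G.Sec W') (i : I) :
    G.component i (G.res h s) = Model.res (G.img_mono i h) (G.component i s) := rfl

/-- The parity involution of sections. -/
def inv (W : Opens Y) : G.Sec W →ₐ[ℝ] G.Sec W :=
  G.mkHom (fun i => Model.inv.comp (G.component i)) fun s i j O k hO => by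
    beta_reduce
    rw [AlgHom.comp_apply, AlgHom.comp_apply, ← Model.inv_res,
      G.res_component s i j O k hO, G.inv_τ]

@[simp]
theorem component_inv (s : G.Sec W) (i : I) :
    G.component i (G.inv W s) = Model.inv (G.component i s) := rfl

variable {G} in
theorem mem_eigen_inv {k : ZMod 2} {s : G.Sec W} :
    s ∈ eigen (G.inv W) k ↔ ∀ i, G.component i s ∈ Model.par (G.img i W) k := by
  rw [mem_eigen]
  constructor
  · intro h i
    rw [Model.mem_par_iff, ← component_inv, h, map_smul]
  · refine fun h => Sec.ext fun i => ?_
    rw [component_inv, Model.mem_par_iff.1 (h i), map_smul]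

theorem res_mem_eigen (h : W ≤ W') {k : ZMod 2} {s : G.Sec W'}
    (hs : s ∈ eigen (G.inv W') k) : G.res h s ∈ eigen (G.inv W) k :=
  mem_eigen_inv.2 fun i => by
    have := Model.mem_par_iff.1 (mem_eigen_inv.1 hs i)
    rw [Model.mem_par_iff, component_res, Model.inv_res, this, map_smul]

theorem sec_supercomm {i j : ZMod 2} {s t : G.Sec W} (hs : s ∈ eigen (G.inv W) i)
    (ht : t ∈ eigen (G.inv W) j) : s * t = (-1 : ℝ) ^ (i * j).val • (t * s) :=
  Sec.ext fun k => by
    rw [map_smul, map_mul, map_mul]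
    exact Model.supercomm (mem_eigen_inv.1 hs k) (mem_eigen_inv.1 ht k)

theorem exists_mem_img {J : Type u} (U : J → Opens Y) (i : I) {z : ι → ℝ}
    (hz : z ∈ G.img i (⨆ a, U a)) : ∃ a, z ∈ G.img i (U a) := by
  obtain ⟨a, ha⟩ := Opens.mem_iSup.1 hz.2
  exact ⟨a, hz.1, ha⟩

/-- Gluing takes place in each chart separately. Compatibility of the results between charts is then
checked on the pieces of the cover, where it is known. -/
theorem exists_glue {J : Type u} (U : J → Opens Y) (s : ∀ a, G.Sec (U a))
    (hs : ∀ a b, G.res (inf_le_left : U a ⊓ U b ≤ U a) (s a) = G.res inf_le_right (s b)) :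
    ∃ f : G.Sec (⨆ a, U a), ∀ a, G.res (le_iSup U a) f = s a := by
  have hex : ∀ i, ∃ t : Model ι κ (G.img i (⨆ a, U a)),
      ∀ a, Model.res (G.img_mono i (le_iSup U a)) t = G.component i (s a) := fun i => by
    refine Model.exists_glue _ _ (fun a => G.img_mono i (le_iSup U a))
      (fun z hz => G.exists_mem_img U i hz) (fun a => G.component i (s a)) fun a b => ?_
    have h := congrArg (G.component i) (hs a b)
    rw [component_res, component_res] at h
    have hle : G.img i (U a) ⊓ G.img i (U b) ≤ G.img i (U a ⊓ U b) := fun z hz =>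
      ⟨hz.1.1, hz.1.2, hz.2.2⟩
    have h2 := congrArg (Model.res hle) h
    rwa [Model.res_res, Model.res_res] at h2
  choose t ht using hex
  have hcomp : G.IsCompatible _ t := fun i j O h hO => by
    have hOa : ∀ a, O ⊓ G.img i (U a) ≤ O := fun a => inf_le_left
    have hia : ∀ a, O ⊓ G.img i (U a) ≤ G.img i (U a) := fun a => inf_le_right
    refine Model.eq_of_res_eq _ O hOa
      (fun z hz => (G.exists_mem_img U i (hO hz)).imp fun a ha => ⟨hz, ha⟩) fun a => ?_
    have hov : Overlap G.φ i j (O ⊓ G.img i (U a)) (G.img j (U a)) := fun z hz => by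
      obtain ⟨h1, h2, -⟩ := h z hz.1
      refine ⟨h1, h2, (G.φ j).map_source h2, ?_⟩
      change (G.φ j).symm (G.φ j ((G.φ i).symm z)) ∈ U a
      rw [(G.φ j).left_inv h2]
      exact hz.2.2
    have h1 := G.res_component (s a) i j _ hov (hia a)
    rw [← ht, ← ht, Model.res_res, τ_res hov (fun z hz => hz.1)] at h1
    rw [Model.res_res, h1, res_τ h]
  exact ⟨G.ofFamily t hcomp, fun a => Sec.ext fun i => by
    rw [component_res, component_ofFamily, ht]⟩

theorem eq_of_res_eq {J : Type u} (U : J → Opens Y) {f g : G.Sec (⨆ a, U a)}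
    (h : ∀ a, G.res (le_iSup U a) f = G.res (le_iSup U a) g) : f = g :=
  Sec.ext fun i => Model.eq_of_res_eq (fun a => G.img i (U a)) _
    (fun a => G.img_mono i (le_iSup U a)) (fun z hz => G.exists_mem_img U i hz) fun a => by
      rw [← component_res G (le_iSup U a), ← component_res G (le_iSup U a), h]

/-- The sheaf glued from superdomains. -/
def sheaf : SuperSheaf Y where
  Sec W := G.Sec W
  par W := eigen (G.inv W)
  graded W := gradedOfInvolution fun s => Sec.ext fun i => by simp
  supercomm _ _ _ _ _ hs ht := G.sec_supercomm hs ht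
  res := G.res
  res_par h _ _ hs := G.res_mem_eigen h hs
  res_self W s := Sec.ext fun i => by rw [component_res, Model.res_self]
  res_res h k s := Sec.ext fun i => by simp only [component_res, Model.res_res]
  glue U s hs := by
    obtain ⟨f, hf⟩ := G.exists_glue U s hs
    exact ⟨f, hf, fun g hg => G.eq_of_res_eq U fun a => (hg a).trans (hf a).symm⟩

theorem overlap_of_image_eq (i j : I) {U : Opens Y} {V : Opens (ι → ℝ)}
    (hU : (U : Set Y) ⊆ (G.φ i).source) (hV : G.φ i '' U = V) : Overlap G.φ j i (G.img j U) V :=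
  fun z hz => ⟨hz.1, hU hz.2, by
    have h1 : G.φ i ((G.φ j).symm z) ∈ G.φ i '' U := ⟨_, hz.2, rfl⟩
    rwa [hV] at h1⟩

theorem le_img_of_image_eq (i : I) {U : Opens Y} {V : Opens (ι → ℝ)}
    (hU : (U : Set Y) ⊆ (G.φ i).source) (hV : G.φ i '' U = V) : V ≤ G.img i U := fun z hz => by
  have hz' : z ∈ G.φ i '' U := by rwa [hV]
  obtain ⟨y, hy, rfl⟩ := hz'
  refine ⟨(G.φ i).map_source (hU hy), ?_⟩
  change (G.φ i).symm (G.φ i y) ∈ U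
  rwa [(G.φ i).left_inv (hU hy)]

/-- The section with a given representation in one chart. -/
def ofModel (i : I) {U : Opens Y} {V : Opens (ι → ℝ)} (hU : (U : Set Y) ⊆ (G.φ i).source)
    (hV : G.φ i '' U = V) : Model ι κ V →ₐ[ℝ] G.Sec U :=
  G.mkHom (fun j => G.τ j i (G.img j U) V (G.overlap_of_image_eq i j hU hV)) fun f j k O h hO => by
    rw [res_τ, G.τ_τ]

@[simp]
theorem component_ofModel (i : I) {U : Opens Y} {V : Opens (ι → ℝ)}
    (hU : (U : Set Y) ⊆ (G.φ i).source) (hV : G.φ i '' U = V) (f : Model ι κ V) (j : I) :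
    G.component j (G.ofModel i hU hV f) =
      G.τ j i (G.img j U) V (G.overlap_of_image_eq i j hU hV) f := rfl

/-- The representation of a section in one chart. -/
def toModel (i : I) {U : Opens Y} {V : Opens (ι → ℝ)} (hV : V ≤ G.img i U) :
    G.Sec U →ₐ[ℝ] Model ι κ V :=
  (Model.res hV).comp (G.component i)

theorem toModel_apply (i : I) {U : Opens Y} {V : Opens (ι → ℝ)} (hV : V ≤ G.img i U)
    (s : G.Sec U) : G.toModel i hV s = Model.res hV (G.component i s) := rfl

theorem toModel_ofModel (i : I) {U : Opens Y} {V : Opens (ι → ℝ)}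
    (hU : (U : Set Y) ⊆ (G.φ i).source) (hV : G.φ i '' U = V) (f : Model ι κ V) :
    G.toModel i (G.le_img_of_image_eq i hU hV) (G.ofModel i hU hV f) = f := by
  have hge : G.img i U ≤ V := fun z hz => by
    have := (G.overlap_of_image_eq i i hU hV z hz).2.2
    rwa [(G.φ i).right_inv hz.1] at this
  rw [toModel_apply, component_ofModel, G.τ_self _ _ _ _ hge, Model.res_res, Model.res_self]

theorem ofModel_toModel (i : I) {U : Opens Y} {V : Opens (ι → ℝ)}
    (hU : (U : Set Y) ⊆ (G.φ i).source) (hV : G.φ i '' U = V) (s : G.Sec U) :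
    G.ofModel i hU hV (G.toModel i (G.le_img_of_image_eq i hU hV) s) = s :=
  Sec.ext fun j => by
    rw [component_ofModel, toModel_apply,
      τ_res _ (fun z hz => (G.le_img_of_image_eq i hU hV hz).1),
      ← G.res_component s j i _ _ le_rfl, Model.res_self]

theorem ofModel_mem_eigen (i : I) {U : Opens Y} {V : Opens (ι → ℝ)}
    (hU : (U : Set Y) ⊆ (G.φ i).source) (hV : G.φ i '' U = V) {k : ZMod 2} {f : Model ι κ V} :
    G.ofModel i hU hV f ∈ eigen (G.inv U) k ↔ f ∈ Model.par V k := by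
  refine ⟨fun h => ?_, fun h => mem_eigen_inv.2 fun j => ?_⟩
  · have h1 := Model.mem_par_iff.1 (mem_eigen_inv.1 h i)
    rw [Model.mem_par_iff, ← G.toModel_ofModel i hU hV f, toModel_apply, Model.inv_res, h1,
      map_smul]
  · rw [Model.mem_par_iff] at h ⊢
    rw [component_ofModel, G.inv_τ, h, map_smul]

theorem res_ofModel (i : I) {U U₁ : Opens Y} {V V₁ : Opens (ι → ℝ)}
    (hU : (U : Set Y) ⊆ (G.φ i).source) (hV : G.φ i '' U = V)
    (hU₁ : (U₁ : Set Y) ⊆ (G.φ i).source) (hV₁ : G.φ i '' U₁ = V₁) (h : U₁ ≤ U) (k : V₁ ≤ V)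
    (f : Model ι κ V) : G.res h (G.ofModel i hU hV f) = G.ofModel i hU₁ hV₁ (Model.res k f) :=
  Sec.ext fun j => by
    rw [component_res, component_ofModel, component_ofModel, res_τ,
      τ_res _ fun z hz => (G.le_img_of_image_eq i hU₁ hV₁ hz).1]

/-- A chart of the atlas as a chart of the glued supermanifold. -/
def chart (i : I) : Chart G.sheaf ι κ where
  e := G.φ i
  iso _ _ hU hV := AlgEquiv.ofAlgHom (G.ofModel i hU hV)
    (G.toModel i (G.le_img_of_image_eq i hU hV))
    (AlgHom.ext fun s => G.ofModel_toModel i hU hV s)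
    (AlgHom.ext fun f => G.toModel_ofModel i hU hV f)
  iso_res _ _ _ _ hU hV hU₁ hV₁ h k f := G.res_ofModel i hU hV hU₁ hV₁ h k f
  iso_par _ _ hU hV _ _ := G.ofModel_mem_eigen i hU hV

/-- The glued supermanifold. -/
def supermanifold [T2Space Y] [SecondCountableTopology Y] : Supermanifold.{u} ι κ where
  X := Y
  O := G.sheaf
  exists_chart y := let ⟨i, hi⟩ := G.exists_mem y; ⟨G.chart i, hi⟩

section VectorField

variable (D : ∀ O : Opens (ι → ℝ), Model ι κ O →ₗ[ℝ] Model ι κ O)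
  (hτ : ∀ i j O O' h f, G.τ i j O O' h (D O' f) = D O (G.τ i j O O' h f))
  (hres : ∀ O O' (h : O ≤ O') f, D O (Model.res h f) = Model.res h (D O' f))

include hτ hres in
theorem isCompatible_endo (U : Opens Y) (s : G.Sec U) :
    G.IsCompatible U fun i => D _ (G.component i s) := fun i j O h hO => by
  rw [hτ, ← hres, G.res_component s i j O h hO]

/-- A linear endomorphism of sections given in the charts. -/
def endo (U : Opens Y) : G.Sec U →ₗ[ℝ] G.Sec U where
  toFun s := G.ofFamily (fun i => D _ (G.component i s)) (G.isCompatible_endo D hτ hres U s)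
  map_add' s t := Sec.ext fun i => by
    rw [map_add, component_ofFamily, component_ofFamily, component_ofFamily, map_add, map_add]
  map_smul' r s := Sec.ext fun i => by
    rw [map_smul, component_ofFamily, component_ofFamily, map_smul, map_smul, RingHom.id_apply]

@[simp]
theorem component_endo (U : Opens Y) (s : G.Sec U) (i : I) :
    G.component i (G.endo D hτ hres U s) = D _ (G.component i s) := rfl

theorem endo_mem_eigen (hinv : ∀ O f, Model.inv (D O f) = -D O (Model.inv f)) (U : Opens Y)
    {k : ZMod 2} {s : G.Sec U} (hs : s ∈ eigen (G.inv U) k) :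
    G.endo D hτ hres U s ∈ eigen (G.inv U) (k + 1) := mem_eigen_inv.2 fun i => by
  have := Model.mem_par_iff.1 (mem_eigen_inv.1 hs i)
  rw [Model.mem_par_iff, component_endo, hinv, this, map_smul]
  rcases zmod_two_cases k with rfl | rfl
  · simpa [ZMod.val_one] using (Model.neg_one_smul' _).symm
  · simp [ZMod.val_one, show (1 + 1 : ZMod 2) = 0 from rfl, Model.neg_one_smul']

theorem endo_mul (hmul : ∀ O f g, D O (f * g) = D O f * g + Model.inv f * D O g) (U : Opens Y)
    {k : ZMod 2} {s : G.Sec U} (t : G.Sec U) (hs : s ∈ eigen (G.inv U) k) :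
    G.endo D hτ hres U (s * t) =
      G.endo D hτ hres U s * t + (-1 : ℝ) ^ k.val • (s * G.endo D hτ hres U t) :=
  Sec.ext fun i => by
    have := Model.mem_par_iff.1 (mem_eigen_inv.1 hs i)
    rw [component_endo, map_mul, hmul, this, map_add, map_mul, map_smul, map_mul, component_endo,
      component_endo, smul_mul_assoc]

/-- An odd vector field given in the charts. -/
def vectorField [T2Space Y] [SecondCountableTopology Y]
    (hinv : ∀ O f, Model.inv (D O f) = -D O (Model.inv f))
    (hmul : ∀ O f g, D O (f * g) = D O f * g + Model.inv f * D O g) :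
    OddVectorField G.supermanifold where
  map := G.endo D hτ hres
  map_res {U V} h _ := Sec.ext fun i => hres (G.img i U) (G.img i V) (G.img_mono i h) _
  map_par U _ _ hs := G.endo_mem_eigen D hτ hres hinv U hs
  leibniz U _ _ t hs := G.endo_mul D hτ hres hmul U t hs

end VectorField

section HomTo

variable {ι' κ' : Type} [Fintype ι'] [Fintype κ'] {N : Supermanifold.{u} ι' κ'} (p : C(Y, N.X))
  (P : ∀ (i : I) (V : Opens N.X) (O : Opens (ι → ℝ)), O ≤ G.img i (Opens.comap p V) →
    (N.O.Sec V →ₐ[ℝ] Model ι κ O))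
  (hτ : ∀ i j V O O' (h : Overlap G.φ i j O O') k k' f,
    G.τ i j O O' h (P j V O' k f) = P i V O k' f)
  (hres : ∀ i V V' O k k' (h : V ≤ V') f, P i V O k (N.O.res h f) = P i V' O k' f)
  (hpar : ∀ i V O k a f, f ∈ N.O.par V a → P i V O k f ∈ Model.par O a)

include hτ in
theorem res_pullback {i : I} {V : Opens N.X} {O O' : Opens (ι → ℝ)}
    (hO : O' ≤ O) (k : O ≤ G.img i (Opens.comap p V)) (f : N.O.Sec V) :
    Model.res hO (P i V O k f) = P i V O' (hO.trans k) f := by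
  have hov : Overlap G.φ i i O' O := overlap_self (fun z hz => (k (hO hz)).1) hO
  rw [← hτ i i V O' O hov k (hO.trans k), G.τ_self _ _ _ _ hO]

/-- The pull-back of functions along a morphism given in the charts. -/
def pullback (V : Opens N.X) : N.O.Sec V →ₐ[ℝ] G.Sec (Opens.comap p V) :=
  G.mkHom (fun i => P i V (G.img i (Opens.comap p V)) le_rfl) fun f i j O h hO => by
    beta_reduce
    rw [hτ i j V _ _ h _ hO, G.res_pullback p P hτ hO]

@[simp]
theorem component_pullback (V : Opens N.X) (f : N.O.Sec V) (i : I) :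
    G.component i (G.pullback p P hτ V f) = P i V (G.img i (Opens.comap p V)) le_rfl f := rfl

include hres in
theorem pullback_res {V W : Opens N.X} (h : V ≤ W)
    (hle : Opens.comap p V ≤ Opens.comap p W) (f : N.O.Sec W) :
    G.pullback p P hτ V (N.O.res h f) = G.res hle (G.pullback p P hτ W f) :=
  Sec.ext fun i => by
    rw [component_res, component_pullback, component_pullback, G.res_pullback p P hτ,
      hres i V W _ le_rfl (G.img_mono i hle)]

/-- A morphism from the glued supermanifold given in the charts. -/
def homTo [T2Space Y] [SecondCountableTopology Y] : Hom G.supermanifold N where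
  base := p
  pull := G.pullback p P hτ
  pull_par _ _ _ hf := mem_eigen_inv.2 fun _ => hpar _ _ _ _ _ _ hf
  pull_res h f := G.pullback_res p P hτ hres h (fun _ hx => h hx) f

end HomTo

end SuperAtlas


variable {ι κ : Type} [Fintype ι] [Fintype κ]

/-! ### The total space of the antitangent bundle -/

/-- Points of different fibres are separated in the base, points of the same fibre in a common
trivialisation. -/
theorem t2Space_totalSpace {I B F : Type*} [TopologicalSpace B] [TopologicalSpace F] [T2Space B]
    [T2Space F] (Z : FiberBundleCore I B F) : T2Space Z.TotalSpace := by
  refine ⟨fun p q hpq => ?_⟩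
  by_cases h : p.1 = q.1
  · set e := Z.localTriv (Z.indexAt p.1)
    have hp : p ∈ e.source := Z.mem_baseSet_at p.1
    have hq : q ∈ e.source := by
      have := Z.mem_baseSet_at p.1
      rw [h] at this
      change q.1 ∈ Z.baseSet (Z.indexAt p.1)
      rwa [h]
    have hne : e p ≠ e q := fun h => hpq (e.injOn hp hq h)
    obtain ⟨U, V, hU, hV, hpU, hqV, hd⟩ := t2_separation hne
    exact ⟨_, _, e.toOpenPartialHomeomorph.isOpen_inter_preimage hU,
      e.toOpenPartialHomeomorph.isOpen_inter_preimage hV, ⟨hp, hpU⟩, ⟨hq, hqV⟩,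
      (hd.preimage e).mono inter_subset_right inter_subset_right⟩
  · obtain ⟨U, V, hU, hV, hpU, hqV, hd⟩ := t2_separation h
    exact ⟨_, _, hU.preimage Z.continuous_proj, hV.preimage Z.continuous_proj, hpU, hqV,
      hd.preimage _⟩

/-- The base is Lindelöf, so countably many trivialisations cover the total space, and each domain
is second countable. -/
theorem secondCountableTopology_totalSpace {I B F : Type*} [TopologicalSpace B]
    [TopologicalSpace F] [SecondCountableTopology B] [SecondCountableTopology F]
    (Z : FiberBundleCore I B F) : SecondCountableTopology Z.TotalSpace := by
  obtain ⟨s, hs, hcov⟩ := countable_cover_nhds (f := fun x => Z.baseSet (Z.indexAt x)) fun x =>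
    (Z.isOpen_baseSet _).mem_nhds (Z.mem_baseSet_at x)
  have := hs.to_subtype
  have : ∀ x : s, SecondCountableTopology (Z.localTriv (Z.indexAt x)).source := fun x =>
    (Z.localTriv (Z.indexAt x)).toOpenPartialHomeomorph.secondCountableTopology_source
  refine secondCountableTopology_of_countable_cover
    (U := fun x : s => (Z.localTriv (Z.indexAt x)).source)
    (fun x => (Z.localTriv (Z.indexAt x)).open_source) (eq_univ_of_forall fun p => ?_)
  have hp : p.1 ∈ ⋃ x ∈ s, Z.baseSet (Z.indexAt x) := by
    rw [hcov]
    trivial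
  obtain ⟨x, hx, hpx⟩ := mem_iUnion₂.1 hp
  exact mem_iUnion.2 ⟨⟨x, hx⟩, hpx⟩

namespace Supermanifold

variable (M : Supermanifold.{u} ι κ)

theorem elim_mem_cyl {c : Chart M.O ι κ} {x : M.X} (hx : x ∈ c.dom) {V : Opens M.X} (hV : x ∈ V)
    (v : κ → ℝ) : Sum.elim (c.e x) v ∈ c.cyl V := by
  have : (fun μ => Sum.elim (c.e x) v (Sum.inl μ)) ∈ c.image V := c.e_mem_image hx hV
  exact this

/-- The bundle whose fibre coordinates are the differentials of the odd coordinates. -/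
def bundleCore : FiberBundleCore (Chart M.O ι κ) M.X (κ → ℝ) where
  baseSet c := c.e.source
  isOpen_baseSet c := c.e.open_source
  indexAt x := (M.exists_chart x).choose
  mem_baseSet_at x := (M.exists_chart x).choose_spec
  -- Only the fibre part of the coordinate change is recorded. Its linearity in v is never needed,
  -- so a fibre bundle suffices.
  coordChange c c' x v j := c.tmap c' (Sum.elim (c.e x) v) (Sum.inr j)
  coordChange_self c x hx v := by
    rw [c.tmap_self (M.elim_mem_cyl hx hx v)]
    rfl
  continuousOn_coordChange c c' := by
    have h1 : ContinuousOn (fun p : M.X × (κ → ℝ) => Sum.elim (c.e p.1) p.2)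
        ((c.e.source ∩ c'.e.source) ×ˢ univ) := by
      refine continuousOn_pi.2 ?_
      rintro (μ | j)
      · exact (continuous_apply μ).comp_continuousOn
          (c.e.continuousOn.comp continuousOn_fst fun p hp => hp.1.1)
      · exact ((continuous_apply j).comp continuous_snd).continuousOn
    have h2 := (c.continuousOn_tmap c').comp h1 fun p hp =>
      M.elim_mem_cyl (V := c'.dom) hp.1.1 hp.1.2 p.2
    exact continuousOn_pi.2 fun j => (continuous_apply (Sum.inr j)).comp_continuousOn h2
  coordChange_comp c c' c'' x hx v := by
    have hz := M.elim_mem_cyl (V := c'.dom) hx.1.1 hx.1.2 v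
    have hz' := M.elim_mem_cyl (V := c''.dom) hx.1.1 hx.2 v
    -- The base part of the coordinate change is the change of coordinates on |M|, so adding back
    -- the base coordinates recovers the full map, to which `tmap_tmap` applies.
    have : Sum.elim (c'.e x) (fun j => c.tmap c' (Sum.elim (c.e x) v) (Sum.inr j)) =
        c.tmap c' (Sum.elim (c.e x) v) := by
      have h := c.tmap_inl c' hz
      simp only [Sum.elim_inl] at h
      rw [c.e.left_inv hx.1.1] at h
      funext s
      rcases s with μ | j
      · exact (congrFun h μ).symm
      · rfl
    funext j
    rw [this, c.tmap_tmap c' c'' hz hz']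

instance : T2Space M.bundleCore.TotalSpace := t2Space_totalSpace _

instance : SecondCountableTopology M.bundleCore.TotalSpace := secondCountableTopology_totalSpace _

/-- The coordinates of the total space over a chart. -/
def bundleChart (c : Chart M.O ι κ) :
    OpenPartialHomeomorph M.bundleCore.TotalSpace (ι ⊕ κ → ℝ) :=
  (M.bundleCore.localTriv c).toOpenPartialHomeomorph.trans
    ((c.e.prod (OpenPartialHomeomorph.refl (κ → ℝ))).trans
      Homeomorph.sumArrowHomeomorphProdArrow.symm.toOpenPartialHomeomorph)

variable {M} (c c' : Chart M.O ι κ)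

theorem mem_bundleChart_source {p : M.bundleCore.TotalSpace} :
    p ∈ (M.bundleChart c).source ↔ p.1 ∈ c.dom := by
  have h : p ∈ (M.bundleCore.localTriv c).source ↔ p.1 ∈ c.dom := Iff.rfl
  simp only [bundleChart, OpenPartialHomeomorph.trans_source, mem_inter_iff, mem_preimage]
  refine ⟨fun hp => h.1 hp.1, fun hp => ⟨h.2 hp, ⟨hp, trivial⟩, trivial⟩⟩

theorem mem_bundleChart_target {z : ι ⊕ κ → ℝ} :
    z ∈ (M.bundleChart c).target ↔ (fun μ => z (Sum.inl μ)) ∈ c.e.target := by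
  simp only [bundleChart, OpenPartialHomeomorph.trans_target, mem_inter_iff, mem_preimage]
  refine ⟨fun hz => hz.1.2.1, fun hz => ⟨⟨trivial, hz, trivial⟩, ?_⟩⟩
  exact (M.bundleCore.mem_localTriv_target c _).2 (c.e.map_target hz)

/-- A point of the total space is stored in the preferred trivialisation at its base point; the
cocycle identity removes this detour from the transition map. -/
theorem bundleChart_bundleChart_symm {z : ι ⊕ κ → ℝ} (hz : z ∈ c.cyl c'.dom) :
    M.bundleChart c' ((M.bundleChart c).symm z) = c.tmap c' z := by
  set x := c.e.symm fun μ => z (Sum.inl μ)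
  have hxc : x ∈ c.e.source := c.e.map_target hz.1
  have hxc' : x ∈ c'.e.source := hz.2
  have hzx : Sum.elim (c.e x) (fun j => z (Sum.inr j)) = z := by
    have h1 : c.e x = fun μ => z (Sum.inl μ) := c.e.right_inv hz.1
    rw [h1]
    funext s
    rcases s with μ | j <;> rfl
  have h := M.bundleCore.coordChange_comp c (M.bundleCore.indexAt x) c' x
    ⟨⟨hxc, M.bundleCore.mem_baseSet_at x⟩, hxc'⟩ fun j => z (Sum.inr j)
  funext s
  rcases s with μ | j
  · exact (congrFun (c.tmap_inl c' hz) μ).symm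
  · refine (congrFun h j).trans ?_
    change c.tmap c' (Sum.elim (c.e x) fun j => z (Sum.inr j)) (Sum.inr j) = _
    rw [hzx]

variable {c c'} in
theorem le_cyl_of_overlap {O O' : Opens (ι ⊕ κ → ℝ)} (h : Overlap M.bundleChart c c' O O') :
    O ≤ c.cyl c'.dom := fun z hz =>
  ⟨(mem_bundleChart_target c).1 (h z hz).1, (mem_bundleChart_source c').1 (h z hz).2.1⟩

variable {c c'} in
theorem tmap_mem_of_overlap {O O' : Opens (ι ⊕ κ → ℝ)} (h : Overlap M.bundleChart c c' O O') :
    ∀ z ∈ O, c.tmap c' z ∈ O' := fun z hz => by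
  rw [← bundleChart_bundleChart_symm c c' (le_cyl_of_overlap h hz)]
  exact (h z hz).2.2

variable (M)

/-- The atlas of the antitangent bundle. -/
def bundleAtlas : SuperAtlas M.bundleCore.TotalSpace (ι ⊕ κ) (κ ⊕ ι) (Chart M.O ι κ) where
  φ := M.bundleChart
  exists_mem p := (M.exists_chart p.1).imp fun c hc => (mem_bundleChart_source c).2 hc
  τ c c' _ _ h := c.trans c' (le_cyl_of_overlap h) (tmap_mem_of_overlap h)
  τ_self c _ _ _ hO f := c.trans_self _ _ hO f
  τ_τ _ _ _ _ _ _ _ _ _ f := Chart.trans_trans _ _ _ _ _ _ f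
  inv_τ _ _ _ _ _ f := Chart.inv_trans _ _ f

/-- The projection of the underlying spaces. -/
def bundleProj : C(M.bundleCore.TotalSpace, M.X) :=
  ⟨M.bundleCore.proj, M.bundleCore.continuous_proj⟩

variable {M} in
theorem img_le_cyl {V : Opens M.X} {O : Opens (ι ⊕ κ → ℝ)}
    (h : O ≤ M.bundleAtlas.img c (Opens.comap M.bundleProj V)) : O ≤ c.cyl V := fun _ hz =>
  ⟨(mem_bundleChart_target c).1 (h hz).1, (h hz).2⟩

/-- The pull-back of functions to the antitangent bundle in the charts. -/
def bundleLift (c : Chart M.O ι κ) (V : Opens M.X) (O : Opens (ι ⊕ κ → ℝ))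
    (h : O ≤ M.bundleAtlas.img c (Opens.comap M.bundleProj V)) :
    M.O.Sec V →ₐ[ℝ] Model (ι ⊕ κ) (κ ⊕ ι) O := c.lift (img_le_cyl c h)

/-- The projection of the antitangent bundle. -/
def antitangentProj : Hom M.bundleAtlas.supermanifold M :=
  M.bundleAtlas.homTo M.bundleProj M.bundleLift
    (fun _ _ _ _ _ h _ _ f => Chart.trans_lift _ (tmap_mem_of_overlap h) _ _ f)
    (fun c _ _ _ _ _ h f => c.lift_res _ h f)
    (fun c _ _ _ _ _ hf => c.lift_mem_par _ hf)

/-- The de Rham differential of the antitangent bundle. -/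
def antitangentD : OddVectorField M.bundleAtlas.supermanifold :=
  M.bundleAtlas.vectorField (fun _ => Model.deRham)
    (fun _ _ _ _ h f => Chart.trans_deRham _ (tmap_mem_of_overlap h) f) (fun _ _ h f => Model.deRham_res h f)
    (fun _ f => Model.inv_deRham f) (fun _ f g => Model.deRham_mul f g)

theorem bundleAtlas_chart_dom (c : Chart M.O ι κ) :
    (M.bundleAtlas.chart c).dom = Opens.comap M.bundleProj c.dom :=
  Opens.ext (Set.ext fun _ => mem_bundleChart_source c)

variable {M}

theorem le_cyl_dom {W : Opens M.bundleCore.TotalSpace} (hW : W ≤ (M.bundleAtlas.chart c).dom) :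
    M.bundleAtlas.img c' W ≤ c'.cyl c.dom := fun _ hz =>
  ⟨(mem_bundleChart_target c').1 hz.1, (mem_bundleChart_source c).1 (hW hz.2)⟩

theorem tmap_mem_chart_img : ∀ z ∈ M.bundleAtlas.img c' (M.bundleAtlas.chart c).dom,
    c'.tmap c z ∈ (M.bundleAtlas.chart c).img :=
  tmap_mem_of_overlap (M.bundleAtlas.overlap_of_image_eq c c' subset_rfl
    (M.bundleChart c).image_source_eq_target)

theorem component_even (s : ι ⊕ κ) :
    M.bundleAtlas.component c' ((M.bundleAtlas.chart c).even s) =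
      c'.tEven c (le_cyl_dom c c' le_rfl) s := Chart.trans_even _ (tmap_mem_chart_img c c') s

theorem component_odd (s : κ ⊕ ι) :
    M.bundleAtlas.component c' ((M.bundleAtlas.chart c).odd s) =
      c'.tOdd c (le_cyl_dom c c' le_rfl) s := Chart.trans_odd _ (tmap_mem_chart_img c c') s

theorem component_res_pull (V : Opens M.X) {W : Opens M.bundleCore.TotalSpace}
    (h : W ≤ Opens.comap M.bundleProj V) (k : M.bundleAtlas.img c W ≤ c.cyl V) (f : M.O.Sec V) :
    M.bundleAtlas.component c (M.bundleAtlas.res h (M.antitangentProj.pull V f)) = c.lift k f :=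
  c.res_lift (img_le_cyl c le_rfl) (M.bundleAtlas.img_mono c h) f

theorem component_res_d_pull (V : Opens M.X) {W : Opens M.bundleCore.TotalSpace}
    (h : W ≤ Opens.comap M.bundleProj V) (k : M.bundleAtlas.img c W ≤ c.cyl V) (f : M.O.Sec V) :
    M.bundleAtlas.component c (M.bundleAtlas.res h
      (M.antitangentD.map _ (M.antitangentProj.pull V f))) = Model.deRham (c.lift k f) :=
  (Model.deRham_res (M.bundleAtlas.img_mono c h) _).symm.trans
    (congrArg Model.deRham (c.res_lift (img_le_cyl c le_rfl) (M.bundleAtlas.img_mono c h) f))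

variable (M)

/-- Every supermanifold has an antitangent bundle. -/
def antitangentBundle : AntitangentBundle M where
  total := M.bundleAtlas.supermanifold
  proj := M.antitangentProj
  d := M.antitangentD
  exists_chart c := by
    refine ⟨M.bundleAtlas.chart c, M.bundleAtlas_chart_dom c, ?_, fun μ => ?_, fun j => ?_,
      fun j => ?_, fun μ => ?_⟩
    · exact Set.ext fun z => mem_bundleChart_target c
    -- Sections are compared in every chart c'. There both sides are the pulled-back coordinates of
    -- c or, in the last two cases, their differentials.
    · exact SuperAtlas.Sec.ext fun c' => (component_even c c' _).trans
        (component_res_pull c' c.dom (M.bundleAtlas_chart_dom c).le _ _).symm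
    · exact SuperAtlas.Sec.ext fun c' => (component_odd c c' _).trans
        (component_res_pull c' c.dom (M.bundleAtlas_chart_dom c).le _ _).symm
    · exact SuperAtlas.Sec.ext fun c' => (component_even c c' _).trans
        (component_res_d_pull c' c.dom (M.bundleAtlas_chart_dom c).le _ _).symm
    · exact SuperAtlas.Sec.ext fun c' => (component_odd c c' _).trans
        (component_res_d_pull c' c.dom (M.bundleAtlas_chart_dom c).le _ _).symm
  d_d c a := SuperAtlas.Sec.ext fun c' => Model.deRham_deRham _

end Supermanifold

end Super

end

theorem mainTheorem6 {n m : ℕ} (M : Super.QManifold.{u} (Fin n) (Fin m)) :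
    Nonempty (Super.AntitangentBundle M.M) ∧
    ∀ T : Super.AntitangentBundle M.M,
      ∃ hd : T.d.IsHomological,
        ∃ a : Super.Hom M.M T.total,
          Super.IsOddAnchor M.Q T a ∧
          (∀ b : Super.Hom M.M T.total, Super.IsOddAnchor M.Q T b → b = a) ∧
          Super.IsQMorphism M ⟨T.total, T.d, hd⟩ a := by
  refine ⟨⟨M.M.antitangentBundle⟩, fun T => ?_⟩
  obtain ⟨a, ha⟩ := T.exists_isOddAnchor M.Q
  exact ⟨T.d_isHomological, a, ha, fun b hb => hb.eq ha, fun V f => ha.map_d M.homological V f⟩
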